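/- Let $M$ be a compact connected topological manifold, possibly with boundary, with a compatible metric, let $\varphi$ be a continuous flow on $M$ (defined for all times), fix $T>0$, and let $\alpha\in H^1(M,\mathbb{R})$. **Pseudo-orbits.** Let $N$ be $M$ or a covering of $M$, with the lifted flow $\psi$ and a metric. An $(\epsilon,T)$-pseudo-orbit of length $l>0$ in $N$ is a right-continuous curve $\gamma\colon[0,l)\to N$ that is continuous outside a finite set $\Delta\subset[0,l)$ disjoint from $[0,T)$, whose points are pairwise at distance at least $T$, such that $\gamma(s)=\psi_{s-t}(\gamma(t))$ whenever $\gamma$ is continuous on $[t,s]$, and such that for every $u\in\Delta$ the left limit $\gamma(u^-)$ exists and is at distance less than $\epsilon$ from $\gamma(u)$. A periodic $(\epsilon,T)$-pseudo-orbit of length $l>0$ is a map $\gamma\colon\mathbb{R}/l\mathbb{Z}\to M$ with the same properties for the flow $\varphi$, where instead of the conditions on $\Delta\subset[0,l)$ one asks that the lift to $\mathbb{R}$ of the finite set $\Delta\subset\mathbb{R}/l\mathbb{Z}$ has points pairwise at distance at least $T$. An $\epsilon$-realization of it is a closed curve obtained by inserting, at each discontinuity time $u$, a curve from $\gamma(u^-)$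 to $\gamma(u)$ inside the $\epsilon$-ball centered at $\gamma(u)$. For small $\epsilon$ all $\epsilon$-realizations of $\gamma$ have the same homology class, denoted by $[\gamma]\in H_1(M,\mathbb{R})$. **Asymptotic pseudo-directions.** Let $D_{\varphi,\epsilon,T}\subset H_1(M,\mathbb{R})$ be the closure of the set of all $\frac{1}{\mathrm{len}(\gamma)}[\gamma]$, for $\gamma$ a periodic $(\epsilon,T)$-pseudo-orbit, and $D_\varphi=\bigcap_{\epsilon>0}D_{\varphi,\epsilon,T}$ (only small $\epsilon$ matter). **$\alpha$-recurrence.** Let $\mathrm{Rec}_\alpha$ be the set of $x\in M$ such that for all small $\epsilon>0$ and all $T'>0$ there is a periodic $(\epsilon,T')$-pseudo-orbit $\gamma$ through $x$ with $\alpha([\gamma])=0$. **Quasi-Lyapunov classes.** Let $\pi_\alpha\colon\widehat M_\alpha\to M$ be the Abelian covering associated to $\alpha$, that is, the quotient of the universal covering of $M$ by the kernel of $\pi_1(M)\to H_1(M,\mathbb{Z})\xrightarrow{\alpha}\mathbb{R}$, on which $H_1(M,\mathbb{Z})$ acts by deck transformations. Equip it with the lifted flow and with any compatible metric that is invariant under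 deck transformations and for which $\pi_\alpha$ is isometric on every ball of some fixed radius $r>0$. A map $f\colon\widehat M_\alpha\to\mathbb{R}$ is $\alpha$-equivariant if $f(\delta\cdot x)=\alpha(\delta)+f(x)$ for all $x\in\widehat M_\alpha$ and all $\delta\in H_1(M,\mathbb{Z})$. The class $\alpha$ is quasi-Lyapunov if for every continuous $\alpha$-equivariant map $f\colon\widehat M_\alpha\to\mathbb{R}$ there are $C\ge0$ and $\epsilon>0$ such that $f(\gamma(0))\ge f(\gamma(t))-C$ for every $(\epsilon,T)$-pseudo-orbit $\gamma$ in $\widehat M_\alpha$ and every $t\in[0,\mathrm{len}(\gamma))$. **Proposition.** We have $\alpha(v)<0$ for all $v\in D_\varphi$ if and only if $\alpha$ is quasi-Lyapunov and $\mathrm{Rec}_\alpha$ is empty. -/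

import Mathlib

open CategoryTheory AlgebraicTopology Set Filter Topology

universe u

noncomputable section

namespace AsympDir

/-! ### Singular homology in degree one -/

/-- The singular chain complex of `M` with real coefficients. -/
abbrev singChains (M : Type u) [TopologicalSpace M] : ChainComplex (ModuleCat.{u} ℝ) ℕ :=
  ((singularChainComplexFunctor (ModuleCat.{u} ℝ)).obj (ModuleCat.of ℝ (ULift.{u} ℝ))).obj
    (TopCat.of M)

/-- The first singular homology `H₁(M; ℝ)`; it is by definition the value at `M` of the functor
`singularHomologyFunctor` in degree `1` with real coefficients. -/
abbrev H1 (M : Type u) [TopologicalSpace M] : ModuleCat.{u} ℝ := (singChains M).homology 1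

/-- The first cohomology `H¹(M; ℝ)`, identified with the dual of `H₁(M; ℝ)` by the pairing of a
class with a cycle (universal coefficients over a field). -/
abbrev CohomH1 (M : Type u) [TopologicalSpace M] : Type u := Module.Dual ℝ (H1 M)

variable {M : Type u}

/-- The singular `1`-simplex given by a curve `c : [0,1] → M`; vertex `0` goes to `c 0` and
vertex `1` to `c 1`. -/
def pathSimplex [TopologicalSpace M] (c : C(unitInterval, M)) :
    (TopCat.toSSet.obj (TopCat.of M)).obj (Opposite.op (SimplexCategory.mk 1)) :=
  (TopCat.toSSetObjEquiv (TopCat.of M) (Opposite.op (SimplexCategory.mk 1))).symm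
    (c.comp (stdSimplexHomeomorphUnitInterval : C(stdSimplex ℝ (Fin 2), unitInterval)))

/-- A curve `c : [0,1] → M`, seen as a singular `1`-chain with coefficient `1`. -/
def pathChain [TopologicalSpace M] (c : C(unitInterval, M)) : (singChains M).X 1 :=
  (SSet.ιChainComplex (TopCat.toSSet.obj (TopCat.of M)) (R := ModuleCat.of ℝ (ULift.{u} ℝ))
    (pathSimplex c)).hom (ULift.up 1)

/-- The singular `1`-chain `z` is a cycle, and `h` is its homology class. -/
def IsHomologyClass [TopologicalSpace M] (z : (singChains M).X 1) (h : H1 M) : Prop :=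
  ∃ w : (singChains M).cycles 1,
    ((singChains M).iCycles 1).hom w = z ∧ ((singChains M).homologyπ 1).hom w = h

/-! ### Manifolds -/

/-- A (finite-dimensional) topological manifold, possibly with boundary.  The first case covers
empty boundary, in every dimension (also `0`). -/
def IsTopManifold (M : Type u) [TopologicalSpace M] : Prop :=
  (∃ n : ℕ, Nonempty (ChartedSpace (EuclideanSpace ℝ (Fin n)) M)) ∨
    ∃ (n : ℕ) (_ : NeZero n), Nonempty (ChartedSpace (EuclideanHalfSpace n) M)

/-! ### Pseudo-orbits -/

/-- `γ`, restricted to `[0, l)`, is an `(ε, T)`-pseudo-orbit of length `l` of the flow `ψ`, where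
jumps are measured by the distance function `d`. -/
def IsPseudoOrbit {N : Type u} [TopologicalSpace N] (d : N → N → ℝ) (ψ : ℝ → N → N)
    (ε T l : ℝ) (γ : ℝ → N) : Prop :=
  0 < l ∧
  (∀ t ∈ Ico 0 l, ContinuousWithinAt γ (Ico t l) t) ∧
  ∃ Δ : Set ℝ, Δ.Finite ∧ Δ ⊆ Ico 0 l ∧ Disjoint Δ (Ico 0 T) ∧
    (∀ t ∈ Ico 0 l, t ∉ Δ → ContinuousWithinAt γ (Ico 0 l) t) ∧
    (∀ s ∈ Δ, ∀ t ∈ Δ, s ≠ t → T ≤ |s - t|) ∧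
    (∀ t s, 0 ≤ t → t ≤ s → s < l → ContinuousOn γ (Icc t s) → γ s = ψ (s - t) (γ t)) ∧
    (∀ t ∈ Δ, ∃ y, Tendsto γ (𝓝[<] t) (𝓝 y) ∧ d (γ t) y < ε)

/-- `γ` is the lift to `ℝ` of a periodic `(ε, T)`-pseudo-orbit `ℝ / lℤ → M` of the flow `φ`.  The
set `Δ` is the lift to `ℝ` of the set of jump times, so that successive jumps around the circle are
distant by at least `T`, also when there is only one jump time in a period. -/
def IsPeriodicPseudoOrbit [MetricSpace M] (φ : Flow ℝ M) (ε T l : ℝ) (γ : ℝ → M) : Prop :=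
  0 < l ∧ Function.Periodic γ l ∧
  (∀ t, ContinuousWithinAt γ (Ici t) t) ∧
  ∃ Δ : Set ℝ, (∀ t, t + l ∈ Δ ↔ t ∈ Δ) ∧ (Δ ∩ Ico 0 l).Finite ∧
    (∀ t, t ∉ Δ → ContinuousAt γ t) ∧
    (∀ s ∈ Δ, ∀ t ∈ Δ, s ≠ t → T ≤ |s - t|) ∧
    (∀ t s, t ≤ s → ContinuousOn γ (Icc t s) → γ s = φ (s - t) (γ t)) ∧
    (∀ t ∈ Δ, ∃ y, Tendsto γ (𝓝[<] t) (𝓝 y) ∧ dist (γ t) y < ε)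

/-- The closed curve `δ` is an `ε`-realization of the `l`-periodic curve `γ`: up to
parametrization by the nondecreasing map `σ`, it follows `γ` once around, and at every discontinuity
time `u` of `γ` a curve that stays in the `ε`-ball centered at `γ u` is inserted.  (Continuity of
`δ` forces the inserted curve to go from the left limit of `γ` at `u` to `γ u`; if `0` is a
discontinuity time, the curve inserted there may be cut into a first and a last part of `δ`.) -/
def IsRealization [MetricSpace M] (ε l : ℝ) (γ : ℝ → M) (δ : C(unitInterval, M)) : Prop :=
  δ 0 = δ 1 ∧ ∃ σ : unitInterval → ℝ, Continuous σ ∧ Monotone σ ∧ σ 0 = 0 ∧ σ 1 = l ∧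
    ∀ s, (ContinuousAt γ (σ s) → δ s = γ (σ s)) ∧
      (¬ ContinuousAt γ (σ s) → δ s ∈ Metric.ball (γ (σ s)) ε)

/-- `h` is the homology class of an `ε`-realization of the `l`-periodic curve `γ`.  For small `ε`
this determines `h`, the class `[γ]`. -/
def IsClassOf [MetricSpace M] (ε l : ℝ) (γ : ℝ → M) (h : H1 M) : Prop :=
  ∃ δ : C(unitInterval, M), IsRealization ε l γ δ ∧ IsHomologyClass (pathChain δ) h

/-! ### Asymptotic pseudo-directions and the `α`-recurrent set -/

/-- The closure of the set of all `[γ] / len γ`, for `γ` a periodic `(ε, T)`-pseudo-orbit.  The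
closure is taken for the canonical topology of the finite-dimensional real vector space `H₁(M; ℝ)`.
-/
def pseudoDirections [MetricSpace M] (φ : Flow ℝ M) (ε T : ℝ) : Set (H1 M) :=
  @closure (H1 M) (moduleTopology ℝ (H1 M))
    {v | ∃ (l : ℝ) (γ : ℝ → M) (h : H1 M),
      IsPeriodicPseudoOrbit φ ε T l γ ∧ IsClassOf ε l γ h ∧ v = l⁻¹ • h}

/-- The set `D_φ` of asymptotic pseudo-directions.  The sets in the intersection decrease with `ε`,
so only small `ε` matter. -/
def asympPseudoDirections [MetricSpace M] (φ : Flow ℝ M) (T : ℝ) : Set (H1 M) :=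
  ⋂ (ε : ℝ) (_ : 0 < ε), pseudoDirections φ ε T

/-- The `α`-recurrent set.  The condition gets stronger as `ε` decreases, so only small `ε` matter.
-/
def alphaRecurrentSet [MetricSpace M] (φ : Flow ℝ M) (α : CohomH1 M) : Set M :=
  {x | ∀ ε > 0, ∀ T > 0, ∃ (l : ℝ) (γ : ℝ → M) (h : H1 M),
    IsPeriodicPseudoOrbit φ ε T l γ ∧ (∃ t, γ t = x) ∧ IsClassOf ε l γ h ∧ α h = 0}

/-! ### The Abelian covering associated to `α` -/

/-- Curves starting at `x₀`, with the compact-open topology. -/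
abbrev PathsFrom [TopologicalSpace M] (x₀ : M) : Type u := {c : C(unitInterval, M) // c 0 = x₀}

/-- Two curves starting at `x₀` are identified when they have the same endpoint and `α` vanishes
on the closed curve that they form.  This is the quotient of the universal covering (curves up to
homotopy with fixed ends) by the kernel of `π₁(M) → H₁(M; ℤ) → ℝ`, the second map being `α`. -/
def coverSetoid [TopologicalSpace M] (α : CohomH1 M) (x₀ : M) : Setoid (PathsFrom x₀) where
  r c c' := c.1 1 = c'.1 1 ∧
    ∃ h : H1 M, IsHomologyClass (pathChain c'.1 - pathChain c.1) h ∧ α h = 0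
  iseqv :=
    { refl := fun c => ⟨rfl, 0, ⟨0, by simp, by simp⟩, by simp⟩
      symm := by
        rintro c c' ⟨he, h, ⟨w, hw, hh⟩, ha⟩
        exact ⟨he.symm, -h, ⟨-w, by simp [hw], by simp [hh]⟩, by simp [ha]⟩
      trans := by
        rintro c c' c'' ⟨he, h, ⟨w, hw, hh⟩, ha⟩ ⟨he', h', ⟨w', hw', hh'⟩, ha'⟩
        exact ⟨he.trans he', h + h', ⟨w + w', by simp [hw, hw'], by simp [hh, hh']⟩,
          by simp [ha, ha']⟩ }

/-- The covering `M̂_α` of `M` associated to `α`, with the quotient topology. -/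
def Cover [TopologicalSpace M] (α : CohomH1 M) (x₀ : M) : Type u := Quotient (coverSetoid α x₀)

instance [TopologicalSpace M] (α : CohomH1 M) (x₀ : M) : TopologicalSpace (Cover α x₀) :=
  inferInstanceAs (TopologicalSpace (Quotient (coverSetoid α x₀)))

/-- The point of `M̂_α` given by a curve starting at `x₀`. -/
def Cover.mk [TopologicalSpace M] (α : CohomH1 M) {x₀ : M} (c : PathsFrom x₀) : Cover α x₀ :=
  Quotient.mk (coverSetoid α x₀) c

/-- The covering map `M̂_α → M`. -/
def Cover.proj [TopologicalSpace M] {α : CohomH1 M} {x₀ : M} : Cover α x₀ → M :=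
  Quotient.lift (fun c => c.1 1) fun _ _ h => h.1

/-- `y = h • x` for the action of the deck transformations on `M̂_α`, where `h` is (the real image
of) a class in `H₁(M; ℤ)`: if `x` is given by the curve `c`, then `h • x` is given by a curve `c'`
with the same endpoint such that `c' - c` is a cycle in the class `h`.  (If `h` is the class of a
loop `ℓ` based at `x₀`, one such `c'` is `ℓ` followed by `c`.) -/
def Cover.IsTranslate [TopologicalSpace M] {α : CohomH1 M} {x₀ : M} (h : H1 M)
    (x y : Cover α x₀) : Prop :=
  ∃ c c' : PathsFrom x₀, Cover.mk α c = x ∧ Cover.mk α c' = y ∧ c.1 1 = c'.1 1 ∧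
    IsHomologyClass (pathChain c'.1 - pathChain c.1) h

/-- The map `f : M̂_α → ℝ` is `α`-equivariant. -/
def IsEquivariant [TopologicalSpace M] {α : CohomH1 M} {x₀ : M} (f : Cover α x₀ → ℝ) : Prop :=
  ∀ (h : H1 M) (x y : Cover α x₀), Cover.IsTranslate h x y → f y = α h + f x

/-- The curve `s ↦ φ_{st}(c(s))`, from `x₀` to `φ_t(c(1))`.  It is homotopic with fixed ends to `c`
followed by the orbit arc from `c(1)` to `φ_t(c(1))`. -/
def flowPath [TopologicalSpace M] (φ : Flow ℝ M) {x₀ : M} (t : ℝ) (c : PathsFrom x₀) :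
    PathsFrom x₀ :=
  ⟨⟨fun s => φ ((s : ℝ) * t) (c.1 s),
      φ.continuous (continuous_subtype_val.mul continuous_const) c.1.continuous⟩,
    by simp [c.2]⟩

/-- The lift of the flow `φ` to `M̂_α`.  (The result does not depend on the curve that is chosen to
represent `x`.) -/
def liftFlow [TopologicalSpace M] (φ : Flow ℝ M) {α : CohomH1 M} {x₀ : M} (t : ℝ)
    (x : Cover α x₀) : Cover α x₀ :=
  Cover.mk α (flowPath φ t (Quotient.out x))

/-- `d` is a lift to `M̂_α` of the metric of `M`: it is compatible with the topology, invariant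
under deck transformations, and the covering map is isometric on all balls of some fixed radius. -/
structure IsLiftedMetric [MetricSpace M] {α : CohomH1 M} {x₀ : M}
    (d : MetricSpace (Cover α x₀)) : Prop where
  compatible : d.toPseudoMetricSpace.toUniformSpace.toTopologicalSpace =
    (inferInstance : TopologicalSpace (Cover α x₀))
  invariant : ∀ (h : H1 M) (x x' y y' : Cover α x₀),
    Cover.IsTranslate h x x' → Cover.IsTranslate h y y' → d.dist x' y' = d.dist x y
  isometric : ∃ r > 0, ∀ z x y : Cover α x₀, d.dist z x < r → d.dist z y < r →
    d.dist x y = dist x.proj y.proj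

/-! ### Quasi-Lyapunov classes -/

/-- The map `f : M̂_α → ℝ` is `C`-quasi-Lyapunov. -/
def IsQuasiLyapunovWith [MetricSpace M] (φ : Flow ℝ M) (T : ℝ) {α : CohomH1 M} {x₀ : M}
    (d : MetricSpace (Cover α x₀)) (C : ℝ) (f : Cover α x₀ → ℝ) : Prop :=
  ∃ ε > 0, ∀ (l : ℝ) (γ : ℝ → Cover α x₀),
    IsPseudoOrbit d.dist (liftFlow φ) ε T l γ → ∀ t ∈ Ico 0 l, f (γ t) - C ≤ f (γ 0)

/-- The class `α` is quasi-Lyapunov: every continuous `α`-equivariant map `M̂_α → ℝ` is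
`C`-quasi-Lyapunov for some `C ≥ 0`. -/
def IsQuasiLyapunov [MetricSpace M] (φ : Flow ℝ M) (T : ℝ) (α : CohomH1 M) (x₀ : M)
    (d : MetricSpace (Cover α x₀)) : Prop :=
  ∀ f : Cover α x₀ → ℝ, Continuous f → IsEquivariant f →
    ∃ C ≥ 0, IsQuasiLyapunovWith φ T d C f

end AsympDir

end

/-!
The class `α` assigns a number to every curve in `M`, additively under concatenation, so that the
flow lifts to a skew product on `M × ℝ`, into which the covering `M̂_α` embeds by projection and
height. Consider closed chains of long orbit arcs followed by small jumps, and the change of height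
along them. Closing them up to periodic pseudo-orbits shows that it is negative if `α < 0` on `D_φ`.
If `α` is quasi-Lyapunov, it is not positive, since going around many times costs only the constant
`C`; and if `Rec_α` is empty, it does not vanish, by compactness.

The passage from these signs to uniform bounds is a pigeonhole argument. Heights above the graph of
a suitable discontinuous function on `M` change in bounded time only by elements of a finite set,
and a finite net of `M` shadows pseudo-orbits by walks in a finite graph. Decomposing the walks into
loops, of which only finitely many heights occur, one sees that heights are bounded above along all
pseudo-orbits if no closed chain ascends, and decrease linearly if all closed chains descend.
-/

noncomputable section

namespace AsympDir

/-! ### Path cocycles -/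

/-- A path cocycle is an additive functional on curves, such as the integral of a closed form.
Additivity under concatenation and invariance under homotopy are both encoded by the single
condition that the values on the sides of every singular triangle add up. -/
structure PathCocycle (M : Type*) (A : Type*) [TopologicalSpace M] [AddCommGroup A] where
  toFun : C(unitInterval, M) → A
  triangle : ∀ (H : C(ℝ × ℝ, M)) (p q r : ℝ × ℝ),
    toFun (H.comp (Path.segment p q).toContinuousMap) +
      toFun (H.comp (Path.segment q r).toContinuousMap) =
        toFun (H.comp (Path.segment p r).toContinuousMap)

instance {M A : Type*} [TopologicalSpace M] [AddCommGroup A] :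
    CoeFun (PathCocycle M A) (fun _ => C(unitInterval, M) → A) := ⟨PathCocycle.toFun⟩

namespace PathCocycle

variable {M A : Type*} [TopologicalSpace M] [AddCommGroup A] (Θ : PathCocycle M A)

/-- The image of a path cocycle under an additive map of the coefficients. -/
def map {B : Type*} [AddCommGroup B] (f : A →+ B) : PathCocycle M B where
  toFun c := f (Θ c)
  triangle H p q r := by rw [← map_add, Θ.triangle]

/-- The value of a path cocycle on the curve `c` between the times `a` and `b`, which may come in
any order. -/
def along (c : C(ℝ, M)) (a b : ℝ) : A := Θ (c.comp (Path.segment a b).toContinuousMap)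

lemma along_congr {c c' : C(ℝ, M)} {a b a' b' : ℝ}
    (h : ∀ s : unitInterval, c (a + s * (b - a)) = c' (a' + s * (b' - a'))) :
    Θ.along c a b = Θ.along c' a' b' :=
  congrArg Θ <| ContinuousMap.ext fun s => by
    simpa [AffineMap.lineMap_apply_module', add_comm] using h s

lemma along_add_along (c : C(ℝ, M)) (a b d : ℝ) :
    Θ.along c a b + Θ.along c b d = Θ.along c a d := by
  have h (a b : ℝ) : c.comp (Path.segment a b).toContinuousMap =
      (c.comp .fst : C(ℝ × ℝ, M)).comp (Path.segment (a, 0) (b, 0)).toContinuousMap := by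
    ext s
    simp [AffineMap.lineMap_apply]
  simpa only [along, h] using Θ.triangle (c.comp .fst) (a, 0) (b, 0) (d, 0)

@[simp] lemma along_self (c : C(ℝ, M)) (a : ℝ) : Θ.along c a a = 0 := by
  simpa using Θ.along_add_along c a a a

lemma along_extend {x y : M} (p : Path x y) : Θ.along p.extend 0 1 = Θ p :=
  congrArg Θ <| ContinuousMap.ext fun s => by simp [AffineMap.lineMap_apply]

lemma map_const (x : M) : Θ (.const _ x) = 0 :=
  Θ.along_self (.const _ x) 0

lemma map_refl (x : M) : Θ (Path.refl x) = 0 :=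
  Θ.map_const x

lemma map_trans {x y z : M} (p : Path x y) (q : Path y z) : Θ (p.trans q) = Θ p + Θ q := by
  rw [← Θ.along_extend, ← Θ.along_add_along _ 0 (1 / 2) 1, ← Θ.along_extend p, ← Θ.along_extend q]
  congr 1 <;> refine Θ.along_congr fun s => ?_
  · rw [Path.extend_trans_of_le_half _ _ (by linarith [s.2.2])]
    ring_nf
  · rw [Path.extend_trans_of_half_le _ _ (by linarith [s.2.1])]
    ring_nf

lemma map_symm {x y : M} (p : Path x y) : Θ p.symm = -Θ p := by
  rw [eq_neg_iff_add_eq_zero, ← Θ.along_extend, ← Θ.along_extend, add_comm,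
    ← Θ.along_self p.extend 0, ← Θ.along_add_along p.extend 0 1 0]
  congr 1
  refine Θ.along_congr fun s => ?_
  rw [Path.extend_symm_apply]
  ring_nf

lemma map_diagonal (G : C(unitInterval × unitInterval, M)) {b r d : C(unitInterval, M)}
    (hb : ∀ s, G (s, 0) = b s) (hr : ∀ u, G (1, u) = r u) (hd : ∀ s, G (s, s) = d s) :
    Θ d = Θ b + Θ r := by
  let H : C(ℝ × ℝ, M) := G.comp
    ⟨Prod.map (projIcc 0 1 zero_le_one) (projIcc 0 1 zero_le_one), by fun_prop⟩
  have hb' : H.comp (Path.segment (0, 0) (1, 0)).toContinuousMap = b := by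
    ext s
    simp [H, ← hb, AffineMap.lineMap_apply]
  have hr' : H.comp (Path.segment (1, 0) (1, 1)).toContinuousMap = r := by
    ext s
    simp [H, ← hr, AffineMap.lineMap_apply]
  have hd' : H.comp (Path.segment (0, 0) (1, 1)).toContinuousMap = d := by
    ext s
    simp [H, ← hd, AffineMap.lineMap_apply]
  rw [← hb', ← hr', ← hd', Θ.triangle]

lemma map_square (G : C(unitInterval × unitInterval, M)) {b t l r : C(unitInterval, M)}
    (hb : ∀ s, G (s, 0) = b s) (ht : ∀ s, G (s, 1) = t s) (hl : ∀ u, G (0, u) = l u)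
    (hr : ∀ u, G (1, u) = r u) : Θ b + Θ r = Θ l + Θ t := by
  let d : C(unitInterval, M) := G.comp ((ContinuousMap.id _).prodMk (ContinuousMap.id _))
  rw [← Θ.map_diagonal G (d := d) hb hr fun _ => rfl,
    ← Θ.map_diagonal (G.comp .prodSwap) (d := d) hl ht fun _ => rfl]

lemma map_comp_eq_along (c : C(ℝ, M)) (h : C(unitInterval, ℝ)) :
    Θ (c.comp h) = Θ.along c (h 0) (h 1) := by
  let G : C(unitInterval × unitInterval, M) := c.comp
    ⟨fun z => AffineMap.lineMap (h z.1) (Path.segment (h 0) (h 1) z.1) (z.2 : ℝ), by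
      simp only [AffineMap.lineMap_apply_module']; fun_prop⟩
  have h_square := Θ.map_square G (b := c.comp h)
    (t := c.comp (Path.segment (h 0) (h 1)).toContinuousMap) (l := .const _ (c (h 0)))
    (r := .const _ (c (h 1))) (by simp [G]) (by simp [G]) (by simp [G]) (by simp [G])
  rwa [Θ.map_const, Θ.map_const, add_zero, zero_add] at h_square

end PathCocycle

/-! ### The skew product over a flow -/

section Raise

variable {M A : Type*}

/-- Translation of the second coordinate, which plays the role of a height above `M`. -/
def raise [Add A] (a : A) (X : M × A) : M × A := (X.1, X.2 + a)

@[simp] lemma raise_fst [Add A] (a : A) (X : M × A) : (raise a X).1 = X.1 := rfl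

@[simp] lemma raise_snd [Add A] (a : A) (X : M × A) : (raise a X).2 = X.2 + a := rfl

@[simp] lemma raise_zero [AddZeroClass A] (X : M × A) : raise 0 X = X := by simp [raise]

lemma raise_raise [AddSemigroup A] (a b : A) (X : M × A) :
    raise b (raise a X) = raise (a + b) X := by
  simp [raise, add_assoc]

end Raise

/-- The orbit of a point under a flow, as a curve defined for all times. -/
def orbit {M : Type*} [TopologicalSpace M] (φ : Flow ℝ M) (x : M) : C(ℝ, M) :=
  ⟨fun t => φ t x, φ.continuous continuous_id continuous_const⟩

@[simp] lemma orbit_apply {M : Type*} [TopologicalSpace M] (φ : Flow ℝ M) (x : M) (t : ℝ) :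
    orbit φ x t = φ t x := rfl

/-- The orbit arc from `x` to `φ t x`, parametrized by `[0, 1]`. -/
def orbitPath {M : Type*} [TopologicalSpace M] (φ : Flow ℝ M) (t : ℝ) (x : M) : Path x (φ t x) :=
  ((Path.segment 0 t).map (orbit φ x).continuous).cast (by simp) rfl

@[simp] lemma orbitPath_apply {M : Type*} [TopologicalSpace M] (φ : Flow ℝ M) (t : ℝ) (x : M)
    (s : unitInterval) : orbitPath φ t x s = φ (s * t) x := by
  change φ (AffineMap.lineMap 0 t (s : ℝ)) x = φ (s * t) x
  simp [AffineMap.lineMap_apply]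

namespace PathCocycle

variable {M A : Type*} [TopologicalSpace M] [AddCommGroup A] (Θ : PathCocycle M A) (φ : Flow ℝ M)

/-- The cocycle over the flow `φ` induced by a path cocycle: its value on the orbit arc from `x` to
`φ t x`. -/
def onOrbit (t : ℝ) (x : M) : A := Θ.along (orbit φ x) 0 t

@[simp] lemma onOrbit_zero (x : M) : Θ.onOrbit φ 0 x = 0 :=
  Θ.along_self _ 0

lemma along_orbit (a b : ℝ) (x : M) :
    Θ.along (orbit φ x) a b = Θ.onOrbit φ (b - a) (φ a x) := by
  refine Θ.along_congr fun u => ?_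
  rw [orbit_apply, orbit_apply, ← Flow.map_add]
  ring_nf

lemma onOrbit_add (s t : ℝ) (x : M) :
    Θ.onOrbit φ (s + t) x = Θ.onOrbit φ s x + Θ.onOrbit φ t (φ s x) := by
  rw [onOrbit, ← Θ.along_add_along _ 0 s (s + t), Θ.along_orbit φ s, add_sub_cancel_left]
  rfl

lemma map_add_onOrbit (t : ℝ) {x y : M} (p : Path x y) :
    Θ p + Θ.onOrbit φ t y = Θ.onOrbit φ t x + Θ (p.map (φ.continuous_toFun t)) := by
  refine Θ.map_square ⟨fun z => φ (z.2 * t) (p z.1), φ.continuous (by fun_prop) (by fun_prop)⟩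
    ?_ ?_ ?_ ?_ <;> intro s <;> simp [AffineMap.lineMap_apply]

lemma map_flow_mul (t : ℝ) (c r : C(unitInterval, M)) (hr : ∀ s, r s = φ (s * t) (c s)) :
    Θ r = Θ c + Θ.onOrbit φ t (c 1) := by
  refine Θ.map_diagonal ⟨fun z => φ (z.2 * t) (c z.1), φ.continuous (by fun_prop) (by fun_prop)⟩
    ?_ ?_ ?_ <;> intro s <;> simp [hr, AffineMap.lineMap_apply]

/-- The skew product of a flow with a path cocycle. Its fibre coordinate, the height, records the
value of the cocycle. -/
def skew (t : ℝ) (X : M × A) : M × A := (φ t X.1, X.2 + Θ.onOrbit φ t X.1)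

@[simp] lemma skew_fst (t : ℝ) (X : M × A) : (Θ.skew φ t X).1 = φ t X.1 := rfl

lemma skew_snd (t : ℝ) (X : M × A) : (Θ.skew φ t X).2 = X.2 + Θ.onOrbit φ t X.1 := rfl

@[simp] lemma skew_zero (X : M × A) : Θ.skew φ 0 X = X := by
  simp [skew]

lemma skew_add (s t : ℝ) (X : M × A) : Θ.skew φ (s + t) X = Θ.skew φ t (Θ.skew φ s X) := by
  ext
  · simp [skew, add_comm s t, Flow.map_add]
  · simp [skew, onOrbit_add, add_assoc]

lemma skew_raise (t : ℝ) (X : M × A) (a : A) :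
    Θ.skew φ t (raise a X) = raise a (Θ.skew φ t X) := by
  simp [raise, skew, add_right_comm]

end PathCocycle

/-! ### The path cocycle of a cohomology class -/

section SimplexChain

variable {M : Type u} [TopologicalSpace M] {n : ℕ}

/-- A singular simplex of `M`, given by a continuous map on the standard simplex. -/
def singularSimplex (f : C(stdSimplex ℝ (Fin (n + 1)), M)) :
    (TopCat.toSSet.obj (TopCat.of M)).obj (Opposite.op (SimplexCategory.mk n)) :=
  (TopCat.toSSetObjEquiv (TopCat.of M) (Opposite.op (SimplexCategory.mk n))).symm f

/-- A singular simplex of `M`, seen as a singular chain with coefficient `1`. -/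
def simplexChain (x : (TopCat.toSSet.obj (TopCat.of M)).obj (Opposite.op (SimplexCategory.mk n))) :
    (singChains M).X n :=
  (SSet.ιChainComplex (TopCat.toSSet.obj (TopCat.of M)) (R := ModuleCat.of ℝ (ULift.{u} ℝ))
    x).hom (ULift.up 1)

lemma δ_singularSimplex (f : C(stdSimplex ℝ (Fin (n + 2)), M)) (i : Fin (n + 2)) :
    (TopCat.toSSet.obj (TopCat.of M)).δ i (singularSimplex f) =
      singularSimplex (f.comp ⟨stdSimplex.map i.succAbove, stdSimplex.continuous_map _⟩) :=
  rfl

lemma d_simplexChain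
    (x : (TopCat.toSSet.obj (TopCat.of M)).obj (Opposite.op (SimplexCategory.mk (n + 1)))) :
    ((singChains M).d (n + 1) n).hom (simplexChain x) =
      ∑ i : Fin (n + 2), (-1 : ℤ) ^ (i : ℕ) •
        simplexChain ((TopCat.toSSet.obj (TopCat.of M)).δ i x) := by
  let evalOne : (ModuleCat.of ℝ (ULift.{u} ℝ) ⟶ (singChains M).X n) →+ (singChains M).X n :=
    { toFun f := f.hom (ULift.up 1), map_zero' := rfl, map_add' _ _ := rfl }
  have h := congrArg evalOne (SSet.ιChainComplex_d (TopCat.toSSet.obj (TopCat.of M))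
    (R := ModuleCat.of ℝ (ULift.{u} ℝ)) x)
  exact h.trans ((map_sum evalOne _ _).trans
    (Finset.sum_congr rfl fun i _ => map_zsmul evalOne _ _))

lemma sum_stdSimplex_map_smul {ι κ E : Type*} [Fintype ι] [Fintype κ] [AddCommGroup E]
    [Module ℝ E] (f : ι → κ) (x : stdSimplex ℝ ι) (v : κ → E) :
    ∑ j, stdSimplex.map f x j • v j = ∑ i, x i • v (f i) := by
  classical
  simp_rw [stdSimplex.map_coe, FunOnFinite.linearMap_apply_apply, Finset.sum_smul,
    Finset.sum_filter]
  rw [Finset.sum_comm]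
  simp

/-- The affine singular simplex with given vertices. -/
def affineSimplex {E : Type*} [AddCommGroup E] [Module ℝ E] [TopologicalSpace E]
    [IsTopologicalAddGroup E] [ContinuousSMul ℝ E] (v : Fin (n + 1) → E) :
    C(stdSimplex ℝ (Fin (n + 1)), E) :=
  ⟨fun x => ∑ i, x i • v i, continuous_finsetSum _ fun i _ =>
    ((continuous_apply i).comp continuous_subtype_val).smul continuous_const⟩

lemma pathSimplex_comp_segment {E : Type*} [AddCommGroup E] [Module ℝ E] [TopologicalSpace E]
    [IsTopologicalAddGroup E] [ContinuousSMul ℝ E] (H : C(E, M)) (v : Fin 2 → E) :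
    pathSimplex (H.comp (Path.segment (v 0) (v 1)).toContinuousMap) =
      singularSimplex (H.comp (affineSimplex v)) := by
  refine congrArg singularSimplex (ContinuousMap.ext fun x => congrArg H ?_)
  change AffineMap.lineMap (v 0) (v 1) (x 1) = ∑ i, x i • v i
  rw [Fin.sum_univ_two, AffineMap.lineMap_apply_module, ← stdSimplex.add_eq_one x,
    add_sub_cancel_right]

lemma δ_singularSimplex_affineSimplex {E : Type*} [AddCommGroup E] [Module ℝ E]
    [TopologicalSpace E] [IsTopologicalAddGroup E] [ContinuousSMul ℝ E] (H : C(E, M))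
    (v : Fin (n + 2) → E) (i : Fin (n + 2)) :
    (TopCat.toSSet.obj (TopCat.of M)).δ i (singularSimplex (H.comp (affineSimplex v))) =
      singularSimplex (H.comp (affineSimplex (v ∘ i.succAbove))) := by
  rw [δ_singularSimplex]
  exact congrArg singularSimplex (ContinuousMap.ext fun x => congrArg H
    (sum_stdSimplex_map_smul i.succAbove x v))

end SimplexChain

section Homology

variable {M : Type u} [TopologicalSpace M]

lemma pOpcycles_pathChain_triangle (H : C(ℝ × ℝ, M)) (p q r : ℝ × ℝ) :
    ((singChains M).pOpcycles 1).hom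
        (pathChain (H.comp (Path.segment p q).toContinuousMap)) +
      ((singChains M).pOpcycles 1).hom
        (pathChain (H.comp (Path.segment q r).toContinuousMap)) =
      ((singChains M).pOpcycles 1).hom
        (pathChain (H.comp (Path.segment p r).toContinuousMap)) := by
  set τ := singularSimplex (H.comp (affineSimplex ![p, q, r]))
  have h_zero : ((singChains M).pOpcycles 1).hom
      (((singChains M).d 2 1).hom (simplexChain τ)) = 0 :=
    congrArg (fun f => f.hom (simplexChain τ)) ((singChains M).d_pOpcycles 2 1)
  have h_face (i : Fin 3) : simplexChain ((TopCat.toSSet.obj (TopCat.of M)).δ i τ) =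
      pathChain (H.comp (Path.segment (![p, q, r] (i.succAbove 0))
        (![p, q, r] (i.succAbove 1))).toContinuousMap) :=
    congrArg simplexChain ((δ_singularSimplex_affineSimplex H _ i).trans
      (pathSimplex_comp_segment H (![p, q, r] ∘ i.succAbove)).symm)
  have h_d : ((singChains M).d 2 1).hom (simplexChain τ) =
      pathChain (H.comp (Path.segment q r).toContinuousMap) -
        pathChain (H.comp (Path.segment p r).toContinuousMap) +
          pathChain (H.comp (Path.segment p q).toContinuousMap) := by
    refine (d_simplexChain τ).trans ((Fin.sum_univ_three _).trans ?_)
    rw [h_face 0, h_face 1, h_face 2]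
    change (-1 : ℤ) ^ 0 • pathChain (H.comp (Path.segment q r).toContinuousMap) +
      (-1 : ℤ) ^ 1 • pathChain (H.comp (Path.segment p r).toContinuousMap) +
        (-1 : ℤ) ^ 2 • pathChain (H.comp (Path.segment p q).toContinuousMap) = _
    simp [sub_eq_add_neg]
  rw [h_d, map_add, map_sub] at h_zero
  rw [← sub_eq_zero, ← h_zero]
  abel

lemma δ_pathSimplex (c : C(unitInterval, M)) (i : Fin 2) :
    (TopCat.toSSet.obj (TopCat.of M)).δ i (pathSimplex c) =
      singularSimplex (n := 0) (.const _ (if i = 0 then c 1 else c 0)) := by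
  refine (δ_singularSimplex _ i).trans (congrArg singularSimplex (ContinuousMap.ext fun x => ?_))
  rw [Subsingleton.elim x (stdSimplex.vertex 0)]
  change c (stdSimplexHomeomorphUnitInterval (stdSimplex.map i.succAbove _)) = _
  rw [stdSimplex.map_vertex]
  fin_cases i
  exacts [congrArg c stdSimplexHomeomorphUnitInterval_one,
    congrArg c stdSimplexHomeomorphUnitInterval_zero]

lemma d_pathChain (c : C(unitInterval, M)) :
    ((singChains M).d 1 0).hom (pathChain c) =
      simplexChain (singularSimplex (n := 0) (.const _ (c 1))) -
        simplexChain (singularSimplex (n := 0) (.const _ (c 0))) := by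
  refine (d_simplexChain (pathSimplex c)).trans ?_
  simp [δ_pathSimplex, sub_eq_add_neg]

lemma exists_isHomologyClass {z : (singChains M).X 1} (hz : ((singChains M).d 1 0).hom z = 0) :
    ∃ h, IsHomologyClass z h := by
  let f : ModuleCat.of ℝ (ULift.{u} ℝ) ⟶ (singChains M).X 1 := ModuleCat.ofHom
    ((LinearMap.toSpanSingleton ℝ _ z).comp ULift.moduleEquiv.toLinearMap)
  have hfz (r) : f.hom r = r.down • z := rfl
  have hf : f ≫ (singChains M).d 1 0 = 0 := by
    ext r
    change ((singChains M).d 1 0).hom (f.hom r) = 0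
    rw [hfz, map_smul, hz, smul_zero]
  refine ⟨_, ((singChains M).liftCycles f 0 (by simp) hf).hom (ULift.up 1), ?_, rfl⟩
  exact (congrArg (fun g => g.hom (ULift.up 1))
    ((singChains M).liftCycles_i f (j := 0) (by simp) hf)).trans ((hfz _).trans (one_smul _ _))

lemma exists_isHomologyClass_of_closed {c : C(unitInterval, M)} (h : c 0 = c 1) :
    ∃ k, IsHomologyClass (pathChain c) k :=
  exists_isHomologyClass (by rw [d_pathChain, h, sub_self])

lemma exists_isHomologyClass_sub {c c' : C(unitInterval, M)} (h0 : c 0 = c' 0) (h1 : c 1 = c' 1) :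
    ∃ k, IsHomologyClass (pathChain c' - pathChain c) k :=
  exists_isHomologyClass (by rw [map_sub, d_pathChain, d_pathChain, h0, h1, sub_self])

lemma IsHomologyClass.homologyι_eq {z : (singChains M).X 1} {h : H1 M}
    (hz : IsHomologyClass z h) :
    ((singChains M).homologyι 1).hom h = ((singChains M).pOpcycles 1).hom z := by
  obtain ⟨w, rfl, rfl⟩ := hz
  exact congrArg (fun f => f.hom w) ((singChains M).homology_π_ι 1)

variable (M) in
lemma exists_homologyι_leftInverse :
    ∃ π : (singChains M).opcycles 1 →ₗ[ℝ] H1 M,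
      ∀ h, π (((singChains M).homologyι 1).hom h) = h := by
  have h_inj : Function.Injective ((singChains M).homologyι 1).hom :=
    (ModuleCat.mono_iff_injective _).1 inferInstance
  obtain ⟨π, hπ⟩ := ((singChains M).homologyι 1).hom.exists_leftInverse_of_injective
    (LinearMap.ker_eq_bot.2 h_inj)
  exact ⟨π, fun h => LinearMap.congr_fun hπ h⟩

variable (M) in
/-- A linear retraction of the one-chains modulo boundaries onto the first homology. Its choice
extends homology classes to curves that are not closed. -/
def homologyRetraction : (singChains M).opcycles 1 →ₗ[ℝ] H1 M :=
  (exists_homologyι_leftInverse M).choose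

lemma IsHomologyClass.homologyRetraction_eq {z : (singChains M).X 1} {h : H1 M}
    (hz : IsHomologyClass z h) :
    homologyRetraction M (((singChains M).pOpcycles 1).hom z) = h := by
  rw [← hz.homologyι_eq]
  exact (exists_homologyι_leftInverse M).choose_spec h

variable (M) in
/-- The path cocycle with values in the first homology. On closed curves it is the homology
class. -/
def homologyCocycle : PathCocycle M (H1 M) where
  toFun c := homologyRetraction M (((singChains M).pOpcycles 1).hom (pathChain c))
  triangle H p q r := by rw [← map_add, pOpcycles_pathChain_triangle]

lemma homologyCocycle_eq {c : C(unitInterval, M)} {h : H1 M}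
    (hc : IsHomologyClass (pathChain c) h) : homologyCocycle M c = h :=
  hc.homologyRetraction_eq

lemma homologyCocycle_sub_eq {c c' : C(unitInterval, M)} {h : H1 M}
    (hc : IsHomologyClass (pathChain c' - pathChain c) h) :
    homologyCocycle M c' - homologyCocycle M c = h := by
  rw [← hc.homologyRetraction_eq, map_sub, map_sub]
  rfl

/-- The real path cocycle of a cohomology class. -/
def cohomCocycle (α : CohomH1 M) : PathCocycle M ℝ :=
  (homologyCocycle M).map (α : H1 M →ₗ[ℝ] ℝ).toAddMonoidHom

end Homology

/-! ### Chains for the skew product -/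

lemma uniformContinuous_flow {M : Type*} [UniformSpace M] [CompactSpace M] (φ : Flow ℝ M)
    (a b : ℝ) : UniformContinuous fun z : Icc a b × M => φ z.1 z.2 :=
  CompactSpace.uniformContinuous_of_continuous (φ.continuous (by fun_prop) (by fun_prop))

namespace PathCocycle

variable {M : Type*} [MetricSpace M] {A : Type*} [AddCommGroup A] (Θ : PathCocycle M A)

/-- `Θ.Near η X Y` means that `Y` is reached from `X` by lifting a curve that stays in the `η`-ball
centered at its end. It is the notion of a jump of size `η` in the skew product. -/
def Near (η : ℝ) (X Y : M × A) : Prop :=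
  ∃ p : Path X.1 Y.1, (∀ s, dist (p s) Y.1 < η) ∧ Y.2 = X.2 + Θ p

variable {Θ} {η η' : ℝ} {X Y Z : M × A}

lemma Near.dist_lt (h : Θ.Near η X Y) : dist X.1 Y.1 < η := by
  obtain ⟨p, hp, -⟩ := h
  simpa using hp 0

lemma Near.mono (h : Θ.Near η X Y) (hη : η ≤ η') : Θ.Near η' X Y := by
  obtain ⟨p, hp, hΘ⟩ := h
  exact ⟨p, fun s => (hp s).trans_le hη, hΘ⟩

lemma Near.refl (hη : 0 < η) (X : M × A) : Θ.Near η X X :=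
  ⟨.refl X.1, by simpa, by rw [Θ.map_refl, add_zero]⟩

lemma Near.trans (h : Θ.Near η X Y) (h' : Θ.Near η' Y Z) : Θ.Near (η + η') X Z := by
  have hη : 0 < η := dist_nonneg.trans_lt h.dist_lt
  have h_dist := h'.dist_lt
  obtain ⟨p, hp, hpΘ⟩ := h
  obtain ⟨q, hq, hqΘ⟩ := h'
  refine ⟨p.trans q, fun s => ?_, by rw [Θ.map_trans, hqΘ, hpΘ, add_assoc]⟩
  obtain ⟨u, hu⟩ | ⟨u, hu⟩ := Path.trans_range p q ▸ mem_range_self s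
  · rw [← hu]
    linarith [dist_triangle (p u) Y.1 Z.1, hp u]
  · rw [← hu]
    linarith [hq u]

lemma Near.symm (h : Θ.Near η X Y) : Θ.Near (2 * η) Y X := by
  have h_dist := h.dist_lt
  obtain ⟨p, hp, hΘ⟩ := h
  refine ⟨p.symm, fun s => ?_, by rw [Θ.map_symm, hΘ, add_neg_cancel_right]⟩
  change dist (p (unitInterval.symm s)) X.1 < 2 * η
  linarith [dist_triangle_right (p (unitInterval.symm s)) X.1 Y.1, hp (unitInterval.symm s)]

lemma Near.raise (h : Θ.Near η X Y) (a : A) : Θ.Near η (raise a X) (raise a Y) := by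
  obtain ⟨p, hp, hΘ⟩ := h
  exact ⟨p, hp, (congrArg (· + a) hΘ).trans (add_right_comm _ _ _)⟩

lemma Near.skew_add_right {φ : Flow ℝ M} {t : ℝ} {x y : M} {a b : A}
    (h : Θ.Near η (Θ.skew φ t (x, a)) (y, b)) (c : A) :
    Θ.Near η (Θ.skew φ t (x, a + c)) (y, b + c) := by
  have h_raise := h.raise c
  rwa [← skew_raise] at h_raise

lemma Near.skew (h : Θ.Near η X Y) (φ : Flow ℝ M) {t : ℝ}
    (ht : ∀ x y, dist x y < η → dist (φ t x) (φ t y) < η') :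
    Θ.Near η' (Θ.skew φ t X) (Θ.skew φ t Y) := by
  obtain ⟨p, hp, hΘ⟩ := h
  refine ⟨p.map (φ.continuous_toFun t), fun s => ht _ _ (hp s), ?_⟩
  rw [skew_snd, skew_snd, hΘ, add_assoc, add_assoc, Θ.map_add_onOrbit]
  rfl

variable [CompactSpace M]

variable (Θ) in
lemma exists_near_skew_skew (φ : Flow ℝ M) (hη : 0 < η) (L : ℝ) :
    ∃ δ > 0, ∀ X Y, Θ.Near δ X Y → ∀ t ∈ Icc 0 L, Θ.Near η (Θ.skew φ t X) (Θ.skew φ t Y) := by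
  obtain ⟨δ, hδ, h⟩ := Metric.uniformContinuous_iff.1 (uniformContinuous_flow φ 0 L) η hη
  refine ⟨δ, hδ, fun X Y hXY t ht => hXY.skew φ fun x y hxy => ?_⟩
  exact h (a := (⟨t, ht⟩, x)) (b := (⟨t, ht⟩, y)) (by simpa [Prod.dist_eq] using hxy)

variable (Θ) in
lemma exists_near_skew (φ : Flow ℝ M) (hη : 0 < η) :
    ∃ τ > 0, ∀ X, ∀ t ∈ Icc 0 τ, Θ.Near η X (Θ.skew φ t X) := by
  obtain ⟨δ, hδ, h⟩ := Metric.uniformContinuous_iff.1 (uniformContinuous_flow φ 0 1) η hη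
  refine ⟨min (δ / 2) 1, by positivity, fun X t ht => ?_⟩
  obtain ⟨htδ, ht1⟩ := le_min_iff.1 ht.2
  refine ⟨orbitPath φ t X.1, fun s => ?_, rfl⟩
  have hst : s * t ∈ Icc (0 : ℝ) 1 := ⟨mul_nonneg s.2.1 ht.1, mul_le_one₀ s.2.2 ht.1 ht1⟩
  have h_dist : dist (s * t : ℝ) t < δ := by
    rw [Real.dist_eq, abs_sub_lt_iff]
    constructor <;> nlinarith [s.2.1, s.2.2, ht.1]
  change dist (orbitPath φ t X.1 s) (φ t X.1) < η
  simpa using h (a := (⟨s * t, hst⟩, X.1)) (b := (⟨t, ht.1, ht1⟩, X.1))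
    (by simpa [Prod.dist_eq, Subtype.dist_eq, hδ] using h_dist)

variable (Θ) in
lemma exists_near_skew_of_chain (φ : Flow ℝ M) (hη : 0 < η) (L : ℝ) (m : ℕ) :
    ∃ δ > 0, ∀ (X : ℕ → M × A) (h : ℝ), h ∈ Icc 0 L →
      (∀ k < m, Θ.Near δ (Θ.skew φ h (X k)) (X (k + 1))) →
      Θ.Near η (Θ.skew φ (m * h) (X 0)) (X m) := by
  induction m generalizing η with
  | zero => exact ⟨1, one_pos, fun X h _ _ => by simpa using Near.refl hη _⟩
  | succ m ih =>
    obtain ⟨δ₁, hδ₁, h_skew⟩ := Θ.exists_near_skew_skew φ (half_pos hη) L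
    obtain ⟨δ₂, hδ₂, h_chain⟩ := ih hδ₁
    refine ⟨min δ₂ (η / 2), by positivity, fun X h hh hX => ?_⟩
    have h_init := h_skew _ _
      (h_chain X h hh fun k hk => (hX k (by omega)).mono (min_le_left _ _)) h hh
    have h_last := (hX m m.lt_succ_self).mono (min_le_right _ _)
    rw [← skew_add, ← add_one_mul] at h_init
    simpa only [Nat.cast_succ, add_halves] using h_init.trans h_last

end PathCocycle

/-! ### Local primitives -/

/-- Every point has arbitrarily small neighbourhoods that contract to it within themselves. This
is what the local structure of a manifold contributes. -/
def LocallyContracts (M : Type*) [TopologicalSpace M] : Prop :=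
  ∀ x : M, ∀ U ∈ 𝓝 x, ∃ V ∈ 𝓝 x, V ⊆ U ∧ ∃ κ : M × unitInterval → M,
    ContinuousOn κ (V ×ˢ univ) ∧
      ∀ y ∈ V, κ (y, 0) = x ∧ κ (y, 1) = y ∧ ∀ u, κ (y, u) ∈ V

lemma locallyContracts_of_isEmbedding {H E : Type*} [TopologicalSpace H] [NormedAddCommGroup E]
    [NormedSpace ℝ E] {f : H → E} (hf : IsEmbedding f) (hc : Convex ℝ (range f)) :
    LocallyContracts H := by
  intro x U hU
  obtain ⟨W, hW, hWU⟩ := (hf.isInducing.nhds_eq_comap x ▸ hU : U ∈ comap f (𝓝 (f x)))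
  obtain ⟨r, hr, hrW⟩ := Metric.mem_nhds_iff.1 hW
  have h_segment (z : H × unitInterval) : ∃ w, f w = f x + (z.2 : ℝ) • (f z.1 - f x) :=
    hc.add_smul_sub_mem (mem_range_self x) (mem_range_self z.1) z.2.2
  choose κ hκ using h_segment
  have hκ_cont : Continuous κ := by
    have hf_cont := hf.continuous
    rw [hf.continuous_iff, show f ∘ κ = fun z => f x + (z.2 : ℝ) • (f z.1 - f x) from funext hκ]
    fun_prop
  refine ⟨f ⁻¹' Metric.ball (f x) r, hf.continuous.continuousAt (Metric.ball_mem_nhds _ hr),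
    (preimage_mono hrW).trans hWU, κ, hκ_cont.continuousOn, fun y hy => ⟨?_, ?_, fun u => ?_⟩⟩
  · exact hf.injective (by simp [hκ])
  · exact hf.injective (by simp [hκ])
  · rw [mem_preimage, Metric.mem_ball, dist_eq_norm] at hy ⊢
    rw [hκ, add_sub_cancel_left, norm_smul, Real.norm_of_nonneg u.2.1]
    exact (mul_le_of_le_one_left (norm_nonneg _) u.2.2).trans_lt hy

lemma LocallyContracts.of_chartedSpace {H M : Type*} [TopologicalSpace H] [TopologicalSpace M]
    [ChartedSpace H M] (hH : LocallyContracts H) : LocallyContracts M := by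
  intro x U hU
  let e := chartAt H x
  have hx : x ∈ e.source := mem_chart_source H x
  have hW : e.target ∩ e.symm ⁻¹' U ∈ 𝓝 (e x) := by
    refine inter_mem (e.open_target.mem_nhds (e.map_source hx)) ?_
    refine (e.continuousAt_symm (e.map_source hx)).preimage_mem_nhds ?_
    rwa [e.left_inv hx]
  obtain ⟨V', hV', hVU, κ, hκ, h⟩ := hH (e x) _ hW
  refine ⟨e.source ∩ e ⁻¹' V', inter_mem (e.open_source.mem_nhds hx)
    ((e.continuousAt hx).preimage_mem_nhds hV'), ?_, fun z => e.symm (κ (e z.1, z.2)), ?_, ?_⟩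
  · rintro y ⟨hy, hy'⟩
    simpa only [mem_preimage, e.left_inv hy] using (hVU hy').2
  · refine e.continuousOn_symm.comp
      (hκ.comp (f := fun z : M × unitInterval => (e z.1, z.2)) ?_ ?_) ?_
    · exact (e.continuousOn.comp continuousOn_fst fun z hz => hz.1.1).prodMk continuousOn_snd
    · exact fun z hz => ⟨hz.1.2, trivial⟩
    · exact fun z hz => (hVU ((h _ hz.1.2).2.2 z.2)).1
  · rintro y ⟨hy, hy'⟩
    obtain ⟨h0, h1, h_mem⟩ := h _ hy'
    refine ⟨?_, ?_, fun u => ⟨e.map_target (hVU (h_mem u)).1, ?_⟩⟩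
    · simp only [h0, e.left_inv hx]
    · simp only [h1, e.left_inv hy]
    · simp only [mem_preimage, e.right_inv (hVU (h_mem u)).1, h_mem u]

lemma IsTopManifold.locallyContracts {M : Type u} [TopologicalSpace M] (h : IsTopManifold M) :
    LocallyContracts M := by
  rcases h with ⟨n, ⟨h⟩⟩ | ⟨n, _, ⟨h⟩⟩
  · exact .of_chartedSpace (H := EuclideanSpace ℝ (Fin n))
      (locallyContracts_of_isEmbedding .id (by simpa using convex_univ))
  · refine .of_chartedSpace (H := EuclideanHalfSpace n)
      (locallyContracts_of_isEmbedding .subtypeVal ?_)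
    refine Eq.subst (motive := fun s => Convex ℝ s) Subtype.range_val.symm ?_
    intro x hx y hy a b ha hb _
    exact add_nonneg (mul_nonneg ha hx) (mul_nonneg hb hy)

lemma LocallyContracts.locallyPathConnectedSpace {M : Type*} [TopologicalSpace M]
    (hM : LocallyContracts M) : LocallyPathConnectedSpace M := by
  refine ⟨fun x => ⟨fun U => ⟨fun hU => ?_, fun ⟨V, hV, hVU⟩ => mem_of_superset hV.1 hVU⟩⟩⟩
  obtain ⟨V, hV, hVU, κ, hκ, h⟩ := hM x U hU
  refine ⟨V, ⟨hV, x, mem_of_mem_nhds hV, fun {y} hy => ?_⟩, hVU⟩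
  have hκy : Continuous fun u : unitInterval => κ (y, u) :=
    hκ.comp_continuous (by fun_prop) fun _ => ⟨hy, trivial⟩
  exact ⟨⟨⟨_, hκy⟩, (h y hy).1, (h y hy).2.1⟩, (h y hy).2.2⟩

lemma exists_path_dist_lt {M : Type*} [PseudoMetricSpace M] [CompactSpace M]
    [LocallyPathConnectedSpace M] {η : ℝ} (hη : 0 < η) :
    ∃ ρ > 0, ∀ x y : M, dist x y < ρ → ∃ p : Path x y, ∀ s, dist (p s) y < η := by
  choose V hV hVη using fun z : M =>
    (path_connected_basis z).mem_iff.1 (Metric.ball_mem_nhds z (half_pos hη))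
  obtain ⟨ρ, hρ, h⟩ := lebesgue_number_lemma_of_metric (c := fun z => interior (V z))
    isCompact_univ (fun _ => isOpen_interior)
    (fun z _ => mem_iUnion.2 ⟨z, mem_interior_iff_mem_nhds.2 (hV z).1⟩)
  refine ⟨ρ, hρ, fun x y hxy => ?_⟩
  obtain ⟨z, hz⟩ := h y trivial
  have hy : y ∈ V z := interior_subset (hz (Metric.mem_ball_self hρ))
  obtain ⟨p, hp⟩ := (hV z).2.joinedIn x (interior_subset (hz hxy)) y hy
  refine ⟨p, fun s => ?_⟩
  linarith [dist_triangle_right (p s) y z, Metric.mem_ball.1 (hVη z (hp s)),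
    Metric.mem_ball.1 (hVη z hy)]

section Primitive

variable {M A : Type*} [TopologicalSpace M] [AddCommGroup A]

/-- `F` is a primitive of the path cocycle `Θ` on `U`. -/
def PathCocycle.IsPrimitiveOn (Θ : PathCocycle M A) (F : M → A) (U : Set M) : Prop :=
  ∀ c : C(unitInterval, M), (∀ s, c s ∈ U) → Θ c = F (c 1) - F (c 0)

namespace PathCocycle

variable {Θ : PathCocycle M A}

lemma IsPrimitiveOn.map_path {F : M → A} {U : Set M} (hF : Θ.IsPrimitiveOn F U) {x y : M}
    (p : Path x y) (hp : ∀ s, p s ∈ U) : Θ p = F y - F x := by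
  simpa using hF p hp

lemma IsPrimitiveOn.eventually_sub_eq [LocallyPathConnectedSpace M] {F F' : M → A}
    {U U' : Set M} (hF : Θ.IsPrimitiveOn F U) (hF' : Θ.IsPrimitiveOn F' U') {x : M}
    (hU : U ∈ 𝓝 x) (hU' : U' ∈ 𝓝 x) : ∀ᶠ y in 𝓝 x, F y - F' y = F x - F' x := by
  obtain ⟨V, ⟨hV, hVc⟩, hVU⟩ := (path_connected_basis x).mem_iff.1 (inter_mem hU hU')
  filter_upwards [hV] with y hy
  obtain ⟨p, hp⟩ := hVc.joinedIn x (mem_of_mem_nhds hV) y hy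
  rw [← sub_eq_sub_iff_sub_eq_sub, ← hF.map_path p fun s => (hVU (hp s)).1,
    ← hF'.map_path p fun s => (hVU (hp s)).2]

end PathCocycle

end Primitive

lemma exists_finite_forall_telescope_mem {A : Type*} [AddCommGroup A] {Ψ : Set A}
    (hΨ : Ψ.Finite) (N : ℕ) :
    ∃ W : Set A, W.Finite ∧ ∀ u : ℕ → A, (∀ k < N, u (k + 1) - u k ∈ Ψ) → u N - u 0 ∈ W := by
  induction N with
  | zero => exact ⟨{0}, finite_singleton _, fun u _ => by simp⟩
  | succ N ih =>
    obtain ⟨W, hW, h⟩ := ih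
    refine ⟨image2 (· + ·) W Ψ, hW.image2 _ hΨ, fun u hu => ?_⟩
    exact ⟨_, h u fun k hk => hu k (by omega), _, hu N N.lt_succ_self, by simp⟩

section Height

variable {M : Type*} [MetricSpace M] [CompactSpace M] {A : Type*} [AddCommGroup A]
  (Θ : PathCocycle M A)

lemma LocallyContracts.exists_isPrimitiveOn_ball (hM : LocallyContracts M) :
    ∃ ρ > 0, ∀ x : M, ∃ F : M → A, Θ.IsPrimitiveOn F (Metric.ball x ρ) := by
  choose V hV _ κ hκ h using fun x : M => hM x univ univ_mem
  obtain ⟨ρ, hρ, hb⟩ := lebesgue_number_lemma_of_metric (c := fun x => interior (V x))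
    isCompact_univ (fun _ => isOpen_interior)
    (fun x _ => mem_iUnion.2 ⟨x, mem_interior_iff_mem_nhds.2 (hV x)⟩)
  have h_cont (z y : M) (hy : y ∈ V z) : Continuous fun u : unitInterval => κ z (y, u) :=
    (hκ z).comp_continuous (by fun_prop) fun s => ⟨hy, trivial⟩
  classical
  refine ⟨ρ, hρ, fun x => ?_⟩
  obtain ⟨z, hz⟩ := hb x trivial
  refine ⟨fun y => if hy : y ∈ V z then Θ ⟨_, h_cont z y hy⟩ else 0, fun c hc => ?_⟩
  have hcV (s) : c s ∈ V z := interior_subset (hz (hc s))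
  let G : C(unitInterval × unitInterval, M) := ⟨fun w => κ z (c w.1, w.2),
    (hκ z).comp_continuous (by fun_prop) fun s => ⟨hcV _, trivial⟩⟩
  have h_square := Θ.map_square G (b := .const _ z) (t := c) (l := ⟨_, h_cont z _ (hcV 0)⟩)
    (r := ⟨_, h_cont z _ (hcV 1)⟩) (fun s => (h z _ (hcV s)).1) (fun s => (h z _ (hcV s)).2.1)
    (fun _ => rfl) (fun _ => rfl)
  rw [Θ.map_const, zero_add] at h_square
  simp only [dif_pos (hcV _), h_square, add_sub_cancel_left]

lemma LocallyContracts.exists_finite_forall_sub_mem (hM : LocallyContracts M) :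
    ∃ (g : M → A) (Ψ : Set A), Ψ.Finite ∧ ∃ η > 0, ∀ {x y : M} (p : Path x y),
      (∀ s, dist (p s) y < η) → Θ p - (g y - g x) ∈ Ψ := by
  have := hM.locallyPathConnectedSpace
  obtain ⟨r, hr, hF⟩ := hM.exists_isPrimitiveOn_ball Θ
  choose F hF using hF
  obtain ⟨ρ, hρ, h_path⟩ := exists_path_dist_lt (M := M) (η := r / 4) (by positivity)
  obtain ⟨t, -, ht_fin, ht⟩ := finite_cover_balls_of_compact (isCompact_univ (X := M)) hρ
  have h_center (x : M) : ∃ p ∈ t, ∃ q : Path p x, ∀ s, dist (q s) x < r / 4 := by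
    obtain ⟨p, hp, hpx⟩ := mem_iUnion₂.1 (ht (mem_univ x))
    exact ⟨p, hp, h_path p x (by rwa [Metric.mem_ball, dist_comm] at hpx)⟩
  choose i hi q hq using h_center
  refine ⟨fun x => Θ (q x), (fun z : M × M => F z.1 z.2 - F z.1 z.1) '' (t ×ˢ t),
    (ht_fin.prod ht_fin).image _, r / 8, by positivity, fun {x y} p hp => ?_⟩
  refine ⟨(i x, i y), ⟨hi _, hi _⟩, ?_⟩
  have hxy : dist x y < r / 8 := by simpa using hp 0
  have hx : dist (i x) x < r / 4 := by simpa using hq x 0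
  have hp_eq := (hF (i x)).map_path p fun s => by
    rw [Metric.mem_ball]
    linarith [hp s, dist_triangle_right (p s) x y, dist_triangle_right (p s) (i x) x]
  have hqx_eq := (hF (i x)).map_path (q x) fun s => by
    rw [Metric.mem_ball]
    linarith [dist_triangle_right (q x s) (i x) x, hq x s]
  have hqy_eq := (hF (i x)).map_path (q y) fun s => by
    rw [Metric.mem_ball]
    linarith [hq y s, dist_triangle_right (q y s) x y, dist_triangle_right (q y s) (i x) x]
  simp only [hp_eq, hqx_eq, hqy_eq]
  abel

/-- The height of a point of the skew product `M × A` above the graph of `g`. -/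
def heightAbove {M A : Type*} [AddCommGroup A] (g : M → A) (X : M × A) : A := X.2 - g X.1

/-- A discretization of the heights in the skew product: a function `g`, in general discontinuous,
such that an `η`-small jump and an orbit arc of length at most `L` can change the height above the
graph of `g` only by an element of the finite set `W`. -/
structure PathCocycle.IsDiscretization (φ : Flow ℝ M) (η L : ℝ) (g : M → A) (W : Set A) :
    Prop where
  finite : W.Finite
  near : ∀ {X Y : M × A}, Θ.Near η X Y → heightAbove g Y - heightAbove g X ∈ W
  skew : ∀ X, ∀ t ∈ Icc 0 L, heightAbove g (Θ.skew φ t X) - heightAbove g X ∈ W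

lemma LocallyContracts.exists_isDiscretization (hM : LocallyContracts M) (φ : Flow ℝ M) (L : ℝ) :
    ∃ η > 0, ∃ g W, Θ.IsDiscretization φ η L g W := by
  obtain ⟨g, Ψ, hΨ, η, hη, h⟩ := hM.exists_finite_forall_sub_mem Θ
  have h_near {X Y : M × A} : Θ.Near η X Y → heightAbove g Y - heightAbove g X ∈ Ψ := by
    rintro ⟨p, hp, hΘ⟩
    convert h p hp using 1
    rw [heightAbove, heightAbove, hΘ]
    abel
  obtain ⟨τ, hτ, h_skew⟩ := Θ.exists_near_skew φ hη
  obtain ⟨N, hN⟩ := exists_nat_ge (L / τ)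
  obtain ⟨W, hW, h_sum⟩ := exists_finite_forall_telescope_mem hΨ (N + 1)
  refine ⟨η, hη, g, Ψ ∪ W, hΨ.union hW, fun hXY => .inl (h_near hXY), fun X t ht => .inr ?_⟩
  have hN_pos : (0 : ℝ) < N + 1 := by positivity
  have h_step : t / (N + 1) ∈ Icc 0 τ := by
    refine ⟨div_nonneg ht.1 hN_pos.le, ?_⟩
    rw [div_le_iff₀ hN_pos]
    rw [div_le_iff₀ hτ] at hN
    nlinarith [ht.2]
  let Y : ℕ → M × A := fun k => Θ.skew φ (k * (t / (N + 1))) X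
  have hY (k : ℕ) : Y (k + 1) = Θ.skew φ (t / (N + 1)) (Y k) := by
    simp only [Y, Nat.cast_succ, add_one_mul, PathCocycle.skew_add]
  have h_end : Y (N + 1) = Θ.skew φ t X := by
    simp only [Y, Nat.cast_succ, mul_div_cancel₀ t hN_pos.ne']
  have h_start : Y 0 = X := by simp [Y]
  simpa only [h_end, h_start] using h_sum (fun k => heightAbove g (Y k)) fun k _ => by
    simpa only [hY] using h_near (h_skew (Y k) _ h_step)

end Height

section Smoothing

namespace PathCocycle

variable {M A : Type*} [TopologicalSpace M] [AddCommGroup A]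

/-- The path cocycle `Θ` modified by the coboundary of `g`. -/
def addCoboundary (Θ : PathCocycle M A) (g : M → A) : PathCocycle M A where
  toFun c := Θ c + (g (c 1) - g (c 0))
  triangle H p q r := by
    rw [← Θ.triangle H p q r]
    simp only [ContinuousMap.comp_apply, Path.coe_toContinuousMap, Path.source, Path.target]
    abel

lemma addCoboundary_apply (Θ : PathCocycle M A) (g : M → A) (c : C(unitInterval, M)) :
    Θ.addCoboundary g c = Θ c + (g (c 1) - g (c 0)) :=
  rfl

lemma IsPrimitiveOn.addCoboundary {Θ : PathCocycle M A} {F : M → A} {U : Set M}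
    (hF : Θ.IsPrimitiveOn F U) (g : M → A) :
    (Θ.addCoboundary g).IsPrimitiveOn (fun x => F x + g x) U := by
  intro c hc
  rw [addCoboundary_apply, hF c hc, sub_add_sub_comm]

lemma IsPrimitiveOn.along_eq {Θ : PathCocycle M A} {F : M → A} {U : Set M}
    (hF : Θ.IsPrimitiveOn F U) {c : C(ℝ, M)} {a b : ℝ} (hc : MapsTo c (uIcc a b) U) :
    Θ.along c a b = F (c b) - F (c a) := by
  refine (hF (c.comp (Path.segment a b).toContinuousMap) fun s => hc ?_).trans (by simp)
  rw [← segment_eq_uIcc]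
  exact ⟨1 - s, s, sub_nonneg.2 s.2.2, s.2.1, sub_add_cancel _ _,
    (AffineMap.lineMap_apply_module a b (s : ℝ)).symm⟩

/- Continuous dependence of the value between two times is a transitive relation on the times. Local
primitives give it for nearby times. -/
lemma continuous_along [TopologicalSpace A] [IsTopologicalAddGroup A] {Θ : PathCocycle M A}
    (hΘ : ∀ x, ∃ U : Set M, IsOpen U ∧ x ∈ U ∧
      ∃ F, Θ.IsPrimitiveOn F U ∧ ContinuousOn F U) (a b : ℝ) :
    Continuous fun c : C(ℝ, M) => Θ.along c a b := by
  refine continuous_iff_continuousAt.2 fun c₀ => ?_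
  have h_symm : Std.Symm fun a b => ContinuousAt (fun c : C(ℝ, M) => Θ.along c a b) c₀ :=
    ⟨fun a b h => h.neg.congr (.of_forall fun c =>
      neg_eq_of_add_eq_zero_right ((Θ.along_add_along c a b a).trans (Θ.along_self c a)))⟩
  refine PreconnectedSpace.induction₂
    (fun a b => ContinuousAt (fun c : C(ℝ, M) => Θ.along c a b) c₀) (fun t => ?_) ⟨fun a b d h h' =>
      (h.add h').congr (.of_forall fun c => Θ.along_add_along c a b d)⟩ a b
  obtain ⟨U, hU, htU, F, hF, hF_cont⟩ := hΘ (c₀ t)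
  obtain ⟨r, hr, hrU⟩ := Metric.mem_nhds_iff.1 ((hU.preimage c₀.continuous).mem_nhds htU)
  filter_upwards [Metric.ball_mem_nhds t hr] with u hu
  have h_maps : MapsTo c₀ (uIcc t u) U := fun v hv => hrU
    ((convex_ball t r).ordConnected.uIcc_subset (Metric.mem_ball_self hr) hu hv)
  refine ContinuousAt.congr (f := fun c : C(ℝ, M) => F (c u) - F (c t)) ?_
    ((ContinuousMap.eventually_mapsTo isCompact_uIcc hU h_maps).mono fun c hc =>
      (hF.along_eq hc).symm)
  have h_eval (v : ℝ) (hv : v ∈ uIcc t u) : ContinuousAt (fun c : C(ℝ, M) => F (c v)) c₀ :=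
    ContinuousAt.comp (f := fun c : C(ℝ, M) => c v)
      (hF_cont.continuousAt (hU.mem_nhds (h_maps hv))) (continuous_eval_const v).continuousAt
  exact (h_eval u right_mem_uIcc).sub (h_eval t left_mem_uIcc)

lemma continuous_of_isPrimitiveOn [TopologicalSpace A] [IsTopologicalAddGroup A]
    {Θ : PathCocycle M A} (hΘ : ∀ x, ∃ U : Set M, IsOpen U ∧ x ∈ U ∧
      ∃ F, Θ.IsPrimitiveOn F U ∧ ContinuousOn F U) : Continuous Θ := by
  let e : C(ℝ, unitInterval) := ⟨projIcc 0 1 zero_le_one, continuous_projIcc⟩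
  refine ((continuous_along hΘ 0 1).comp (ContinuousMap.continuous_precomp e)).congr fun c => ?_
  exact Θ.along_extend (⟨c, rfl, rfl⟩ : Path (c 0) (c 1))

end PathCocycle

lemma continuousOn_add_neg_sum_partitionOfUnity {M ι : Type*} [TopologicalSpace M]
    [LocallyPathConnectedSpace M] [Fintype ι] {Θ : PathCocycle M ℝ} {U : ι → Set M}
    (hU : ∀ i, IsOpen (U i)) {F : ι → M → ℝ} (hF : ∀ i, Θ.IsPrimitiveOn (F i) (U i))
    {P : PartitionOfUnity ι M} (hP : P.IsSubordinate U) (j : ι) :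
    ContinuousOn (fun y => F j y + -∑ i, P i y * F i y) (U j) := by
  have h_eq (y : M) : F j y + -∑ i, P i y * F i y = ∑ i, P i y * (F j y - F i y) := by
    have h_one := P.sum_eq_one (mem_univ y)
    rw [finsum_eq_sum_of_fintype] at h_one
    rw [← sub_eq_add_neg]
    simp only [mul_sub, Finset.sum_sub_distrib, ← Finset.sum_mul, h_one, one_mul]
  simp only [h_eq]
  refine fun x hx => ContinuousAt.continuousWithinAt (tendsto_finsetSum _ fun i _ => ?_)
  by_cases hxi : x ∈ tsupport (P i)
  · refine ContinuousAt.congr (f := fun y => P i y * (F j x - F i x)) (by fun_prop) ?_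
    filter_upwards [(hF j).eventually_sub_eq (hF i) ((hU j).mem_nhds hx)
      ((hU i).mem_nhds (hP i hxi))] with y hy
    rw [hy]
  · refine ContinuousAt.congr (f := fun _ => 0) continuousAt_const ?_
    filter_upwards [(isClosed_tsupport (P i)).isOpen_compl.mem_nhds hxi] with y hy
    rw [image_eq_zero_of_notMem_tsupport hy, zero_mul]

lemma LocallyContracts.exists_continuous_addCoboundary {M : Type*} [MetricSpace M] [CompactSpace M]
    (hM : LocallyContracts M) (Θ : PathCocycle M ℝ) :
    ∃ g : M → ℝ, Continuous (Θ.addCoboundary g) := by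
  have := hM.locallyPathConnectedSpace
  obtain ⟨ρ, hρ, hF⟩ := hM.exists_isPrimitiveOn_ball Θ
  choose F hF using hF
  obtain ⟨t, -, ht_fin, ht⟩ := finite_cover_balls_of_compact (isCompact_univ (X := M)) hρ
  have := ht_fin.fintype
  obtain ⟨P, hP⟩ := PartitionOfUnity.exists_isSubordinate isClosed_univ
    (fun p : t => Metric.ball (p : M) ρ) (fun _ => Metric.isOpen_ball)
    (fun x hx => by simpa using ht hx)
  refine ⟨fun x => -∑ p : t, P p x * F p x, PathCocycle.continuous_of_isPrimitiveOn fun x => ?_⟩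
  obtain ⟨p, hp, hpx⟩ := mem_iUnion₂.1 (ht (mem_univ x))
  exact ⟨Metric.ball p ρ, Metric.isOpen_ball, hpx, _, (hF p).addCoboundary _,
    continuousOn_add_neg_sum_partitionOfUnity (U := fun q : t => Metric.ball (q : M) ρ)
      (F := fun q : t => F q) (fun _ => Metric.isOpen_ball) (fun q => hF q) hP ⟨p, hp⟩⟩

end Smoothing

/-! ### The covering as a space of pairs -/

namespace Cover

section Topological

variable {M : Type u} [TopologicalSpace M] {α : CohomH1 M} {x₀ : M}

lemma exists_mk (x : Cover α x₀) : ∃ c, Cover.mk α c = x := Quotient.exists_rep x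

lemma continuous_mk : Continuous (Cover.mk α : PathsFrom x₀ → Cover α x₀) :=
  continuous_quotient_mk'

lemma cohomCocycle_eq_add {c c' : PathsFrom x₀} {h : H1 M}
    (hc : IsHomologyClass (pathChain c'.1 - pathChain c.1) h) :
    cohomCocycle α c'.1 = cohomCocycle α c.1 + α h := by
  rw [← homologyCocycle_sub_eq hc, map_sub]
  exact (add_sub_cancel _ _).symm

/-- The height of a point of the covering: the value of `α` along a curve that represents it. It
trivializes the action of the deck transformations. -/
def height : Cover α x₀ → ℝ :=
  Quotient.lift (fun c : PathsFrom x₀ => cohomCocycle α c.1) fun c c' ⟨_, h, hc, hα⟩ => by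
    rw [cohomCocycle_eq_add hc, hα, add_zero]

/-- The pair formed by the projection and the height of a point of the covering. It embeds the
covering into the space on which the skew products act. -/
def pt (x : Cover α x₀) : M × ℝ := (x.proj, x.height)

@[simp] lemma pt_fst (x : Cover α x₀) : x.pt.1 = x.proj := rfl

@[simp] lemma pt_snd (x : Cover α x₀) : x.pt.2 = x.height := rfl

lemma pt_mk (c : PathsFrom x₀) : (Cover.mk α c).pt = (c.1 1, cohomCocycle α c.1) := rfl

lemma pt_injective : Function.Injective (pt : Cover α x₀ → M × ℝ) := by
  intro x y hxy
  obtain ⟨c, rfl⟩ := exists_mk x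
  obtain ⟨c', rfl⟩ := exists_mk y
  rw [pt_mk, pt_mk, Prod.mk.injEq] at hxy
  obtain ⟨h, hc⟩ := exists_isHomologyClass_sub (c.2.trans c'.2.symm) hxy.1
  refine Quotient.sound ⟨hxy.1, h, hc, ?_⟩
  linarith [hxy.2, cohomCocycle_eq_add (α := α) hc]

lemma IsTranslate.pt_eq {h : H1 M} {x y : Cover α x₀} (hxy : IsTranslate h x y) :
    y.pt = raise (α h) x.pt := by
  obtain ⟨c, c', rfl, rfl, h_end, hc⟩ := hxy
  rw [pt_mk, pt_mk, cohomCocycle_eq_add hc, h_end]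
  rfl

lemma exists_isTranslate {x y : Cover α x₀} (hxy : x.proj = y.proj) : ∃ h, IsTranslate h x y := by
  obtain ⟨c, rfl⟩ := exists_mk x
  obtain ⟨c', rfl⟩ := exists_mk y
  obtain ⟨h, hc⟩ := exists_isHomologyClass_sub (c.2.trans c'.2.symm) hxy
  exact ⟨h, c, c', rfl, rfl, hxy, hc⟩

lemma sub_height_eq_of_proj_eq {f : Cover α x₀ → ℝ} (hf : IsEquivariant f) {x y : Cover α x₀}
    (hxy : x.proj = y.proj) : f x - x.height = f y - y.height := by
  obtain ⟨h, hh⟩ := exists_isTranslate hxy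
  have h_height : y.height = x.height + α h := congrArg Prod.snd hh.pt_eq
  rw [hf h x y hh, h_height]
  ring

lemma pt_liftFlow (φ : Flow ℝ M) (t : ℝ) (x : Cover α x₀) :
    (liftFlow φ t x).pt = (cohomCocycle α).skew φ t x.pt := by
  have hx : x = Cover.mk α (Quotient.out x) := (Quotient.out_eq x).symm
  rw [liftFlow, pt_mk]
  conv_rhs => rw [hx, pt_mk]
  ext
  · simp [flowPath]
  · exact (cohomCocycle α).map_flow_mul φ t _ _ fun s => rfl

lemma liftFlow_zero (φ : Flow ℝ M) (x : Cover α x₀) : liftFlow φ 0 x = x :=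
  pt_injective (by simp [pt_liftFlow])

lemma liftFlow_add (φ : Flow ℝ M) (s t : ℝ) (x : Cover α x₀) :
    liftFlow φ (s + t) x = liftFlow φ t (liftFlow φ s x) :=
  pt_injective (by simp only [pt_liftFlow, PathCocycle.skew_add])

lemma continuous_liftFlow (φ : Flow ℝ M) (x : Cover α x₀) :
    Continuous fun t => liftFlow φ t x := by
  refine continuous_mk.comp (Continuous.subtype_mk
    (ContinuousMap.continuous_of_continuous_uncurry _ ?_) _)
  exact φ.continuous (by fun_prop) (by fun_prop)

lemma exists_lift (x : Cover α x₀) {m : M} (p : Path x.proj m) :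
    ∃ P : unitInterval → Cover α x₀, Continuous P ∧ P 0 = x ∧ (∀ s, (P s).proj = p s) ∧
      (P 1).height = x.height + cohomCocycle α p := by
  obtain ⟨c, rfl⟩ := exists_mk x
  let c' : Path x₀ (Cover.mk α c).proj := ⟨c.1, c.2, rfl⟩
  let q (s : unitInterval) : Path (Cover.mk α c).proj (p s) :=
    (p.subpath 0 s).cast p.source.symm rfl
  let P (s : unitInterval) : Cover α x₀ :=
    Cover.mk α ⟨c'.trans (q s), (c'.trans (q s)).source⟩
  have h_proj (s : unitInterval) : (P s).proj = p s := (c'.trans (q s)).target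
  have h_height (s : unitInterval) :
      (P s).height = (Cover.mk α c).height + cohomCocycle α (q s) :=
    (cohomCocycle α).map_trans c' (q s)
  refine ⟨P, continuous_mk.comp (Continuous.subtype_mk
    (ContinuousMap.continuous_of_continuous_uncurry _ ?_) _), ?_, h_proj, ?_⟩
  · refine Path.trans_continuous_family (fun _ => c') (c'.continuous.comp continuous_snd) q ?_
    exact p.continuous.comp (by fun_prop)
  · refine pt_injective (Prod.ext ((h_proj 0).trans p.source) ((h_height 0).trans ?_))
    simp only [q, Path.subpath_self, pt_snd, add_eq_left]
    exact (cohomCocycle α).map_refl (p 0)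
  · simp only [h_height, q, Path.subpath_zero_one]
    rfl

end Topological

end Cover

section Metric

/-- A metric of the covering, compatible with its topology, for which the covering map is isometric
on all balls of some fixed radius. It need not be invariant under deck transformations. -/
structure IsLocallyLiftedMetric {M : Type u} [MetricSpace M] {α : CohomH1 M} {x₀ : M}
    (d : MetricSpace (Cover α x₀)) : Prop where
  compatible : d.toPseudoMetricSpace.toUniformSpace.toTopologicalSpace =
    (inferInstance : TopologicalSpace (Cover α x₀))
  isometric : ∃ r > 0, ∀ z x y : Cover α x₀, d.dist z x < r → d.dist z y < r →
    d.dist x y = dist x.proj y.proj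

variable {M : Type u} [MetricSpace M] {α : CohomH1 M} {x₀ : M} {d : MetricSpace (Cover α x₀)}

lemma IsLiftedMetric.isLocallyLiftedMetric (hd : IsLiftedMetric d) : IsLocallyLiftedMetric d :=
  ⟨hd.compatible, hd.isometric⟩

namespace Cover

lemma continuous_dist_left (hd : IsLocallyLiftedMetric d) (x : Cover α x₀) :
    Continuous fun y => d.dist x y := by
  have h : ∀ (X : Type u) [MetricSpace X] (x : X), Continuous fun y => dist x y :=
    fun X _ x => by fun_prop
  replace h := @h _ d x
  rwa [hd.compatible] at h

lemma nhds_basis_dist (hd : IsLocallyLiftedMetric d) (x : Cover α x₀) :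
    (𝓝 x).HasBasis (fun ε : ℝ => 0 < ε) (fun ε => {y | d.dist y x < ε}) := by
  have h := @Metric.nhds_basis_ball _ d.toPseudoMetricSpace x
  rw [hd.compatible] at h
  exact h

/- The lift of a short curve cannot leave the ball on which the covering map is isometric. -/
lemma exists_dist_lt_of_near (hd : IsLocallyLiftedMetric d) {r : ℝ}
    (hr : ∀ z x y : Cover α x₀, d.dist z x < r → d.dist z y < r → d.dist x y = dist x.proj y.proj)
    {η : ℝ} (hη : 4 * η ≤ r) (x : Cover α x₀) {Y : M × ℝ} (h : (cohomCocycle α).Near η x.pt Y) :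
    ∃ y : Cover α x₀, y.pt = Y ∧ d.dist x y < η := by
  have h_dist : dist x.proj Y.1 < η := h.dist_lt
  have hη_pos : 0 < η := dist_nonneg.trans_lt h_dist
  obtain ⟨p, hp, hY⟩ : ∃ p : Path x.proj Y.1, (∀ s, dist (p s) Y.1 < η) ∧
    Y.2 = x.height + cohomCocycle α p := h
  obtain ⟨P, hP, hP0, h_proj, h_height⟩ := exists_lift x p
  have h_self : d.dist x x < r := (d.dist_self x).trans_lt (by linarith)
  have h_small (s) (hs : d.dist x (P s) < r) : d.dist x (P s) ≤ 2 * η := by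
    rw [hr x x (P s) h_self hs, h_proj]
    linarith [dist_triangle_right x.proj (p s) Y.1, hp s]
  have h_cont : Continuous fun s => d.dist x (P s) := (continuous_dist_left hd x).comp hP
  have h_eq : {s | d.dist x (P s) < r} = {s | d.dist x (P s) ≤ 2 * η} :=
    Set.ext fun s => ⟨h_small s, fun hs => lt_of_le_of_lt hs (by linarith : 2 * η < r)⟩
  have h_clopen : IsClopen {s | d.dist x (P s) < r} :=
    ⟨h_eq ▸ isClosed_le h_cont continuous_const, isOpen_lt h_cont continuous_const⟩
  have h_univ := h_clopen.eq_univ ⟨0, by rwa [mem_ofPred_eq, hP0]⟩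
  have hP1 : (P 1).proj = Y.1 := (h_proj 1).trans p.target
  refine ⟨P 1, Prod.ext hP1 (h_height.trans hY.symm), ?_⟩
  rwa [hr x x (P 1) h_self (h_univ.ge (mem_univ 1)), hP1]

variable [CompactSpace M] [LocallyPathConnectedSpace M]

lemma exists_near_of_dist_lt (hd : IsLocallyLiftedMetric d) {η : ℝ} (hη : 0 < η) :
    ∃ ε > 0, ∀ x y : Cover α x₀, d.dist x y < ε → (cohomCocycle α).Near η x.pt y.pt := by
  obtain ⟨r, hr_pos, hr⟩ := hd.isometric
  obtain ⟨ρ, hρ, h_path⟩ := exists_path_dist_lt (M := M) (η := min η (r / 4)) (by positivity)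
  refine ⟨min ρ r, by positivity, fun x y hxy => ?_⟩
  obtain ⟨hxyρ, hxyr⟩ := lt_min_iff.1 hxy
  have h_self : d.dist x x < r := (d.dist_self x).trans_lt hr_pos
  obtain ⟨p, hp⟩ := h_path x.proj y.proj (hr x x y h_self hxyr ▸ hxyρ)
  have h_near : (cohomCocycle α).Near (min η (r / 4)) x.pt (y.proj, x.height + cohomCocycle α p) :=
    ⟨p, hp, rfl⟩
  have h_le := min_le_right η (r / 4)
  obtain ⟨z, hz, hxz⟩ := exists_dist_lt_of_near hd hr (by linarith) x h_near
  have hyz : y = z := by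
    refine @eq_of_dist_eq_zero _ d y z ((hr x y z hxyr (by linarith)).trans ?_)
    rw [show z.proj = y.proj from congrArg Prod.fst hz, dist_self]
  rw [hyz, hz]
  exact h_near.mono (min_le_left _ _)

lemma exists_near_of_dist_proj_lt (hd : IsLocallyLiftedMetric d) {η : ℝ} (hη : 0 < η) :
    ∃ ρ > 0, ∀ (x : Cover α x₀) (m : M), dist x.proj m < ρ →
      ∃ y : Cover α x₀, y.proj = m ∧ d.dist x y < η ∧ (cohomCocycle α).Near η x.pt y.pt := by
  obtain ⟨r, hr_pos, hr⟩ := hd.isometric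
  obtain ⟨ρ, hρ, h_path⟩ := exists_path_dist_lt (M := M) (η := min η (r / 4)) (by positivity)
  refine ⟨ρ, hρ, fun x m hxm => ?_⟩
  obtain ⟨p, hp⟩ := h_path _ _ hxm
  have h_near : (cohomCocycle α).Near (min η (r / 4)) x.pt (m, x.height + cohomCocycle α p) :=
    ⟨p, hp, rfl⟩
  obtain ⟨y, hy, hxy⟩ :=
    exists_dist_lt_of_near hd hr (by linarith [min_le_right η (r / 4)]) x h_near
  exact ⟨y, congrArg Prod.fst hy, hxy.trans_le (min_le_left _ _),
    hy ▸ h_near.mono (min_le_left _ _)⟩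

lemma proj_surjective [ConnectedSpace M] (hd : IsLocallyLiftedMetric d) :
    Function.Surjective (proj : Cover α x₀ → M) := by
  obtain ⟨ρ, hρ, h_lift⟩ := exists_near_of_dist_proj_lt hd one_pos
  have h_ball (x : Cover α x₀) (m : M) (hm : dist m x.proj < ρ) :
      m ∈ range (proj : Cover α x₀ → M) :=
    let ⟨y, hy, _⟩ := h_lift x m (by rwa [dist_comm])
    ⟨y, hy⟩
  refine range_eq_univ.1 (IsClopen.eq_univ ⟨isClosed_of_closure_subset fun m hm => ?_,
    Metric.isOpen_iff.2 ?_⟩ ⟨_, Cover.mk α ⟨.const _ x₀, rfl⟩, rfl⟩)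
  · obtain ⟨_, ⟨x, rfl⟩, hx⟩ := Metric.mem_closure_iff.1 hm ρ hρ
    exact h_ball x m hx
  · rintro _ ⟨x, rfl⟩
    exact ⟨ρ, hρ, h_ball x⟩

end Cover

end Metric

namespace Cover

section Equivariant

variable {M : Type u} [MetricSpace M] [CompactSpace M] {α : CohomH1 M} {x₀ : M}

/- As `g` need not be continuous, the finite set `W` is what bounds its oscillation. -/
lemma exists_forall_abs_sub_le [ConnectedSpace M] [LocallyPathConnectedSpace M]
    {d : MetricSpace (Cover α x₀)} (hd : IsLocallyLiftedMetric d)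
    {f : Cover α x₀ → ℝ} (hf : Continuous f) (hfα : IsEquivariant f) {φ : Flow ℝ M}
    {η L : ℝ} {g : M → ℝ} {W : Set ℝ} (hη : 0 < η)
    (hg : (cohomCocycle α).IsDiscretization φ η L g W) :
    ∃ C, ∀ x : Cover α x₀, |f x - heightAbove g x.pt| ≤ C := by
  suffices h : ∃ C, ∀ x : Cover α x₀, x.proj ∈ univ → |f x - heightAbove g x.pt| ≤ C by
    simpa using h
  refine isCompact_univ.induction_on (p := fun s => ∃ C, ∀ x : Cover α x₀, x.proj ∈ s →
    |f x - heightAbove g x.pt| ≤ C) ⟨0, by simp⟩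
    (fun s t hst ⟨C, hC⟩ => ⟨C, fun x hx => hC x (hst hx)⟩)
    (fun s t ⟨C, hC⟩ ⟨C', hC'⟩ => ⟨max C C', fun x hx => hx.elim
      (fun hx => (hC x hx).trans (le_max_left _ _)) fun hx => (hC' x hx).trans (le_max_right _ _)⟩)
    fun m _ => ?_
  obtain ⟨z, rfl⟩ := proj_surjective (α := α) (x₀ := x₀) hd m
  obtain ⟨B, hB⟩ := hg.finite.isBounded.exists_norm_le
  obtain ⟨δ, hδ, hf_near⟩ := (nhds_basis_dist hd z).eventually_iff.1
    (hf.tendsto z (Metric.ball_mem_nhds _ one_pos))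
  obtain ⟨ρ, hρ, h_lift⟩ := exists_near_of_dist_proj_lt (α := α) (x₀ := x₀) hd (lt_min hδ hη)
  refine ⟨_, mem_nhdsWithin_of_mem_nhds (Metric.ball_mem_nhds _ hρ),
    |f z - heightAbove g z.pt| + 1 + B, fun x hx => ?_⟩
  obtain ⟨y, hyx, hzy, h_near⟩ := h_lift z x.proj (by rwa [dist_comm])
  have h_fy : |f y - f z| < 1 := hf_near (x := y)
    ((d.dist_comm y z).trans_lt (hzy.trans_le (min_le_left _ _)))
  have h_W : |heightAbove g y.pt - heightAbove g z.pt| ≤ B :=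
    hB _ (hg.near (h_near.mono (min_le_right _ _)))
  have h_fibre : f x - heightAbove g x.pt = (f z - heightAbove g z.pt) + (f y - f z) -
      (heightAbove g y.pt - heightAbove g z.pt) := by
    simp only [heightAbove, pt_fst, pt_snd, hyx]
    linarith [sub_height_eq_of_proj_eq hfα hyx]
  rw [h_fibre]
  exact (abs_sub _ _).trans (add_le_add ((abs_add_le _ _).trans (by gcongr)) h_W)

variable (α x₀) in
lemma exists_continuous_isEquivariant (hM : LocallyContracts M) :
    ∃ f : Cover α x₀ → ℝ, Continuous f ∧ IsEquivariant f := by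
  obtain ⟨g, hg⟩ := hM.exists_continuous_addCoboundary (cohomCocycle α)
  refine ⟨fun x => x.height + (g x.proj - g x₀), ?_, fun h x y hxy => ?_⟩
  · refine continuous_coinduced_dom.2 ((hg.comp continuous_subtype_val).congr fun c => ?_)
    rw [Function.comp_apply, PathCocycle.addCoboundary_apply, c.2]
    rfl
  · have h_proj : y.proj = x.proj := congrArg Prod.fst hxy.pt_eq
    have h_height : y.height = x.height + α h := congrArg Prod.snd hxy.pt_eq
    simp only [h_proj, h_height]
    ring

end Equivariant

end Cover

/-! ### Realizations -/

section UnitFract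

/-- The fractional part of a real number, as a point of the unit interval. -/
def unitFract (s : ℝ) : unitInterval := ⟨Int.fract s, Int.fract_nonneg s, (Int.fract_lt_one s).le⟩

lemma continuous_comp_unitFract {X : Type*} [TopologicalSpace X] {f : unitInterval → X}
    (hf : Continuous f) (h : f 0 = f 1) : Continuous fun s => f (unitFract s) := by
  have h_comp : Continuous ((fun u : ℝ => f (projIcc 0 1 zero_le_one u)) ∘ Int.fract) :=
    ContinuousOn.comp_fract'' (hf.comp continuous_projIcc).continuousOn
      (by rw [projIcc_left, projIcc_right]; exact h)
  exact h_comp.congr fun s => congrArg f (projIcc_val zero_le_one (unitFract s))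

lemma apply_unitFract_coe {X : Type*} {f : unitInterval → X} (h : f 0 = f 1) (s : unitInterval) :
    f (unitFract s) = f s := by
  rcases eq_or_ne s 1 with rfl | hs
  · exact (congrArg f (Subtype.ext (by simp [unitFract]))).trans h
  · have h_lt : (s : ℝ) < 1 := unitInterval.lt_one_iff_ne_one.2 hs
    exact congrArg f (Subtype.ext (Int.fract_eq_self.2 ⟨s.2.1, h_lt⟩))

lemma continuous_floor_mul_add {σ : unitInterval → ℝ} (hσ : Continuous σ) {l : ℝ} (h0 : σ 0 = 0)
    (h1 : σ 1 = l) : Continuous fun s : ℝ => ⌊s⌋ * l + σ (unitFract s) := by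
  have h_loop : Continuous fun s => σ (unitFract s) - unitFract s * l :=
    continuous_comp_unitFract (f := fun u => σ u - u * l) (by fun_prop) (by simp [h0, h1])
  refine ((continuous_mul_const l).add h_loop).congr fun s => ?_
  change s * l + (σ (unitFract s) - Int.fract s * l) = _
  linear_combination (-l) * Int.floor_add_fract s

lemma monotone_floor_mul_add {σ : unitInterval → ℝ} (hσ : Monotone σ) {l : ℝ} (h0 : σ 0 = 0)
    (h1 : σ 1 = l) : Monotone fun s : ℝ => ⌊s⌋ * l + σ (unitFract s) := by
  have hl : 0 ≤ l := h0 ▸ h1 ▸ hσ zero_le_one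
  intro s s' hs
  rcases (Int.floor_mono hs).eq_or_lt with h | h
  · have h_fract : unitFract s ≤ unitFract s' := by
      refine Subtype.coe_le_coe.1 ?_
      simp only [unitFract, Int.fract, h]
      linarith
    simpa only [h] using add_le_add_right (hσ h_fract) _
  · have h_floor : (⌊s⌋ : ℝ) + 1 ≤ ⌊s'⌋ := by exact_mod_cast h
    have h_le : σ (unitFract s) ≤ l := h1 ▸ hσ unitInterval.le_one'
    have h_ge : 0 ≤ σ (unitFract s') := h0 ▸ hσ unitInterval.nonneg'
    nlinarith [mul_le_mul_of_nonneg_right h_floor hl]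

end UnitFract

section LiftCurve

namespace PathCocycle

variable {M : Type*} [TopologicalSpace M] {A : Type*} [AddCommGroup A] (Θ : PathCocycle M A)

/-- The lift to `M × A` of a curve in `M`, by the values of a path cocycle on its arcs from time
zero. -/
def liftCurve (δ : C(ℝ, M)) (s : ℝ) : M × A := (δ s, Θ.along δ 0 s)

lemma liftCurve_snd (δ : C(ℝ, M)) (s s' : ℝ) :
    (Θ.liftCurve δ s').2 = (Θ.liftCurve δ s).2 + Θ.along δ s s' :=
  (Θ.along_add_along δ 0 s s').symm

lemma liftCurve_add_nat {δ : C(ℝ, M)} (hδ : Function.Periodic δ 1) (s : ℝ) (k : ℕ) :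
    Θ.liftCurve δ (s + k) = raise (k • Θ.along δ 0 1) (Θ.liftCurve δ s) := by
  induction k with
  | zero => simp
  | succ k ih =>
    have h_shift : Θ.along δ 1 (s + k + 1) = Θ.along δ 0 (s + k) :=
      Θ.along_congr fun u => by
        rw [← hδ (0 + u * (s + k - 0))]
        congr 1
        ring
    have h_one : Θ.liftCurve δ (s + k + 1) = raise (Θ.along δ 0 1) (Θ.liftCurve δ (s + k)) := by
      refine Prod.ext (hδ _) ?_
      change Θ.along δ 0 (s + k + 1) = Θ.along δ 0 (s + k) + Θ.along δ 0 1
      rw [← Θ.along_add_along δ 0 1, h_shift, add_comm]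
    rw [Nat.cast_succ, ← add_assoc, h_one, ih, raise_raise, succ_nsmul]

lemma liftCurve_eq_skew {φ : Flow ℝ M} {δ : C(ℝ, M)} {σ : C(ℝ, ℝ)} {y : M} {s s' : ℝ}
    (h : ∀ r ∈ uIcc s s', δ r = φ (σ r) y) :
    Θ.liftCurve δ s' = Θ.skew φ (σ s' - σ s) (Θ.liftCurve δ s) := by
  have hs := h s left_mem_uIcc
  refine Prod.ext ?_ ?_
  · change δ s' = φ _ (δ s)
    rw [hs, h s' right_mem_uIcc, ← Flow.map_add, sub_add_cancel]
  · rw [Θ.liftCurve_snd δ s s', skew_snd]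
    change _ + _ = _ + Θ.onOrbit φ _ (δ s)
    rw [hs, ← along_orbit, along]
    congr 1
    refine .trans (congrArg Θ (ContinuousMap.ext fun u => ?_)) ((Θ.map_comp_eq_along (orbit φ y)
      (σ.comp (Path.segment s s').toContinuousMap)).trans ?_)
    · refine h _ ?_
      rw [← segment_eq_uIcc, segment_eq_image_lineMap]
      exact mem_image_of_mem _ u.2
    · simp

end PathCocycle

end LiftCurve

section Realization

variable {M : Type*} [MetricSpace M]

/-- `δ` follows the curve `γ` along the nondecreasing time change `σ`, and fills the discontinuities
of `γ` with curves of size `ε`. This is `IsRealization`, unrolled to the line. -/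
structure IsLineRealization (ε : ℝ) (γ : ℝ → M) (δ : C(ℝ, M)) (σ : C(ℝ, ℝ)) : Prop where
  monotone : Monotone σ
  eq_of_continuousAt : ∀ s, ContinuousAt γ (σ s) → δ s = γ (σ s)
  mem_ball : ∀ s, ¬ ContinuousAt γ (σ s) → δ s ∈ Metric.ball (γ (σ s)) ε

lemma continuousAt_int_mul_add {γ : ℝ → M} {l : ℝ} (hγ : Function.Periodic γ l) (k : ℤ) (t : ℝ) :
    ContinuousAt γ (k * l + t) ↔ ContinuousAt γ t := by
  have h_shift (s : ℝ) : (γ ∘ fun s => k * l + s) s = γ s := by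
    rw [Function.comp_apply, add_comm]
    exact hγ.int_mul k s
  exact ((Homeomorph.addLeft (k * l)).comp_continuousAt_iff' γ t).symm.trans
    (continuousAt_congr (.of_forall h_shift))

lemma IsRealization.exists_isLineRealization {M : Type u} [MetricSpace M] {ε l : ℝ} {γ : ℝ → M}
    {δ : C(unitInterval, M)} (h : IsRealization ε l γ δ) (hγ : Function.Periodic γ l) :
    ∃ (δ' : C(ℝ, M)) (σ : C(ℝ, ℝ)), IsLineRealization ε γ δ' σ ∧ (∀ s, δ' s = δ (unitFract s)) ∧
      σ 0 = 0 ∧ ∀ (s : ℝ) (j : ℕ), σ (s + j) = σ s + j * l := by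
  obtain ⟨h_closed, σ, hσ, hσ_mono, h0, h1, h_real⟩ := h
  have h_cont (s : ℝ) :
      ContinuousAt γ (⌊s⌋ * l + σ (unitFract s)) ↔ ContinuousAt γ (σ (unitFract s)) :=
    continuousAt_int_mul_add hγ _ _
  have h_val (s : ℝ) : γ (⌊s⌋ * l + σ (unitFract s)) = γ (σ (unitFract s)) :=
    (congrArg γ (add_comm _ _)).trans (hγ.int_mul _ _)
  refine ⟨⟨_, continuous_comp_unitFract δ.continuous h_closed⟩,
    ⟨_, continuous_floor_mul_add hσ h0 h1⟩, ⟨monotone_floor_mul_add hσ_mono h0 h1,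
      fun s hs => ?_, fun s hs => ?_⟩, fun s => rfl, ?_, fun s j => ?_⟩
  · exact ((h_real _).1 ((h_cont s).1 hs)).trans (h_val s).symm
  · exact (congrArg (Metric.ball · ε) (h_val s)).symm ▸ (h_real _).2 (mt (h_cont s).2 hs)
  · have h_fract : unitFract 0 = 0 := Subtype.ext Int.fract_zero
    simp [h_fract, h0]
  · have h_fract : unitFract (s + j) = unitFract s := Subtype.ext (Int.fract_add_natCast s j)
    simp only [ContinuousMap.coe_mk, h_fract, Int.floor_add_natCast]
    push_cast
    ring

namespace IsLineRealization

variable {A : Type*} [AddCommGroup A] {Θ : PathCocycle M A} {φ : Flow ℝ M} {ε : ℝ} {γ : ℝ → M}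
  {δ : C(ℝ, M)} {σ : C(ℝ, ℝ)}

lemma exists_eq_flow (h : IsLineRealization ε γ δ σ)
    (hγ : ∀ t s, t ≤ s → ContinuousOn γ (Icc t s) → γ s = φ (s - t) (γ t)) {s s' : ℝ} (hs : s < s')
    (h_cont : ∀ r ∈ Ioo s s', ContinuousAt γ (σ r)) : ∃ y, ∀ r ∈ Icc s s', δ r = φ (σ r) y := by
  have h_flow (r) (hr : r ∈ Ioo s s') (r') (hr' : r' ∈ Ioo s s') (hrr' : r ≤ r') :
      δ r' = φ (σ r' - σ r) (δ r) := by
    rw [h.eq_of_continuousAt r (h_cont r hr), h.eq_of_continuousAt r' (h_cont r' hr')]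
    refine hγ _ _ (h.monotone hrr') fun u hu => ?_
    obtain ⟨q, hq, rfl⟩ := intermediate_value_Icc hrr' σ.continuous.continuousOn hu
    exact (h_cont q ⟨hr.1.trans_le hq.1, hq.2.trans_lt hr'.2⟩).continuousWithinAt
  obtain ⟨r₀, hr₀⟩ := nonempty_Ioo.2 hs
  have h_open : EqOn δ (fun r => φ (σ r) (φ (-σ r₀) (δ r₀))) (Ioo s s') := by
    intro r hr
    change δ r = φ (σ r) (φ (-σ r₀) (δ r₀))
    rw [← Flow.map_add]
    rcases le_total r₀ r with hle | hle
    · exact h_flow _ hr₀ _ hr hle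
    · rw [h_flow _ hr _ hr₀ hle, ← Flow.map_add, ← sub_eq_add_neg, sub_add_sub_cancel, sub_self,
        Flow.map_zero_apply]
  have h_closed := h_open.closure δ.continuous (φ.continuous σ.continuous continuous_const)
  exact ⟨_, closure_Ioo hs.ne ▸ h_closed⟩

lemma liftCurve_eq_skew (h : IsLineRealization ε γ δ σ)
    (hγ : ∀ t s, t ≤ s → ContinuousOn γ (Icc t s) → γ s = φ (s - t) (γ t)) {s s' : ℝ} (hs : s ≤ s')
    (h_cont : ∀ r ∈ Ioo s s', ContinuousAt γ (σ r)) :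
    Θ.liftCurve δ s' = Θ.skew φ (σ s' - σ s) (Θ.liftCurve δ s) := by
  rcases hs.eq_or_lt with rfl | hlt
  · simp
  obtain ⟨y, hy⟩ := h.exists_eq_flow hγ hlt h_cont
  exact Θ.liftCurve_eq_skew fun r hr => hy r (uIcc_of_le hs ▸ hr)

lemma near_liftCurve (h : IsLineRealization ε γ δ σ) {u s s' : ℝ} (hs : s ≤ s')
    (hu : ¬ ContinuousAt γ u) (h_const : ∀ r ∈ Icc s s', σ r = u) :
    Θ.Near (2 * ε) (Θ.liftCurve δ s) (Θ.liftCurve δ s') := by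
  have h_ball (r) (hr : r ∈ Icc s s') : dist (δ r) (γ u) < ε := by
    rw [← h_const r hr] at hu ⊢
    exact h.mem_ball r hu
  refine ⟨(Path.segment s s').map δ.continuous, fun r => ?_, Θ.liftCurve_snd δ s s'⟩
  have h_mem : Path.segment s s' r ∈ Icc s s' := by
    rw [← segment_eq_Icc hs, segment_eq_image_lineMap]
    exact mem_image_of_mem _ r.2
  change dist (δ (Path.segment s s' r)) (δ s') < _
  linarith [dist_triangle_right (δ (Path.segment s s' r)) (δ s') (γ u), h_ball _ h_mem,
    h_ball s' (right_mem_Icc.2 hs)]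

end IsLineRealization

end Realization

section Sampling

variable {M : Type u} [MetricSpace M] {A : Type*} [AddCommGroup A] {Θ : PathCocycle M A}
  {φ : Flow ℝ M}

lemma IsPeriodicPseudoOrbit.eq_flow {ε T l : ℝ} {γ : ℝ → M} (h : IsPeriodicPseudoOrbit φ ε T l γ)
    (t s : ℝ) (hts : t ≤ s) (h_cont : ContinuousOn γ (Icc t s)) : γ s = φ (s - t) (γ t) := by
  obtain ⟨-, -, -, Δ, -, -, -, -, h_flow, -⟩ := h
  exact h_flow t s hts h_cont

lemma IsPeriodicPseudoOrbit.le_abs_sub {ε T l : ℝ} {γ : ℝ → M}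
    (h : IsPeriodicPseudoOrbit φ ε T l γ) {s t : ℝ} (hs : ¬ ContinuousAt γ s)
    (ht : ¬ ContinuousAt γ t) (hst : s ≠ t) : T ≤ |s - t| := by
  obtain ⟨-, -, -, Δ, -, -, h_cont, h_sep, -⟩ := h
  exact h_sep s (not_imp_comm.1 (h_cont s) hs) t (not_imp_comm.1 (h_cont t) ht) hst

lemma IsLineRealization.near_skew_liftCurve {ε ε' η T l : ℝ} {γ : ℝ → M} {δ : C(ℝ, M)}
    {σ : C(ℝ, ℝ)} (h : IsLineRealization ε γ δ σ) (hγ : IsPeriodicPseudoOrbit φ ε' T l γ)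
    (hη : 0 < η)
    (hε : ∀ X Y, Θ.Near (2 * ε) X Y → ∀ t ∈ Icc 0 T, Θ.Near η (Θ.skew φ t X) (Θ.skew φ t Y))
    {s s' : ℝ} (hs : s ≤ s') (hT : σ s' - σ s < T) :
    Θ.Near η (Θ.skew φ (σ s' - σ s) (Θ.liftCurve δ s)) (Θ.liftCurve δ s') := by
  by_cases h_disc : ∃ r₀ ∈ Icc s s', ¬ ContinuousAt γ (σ r₀)
  · obtain ⟨r₀, hr₀, h_r₀⟩ := h_disc
    have h_unique (r) (hr : r ∈ Icc s s') (h_r : ¬ ContinuousAt γ (σ r)) : σ r = σ r₀ := by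
      by_contra hne
      rcases le_abs'.1 (hγ.le_abs_sub h_r h_r₀ hne) with h_sep | h_sep <;>
        linarith [h.monotone hr.1, h.monotone hr.2, h.monotone hr₀.1, h.monotone hr₀.2]
    have h_compact : IsCompact (Icc s s' ∩ σ ⁻¹' {σ r₀}) :=
      isCompact_Icc.inter_right (isClosed_singleton.preimage σ.continuous)
    obtain ⟨s₁, ⟨hs₁, hσ₁⟩, h_min⟩ := h_compact.exists_isLeast ⟨r₀, hr₀, rfl⟩
    obtain ⟨s₂, ⟨hs₂, hσ₂⟩, h_max⟩ := h_compact.exists_isGreatest ⟨r₀, hr₀, rfl⟩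
    have h_le : s₁ ≤ s₂ := h_max ⟨hs₁, hσ₁⟩
    have h_before : Θ.liftCurve δ s₁ = Θ.skew φ (σ s₁ - σ s) (Θ.liftCurve δ s) :=
      h.liftCurve_eq_skew hγ.eq_flow hs₁.1 fun r hr => by
        by_contra h_r
        have hr' : r ∈ Icc s s' := ⟨hr.1.le, hr.2.le.trans hs₁.2⟩
        exact (h_min ⟨hr', h_unique r hr' h_r⟩).not_gt hr.2
    have h_after : Θ.liftCurve δ s' = Θ.skew φ (σ s' - σ s₂) (Θ.liftCurve δ s₂) :=
      h.liftCurve_eq_skew hγ.eq_flow hs₂.2 fun r hr => by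
        by_contra h_r
        have hr' : r ∈ Icc s s' := ⟨hs₂.1.trans hr.1.le, hr.2.le⟩
        exact (h_max ⟨hr', h_unique r hr' h_r⟩).not_gt hr.1
    have h_jump : Θ.Near (2 * ε) (Θ.liftCurve δ s₁) (Θ.liftCurve δ s₂) :=
      h.near_liftCurve h_le h_r₀ fun r hr =>
        le_antisymm (hσ₂ ▸ h.monotone hr.2) (hσ₁ ▸ h.monotone hr.1)
    have h_near := hε _ _ h_jump (σ s' - σ s₂) ⟨sub_nonneg.2 (h.monotone hs₂.2), by
      linarith [h.monotone hs₂.1]⟩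
    rwa [← h_after, h_before, ← PathCocycle.skew_add, hσ₁, hσ₂, add_comm,
      sub_add_sub_cancel] at h_near
  · push Not at h_disc
    rw [h.liftCurve_eq_skew hγ.eq_flow hs fun r hr => h_disc r (Ioo_subset_Icc_self hr)]
    exact .refl hη _

lemma exists_sampling_times {l h : ℝ} (hl : 0 < l) (hh : 0 < h) {k n : ℕ} (hn : 0 < n)
    (hnk : n * h = k * l) {σ : ℝ → ℝ} (hσ : Continuous σ) (hσ0 : σ 0 = 0)
    (hσ_add : ∀ (s : ℝ) (j : ℕ), σ (s + j) = σ s + j * l) :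
    ∃ s : ℕ → ℝ, (∀ i, σ (s i) = i * h) ∧ ∀ i, s (i + n) = s i + k := by
  have h_surj (j : ℕ) : ∃ s, σ s = j * h := by
    obtain ⟨N, hN⟩ := exists_nat_ge (j * h / l)
    rw [div_le_iff₀ hl] at hN
    have hσN : σ N = N * l := by simpa [hσ0] using hσ_add 0 N
    obtain ⟨s, -, hs⟩ := intermediate_value_Icc (Nat.cast_nonneg (α := ℝ) N) hσ.continuousOn
      (show (j : ℝ) * h ∈ Icc (σ 0) (σ N) by rw [hσ0, hσN]; exact ⟨by positivity, hN⟩)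
    exact ⟨s, hs⟩
  choose b hb using h_surj
  refine ⟨fun i => b (i % n) + (i / n * k : ℕ), fun i => ?_, fun i => ?_⟩
  · have h_div : ((i % n : ℕ) : ℝ) + n * (i / n : ℕ) = i := mod_cast Nat.mod_add_div i n
    rw [hσ_add, hb]
    push_cast
    linear_combination h * h_div - (i / n : ℕ) * hnk
  · simp only [Nat.add_mod_right, Nat.add_div_right i hn]
    push_cast
    ring

variable (Θ φ) in
/- The realization is sampled at regular times: a sampling interval shorter than `T` contains at
most one jump. -/
lemma exists_chain_of_isRealization [CompactSpace M] (T : ℝ) {η : ℝ} (hη : 0 < η) :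
    ∃ ε > 0, ∀ (l : ℝ) (γ : ℝ → M) (δ : C(unitInterval, M)), IsPeriodicPseudoOrbit φ ε T l γ →
      IsRealization ε l γ δ → ∀ (h : ℝ) (k n : ℕ), 0 < h → h < T → 0 < n → n * h = k * l →
        ∃ Y : ℕ → M × A, (∀ i, Θ.Near η (Θ.skew φ h (Y i)) (Y (i + 1))) ∧
          ∀ i, Y (i + n) = raise (k • Θ δ) (Y i) := by
  obtain ⟨ε, hε, h_skew⟩ := Θ.exists_near_skew_skew φ hη T
  refine ⟨ε / 2, half_pos hε, fun l γ δ hγ hδ h k n hh hhT hn hnk => ?_⟩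
  obtain ⟨δ', σ, h_line, hδ', hσ0, hσ_add⟩ := hδ.exists_isLineRealization hγ.2.1
  obtain ⟨s, hσs, hs⟩ := exists_sampling_times hγ.1 hh hn hnk σ.continuous hσ0 hσ_add
  refine ⟨fun i => Θ.liftCurve δ' (s i), fun i => ?_, fun i => ?_⟩
  · have h_time : σ (s (i + 1)) - σ (s i) = h := by
      rw [hσs, hσs]
      push_cast
      ring
    have h_le : s i ≤ s (i + 1) := (h_line.monotone.reflect_lt (by linarith)).le
    have h_near := h_line.near_skew_liftCurve (η := η) (Θ := Θ) hγ hη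
      (by rwa [mul_div_cancel₀ _ two_ne_zero]) h_le (h_time ▸ hhT)
    rwa [h_time] at h_near
  · have h_periodic : Function.Periodic δ' 1 := fun r => by
      rw [hδ', hδ', show unitFract (r + 1) = unitFract r from Subtype.ext (Int.fract_add_one r)]
    have h_along : Θ.along δ' 0 1 = Θ δ := congrArg Θ <| ContinuousMap.ext fun u => by
      simpa [AffineMap.lineMap_apply, hδ'] using apply_unitFract_coe hδ.1 u
    change Θ.liftCurve δ' (s (i + n)) = _
    rw [hs, Θ.liftCurve_add_nat h_periodic, h_along]

lemma exists_sampling_step {l T : ℝ} (hl : 0 < l) (hT : 0 < T) :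
    ∃ (h : ℝ) (k n : ℕ), T / 4 ≤ h ∧ h ≤ T / 2 ∧ 0 < k ∧ 0 < n ∧ n * h = k * l := by
  obtain ⟨k, hk⟩ := exists_nat_gt (T / l)
  rw [div_lt_iff₀ hl] at hk
  have hkl : (0 : ℝ) < k * l := hT.trans hk
  have hk_pos : 0 < k := Nat.pos_of_ne_zero fun hk0 => by simp [hk0] at hkl
  have h_floor := Nat.lt_floor_add_one (4 * (k * l) / T)
  have h_floor_le := Nat.floor_le (a := 4 * (k * l) / T) (by positivity)
  have h_four : 4 ≤ ⌊4 * (k * l) / T⌋₊ :=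
    Nat.le_floor (by rw [Nat.cast_ofNat, le_div_iff₀ hT]; linarith)
  set n := ⌊4 * (k * l) / T⌋₊
  have hn_four : (4 : ℝ) ≤ n := mod_cast h_four
  have hn : (0 : ℝ) < n := by linarith
  rw [div_lt_iff₀ hT] at h_floor
  rw [le_div_iff₀ hT] at h_floor_le
  refine ⟨k * l / n, k, n, ?_, ?_, hk_pos, by omega, mul_div_cancel₀ _ hn.ne'⟩
  · rw [le_div_iff₀ hn]
    linarith
  · rw [div_le_iff₀ hn]
    nlinarith

end Sampling

/-! ### Pseudo-orbits -/

section TimeFlow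

variable {N : Type*} [TopologicalSpace N] {ψ : ℝ → N → N}

/-- A flow of which only the continuity in time is required. This is all that pseudo-orbits see, and
it covers flows on `M` as well as their lifts to the covering. -/
structure IsTimeFlow (ψ : ℝ → N → N) : Prop where
  map_zero : ∀ x, ψ 0 x = x
  map_add : ∀ s t x, ψ (s + t) x = ψ t (ψ s x)
  continuous : ∀ x, Continuous fun t => ψ t x

lemma isTimeFlow_flow (φ : Flow ℝ N) : IsTimeFlow fun t x => φ t x where
  map_zero := φ.map_zero_apply
  map_add s t x := by rw [add_comm, Flow.map_add]
  continuous x := φ.continuous continuous_id continuous_const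

lemma Cover.isTimeFlow_liftFlow {M : Type u} [TopologicalSpace M] {α : CohomH1 M} {x₀ : M}
    (φ : Flow ℝ M) : IsTimeFlow (liftFlow φ : ℝ → Cover α x₀ → Cover α x₀) where
  map_zero := liftFlow_zero φ
  map_add := liftFlow_add φ
  continuous := continuous_liftFlow φ

lemma IsTimeFlow.tendsto_of_eqOn (hψ : IsTimeFlow ψ) {γ : ℝ → N} {c u v : ℝ} {x : N} (huv : u < v)
    (h : ∀ t ∈ Ioo u v, γ t = ψ (t - c) x) : Tendsto γ (𝓝[<] v) (𝓝 (ψ (v - c) x)) := by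
  have h_lim : Tendsto (fun t => ψ (t - c) x) (𝓝[<] v) (𝓝 (ψ (v - c) x)) :=
    (((hψ.continuous x).comp (continuous_sub_right c)).tendsto v).mono_left nhdsWithin_le_nhds
  refine h_lim.congr' ?_
  filter_upwards [Ioo_mem_nhdsLT huv] with t ht using (h t ht).symm

end TimeFlow

section PseudoOrbit

variable {N : Type u} [TopologicalSpace N] {dist : N → N → ℝ} {ψ : ℝ → N → N} {ε T l a b : ℝ}
  {γ : ℝ → N}

lemma IsPseudoOrbit.eq_flow (h : IsPseudoOrbit dist ψ ε T l γ) (ha : 0 ≤ a) (hab : a ≤ b)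
    (hb : b < l) (h_cont : ∀ t ∈ Ioc a b, ContinuousWithinAt γ (Ico 0 l) t) :
    γ b = ψ (b - a) (γ a) := by
  obtain ⟨-, h_right, Δ, -, -, -, -, -, h_flow, -⟩ := h
  refine h_flow a b ha hab hb fun t ht => ?_
  rcases ht.1.eq_or_lt with rfl | hat
  · exact (h_right a ⟨ha, hab.trans_lt hb⟩).mono fun s hs => ⟨hs.1, hs.2.trans_lt hb⟩
  · exact (h_cont t ⟨hat, ht.2⟩).mono fun s hs => ⟨ha.trans hs.1, hs.2.trans_lt hb⟩

lemma IsPseudoOrbit.eq_flow_or_exists_jump [T2Space N] (h : IsPseudoOrbit dist ψ ε T l γ)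
    (hψ : IsTimeFlow ψ) (ha : 0 ≤ a) (hab : a ≤ b) (hb : b < l) (hT : b - a < T) :
    γ b = ψ (b - a) (γ a) ∨
      ∃ u ∈ Ioc a b, dist (γ u) (ψ (u - a) (γ a)) < ε ∧ γ b = ψ (b - u) (γ u) := by
  have h_flow {a' b' : ℝ} (haa' : a ≤ a') (hab' : a' ≤ b') (hbb' : b' ≤ b)
      (hc : ∀ t ∈ Ioc a' b', ContinuousWithinAt γ (Ico 0 l) t) : γ b' = ψ (b' - a') (γ a') :=
    h.eq_flow (ha.trans haa') hab' (hbb'.trans_lt hb) hc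
  obtain ⟨-, -, Δ, -, -, -, h_cont, h_sep, -, h_jump⟩ := h
  have h_mem {t : ℝ} (ht : t ∈ Ioc a b) : t ∈ Ico 0 l := ⟨ha.trans ht.1.le, ht.2.trans_lt hb⟩
  by_cases h_disc : ∃ u ∈ Ioc a b, u ∈ Δ
  · obtain ⟨u, hu, huΔ⟩ := h_disc
    have h_unique {t : ℝ} (ht : t ∈ Ioc a b) (htu : t ≠ u) : t ∉ Δ := fun htΔ => by
      rcases le_abs'.1 (h_sep t htΔ u huΔ htu) with h_le | h_le <;>
        linarith [ht.1, ht.2, hu.1, hu.2]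
    obtain ⟨y, hy, hdy⟩ := h_jump u huΔ
    have h_before : Tendsto γ (𝓝[<] u) (𝓝 (ψ (u - a) (γ a))) :=
      hψ.tendsto_of_eqOn hu.1 fun t ht => h_flow le_rfl ht.1.le (ht.2.le.trans hu.2) fun s hs =>
        have hs' : s ∈ Ioc a b := ⟨hs.1, hs.2.trans (ht.2.le.trans hu.2)⟩
        h_cont s (h_mem hs') (h_unique hs' (hs.2.trans_lt ht.2).ne)
    refine .inr ⟨u, hu, tendsto_nhds_unique hy h_before ▸ hdy, ?_⟩
    exact h_flow hu.1.le hu.2 le_rfl fun t ht =>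
      have ht' : t ∈ Ioc a b := ⟨hu.1.trans ht.1, ht.2⟩
      h_cont t (h_mem ht') (h_unique ht' ht.1.ne')
  · push Not at h_disc
    exact .inl (h_flow le_rfl hab le_rfl fun t ht => h_cont t (h_mem ht) (h_disc t ht))

end PseudoOrbit

section CoverPseudoOrbit

variable {M : Type u} [MetricSpace M] {α : CohomH1 M} {x₀ : M} {d : MetricSpace (Cover α x₀)}

lemma Cover.t2Space (hd : IsLocallyLiftedMetric d) : T2Space (Cover α x₀) := by
  have h : ∀ (X : Type u) [MetricSpace X], T2Space X := fun X _ => inferInstance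
  replace h := @h _ d
  rwa [hd.compatible] at h

lemma exists_near_of_isPseudoOrbit [CompactSpace M] [LocallyPathConnectedSpace M]
    (hd : IsLocallyLiftedMetric d) (φ : Flow ℝ M) (T : ℝ) {η : ℝ} (hη : 0 < η) :
    ∃ ε > 0, ∀ (l : ℝ) (γ : ℝ → Cover α x₀), IsPseudoOrbit d.dist (liftFlow φ) ε T l γ →
      ∀ a b, 0 ≤ a → a ≤ b → b < l → b - a < T →
        (cohomCocycle α).Near η ((cohomCocycle α).skew φ (b - a) (γ a).pt) (γ b).pt := by
  have := Cover.t2Space hd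
  obtain ⟨δ, hδ, h_skew⟩ := (cohomCocycle α).exists_near_skew_skew φ hη T
  obtain ⟨ε, hε, h_near⟩ := Cover.exists_near_of_dist_lt hd hδ
  refine ⟨ε, hε, fun l γ hγ a b ha hab hb hT => ?_⟩
  rcases hγ.eq_flow_or_exists_jump (Cover.isTimeFlow_liftFlow φ) ha hab hb hT with
    h_eq | ⟨u, hu, h_jump, h_eq⟩
  · rw [h_eq, Cover.pt_liftFlow]
    exact .refl hη _
  · have h_u := h_skew _ _ (h_near _ _ (d.dist_comm (γ u) _ ▸ h_jump)) (b - u)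
      ⟨sub_nonneg.2 hu.2, by linarith [hu.1]⟩
    rw [Cover.pt_liftFlow, ← PathCocycle.skew_add, add_comm, sub_add_sub_cancel] at h_u
    rwa [h_eq, Cover.pt_liftFlow φ (b - u)]

end CoverPseudoOrbit

section Spaced

/-- Successive times, with gaps bounded below by the positive number `T`. -/
structure IsSpaced (T : ℝ) (t : ℤ → ℝ) : Prop where
  pos : 0 < T
  le_sub : ∀ k, T ≤ t (k + 1) - t k

namespace IsSpaced

variable {t : ℤ → ℝ} {T s : ℝ}

lemma strictMono (ht : IsSpaced T t) : StrictMono t :=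
  strictMono_int_of_lt_succ fun k => sub_pos.1 (ht.pos.trans_le (ht.le_sub k))

lemma add_mul_le (ht : IsSpaced T t) (k : ℤ) (n : ℕ) : t k + n * T ≤ t (k + n) := by
  induction n with
  | zero => simp
  | succ n ih =>
    have h_gap := ht.le_sub (k + n)
    push_cast
    rw [← add_assoc]
    linarith

lemma exists_mem_Ico (ht : IsSpaced T t) (s : ℝ) : ∃ k, s ∈ Ico (t k) (t (k + 1)) := by
  obtain ⟨n, hn⟩ := exists_nat_gt (|s - t 0| / T)
  rw [div_lt_iff₀ ht.pos] at hn
  have h_above := ht.add_mul_le 0 n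
  have h_below := ht.add_mul_le (-n) n
  rw [neg_add_cancel] at h_below
  rw [zero_add] at h_above
  have h_bdd (k : ℤ) (hk : t k ≤ s) : k ≤ n :=
    ht.strictMono.le_iff_le.1 (by linarith [le_abs_self (s - t 0)])
  obtain ⟨k, hk, h_max⟩ := Int.exists_greatest_of_bdd (P := fun k => t k ≤ s) ⟨n, h_bdd⟩
    ⟨-n, by linarith [neg_abs_le (s - t 0)]⟩
  exact ⟨k, hk, not_le.1 fun h => (lt_add_one k).not_ge (h_max _ h)⟩

lemma mem_Ico_unique (ht : IsSpaced T t) {j k : ℤ} (hj : s ∈ Ico (t j) (t (j + 1)))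
    (hk : s ∈ Ico (t k) (t (k + 1))) : j = k :=
  le_antisymm (Int.lt_add_one_iff.1 (ht.strictMono.lt_iff_lt.1 (hj.1.trans_lt hk.2)))
    (Int.lt_add_one_iff.1 (ht.strictMono.lt_iff_lt.1 (hk.1.trans_lt hj.2)))

lemma le_abs_sub (ht : IsSpaced T t) {s s' : ℝ} (hs : s ∈ range t) (hs' : s' ∈ range t)
    (hne : s ≠ s') : T ≤ |s - s'| := by
  have h_lt {i j : ℤ} (hij : i < j) : T ≤ t j - t i :=
    (ht.le_sub i).trans (sub_le_sub_right (ht.strictMono.monotone (Int.add_one_le_of_lt hij)) _)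
  obtain ⟨i, rfl⟩ := hs
  obtain ⟨j, rfl⟩ := hs'
  rcases lt_or_gt_of_ne (ne_of_apply_ne t hne) with hij | hij
  · exact abs_sub_comm (t i) (t j) ▸ (h_lt hij).trans (le_abs_self _)
  · exact (h_lt hij).trans (le_abs_self _)

end IsSpaced

end Spaced

section PiecewiseOrbit

/-- The curve `γ` follows the orbit of `x k` during `[t k, t (k + 1))`. -/
def IsPiecewiseOrbit {N : Type*} (ψ : ℝ → N → N) (t : ℤ → ℝ) (x : ℤ → N) (γ : ℝ → N) : Prop :=
  ∀ k, ∀ s ∈ Ico (t k) (t (k + 1)), γ s = ψ (s - t k) (x k)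

lemma IsSpaced.exists_isPiecewiseOrbit {N : Type*} {t : ℤ → ℝ} {T : ℝ} (ht : IsSpaced T t)
    (ψ : ℝ → N → N) (x : ℤ → N) : ∃ γ, IsPiecewiseOrbit ψ t x γ := by
  choose κ hκ using ht.exists_mem_Ico
  refine ⟨fun s => ψ (s - t (κ s)) (x (κ s)), fun k s hs => ?_⟩
  simp only [ht.mem_Ico_unique (hκ s) hs]

namespace IsPiecewiseOrbit

variable {N : Type*} [TopologicalSpace N] {ψ : ℝ → N → N} {t : ℤ → ℝ} {x : ℤ → N} {γ : ℝ → N}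
  {T : ℝ}

lemma apply_start (hγ : IsPiecewiseOrbit ψ t x γ) (hψ : IsTimeFlow ψ) (ht : IsSpaced T t) (k : ℤ) :
    γ (t k) = x k := by
  rw [hγ k (t k) ⟨le_rfl, ht.strictMono (lt_add_one k)⟩, sub_self, hψ.map_zero]

lemma continuousWithinAt_Ici (hγ : IsPiecewiseOrbit ψ t x γ) (hψ : IsTimeFlow ψ)
    (ht : IsSpaced T t) (s : ℝ) : ContinuousWithinAt γ (Ici s) s := by
  obtain ⟨k, hk⟩ := ht.exists_mem_Ico s
  have h_orbit : ContinuousWithinAt (fun s' => ψ (s' - t k) (x k)) (Ici s) s :=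
    ((hψ.continuous (x k)).comp (continuous_sub_right (t k))).continuousWithinAt
  refine h_orbit.congr_of_eventuallyEq ?_ (hγ k s hk)
  filter_upwards [Ico_mem_nhdsGE hk.2] with s' hs' using hγ k s' ⟨hk.1.trans hs'.1, hs'.2⟩

lemma continuousAt (hγ : IsPiecewiseOrbit ψ t x γ) (hψ : IsTimeFlow ψ) (ht : IsSpaced T t) {s : ℝ}
    (hs : s ∉ range t) : ContinuousAt γ s := by
  obtain ⟨k, hk⟩ := ht.exists_mem_Ico s
  have hlt : t k < s := lt_of_le_of_ne hk.1 fun h => hs ⟨k, h⟩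
  have h_orbit : ContinuousAt (fun s' => ψ (s' - t k) (x k)) s :=
    ((hψ.continuous (x k)).comp (continuous_sub_right (t k))).continuousAt
  refine h_orbit.congr ?_
  filter_upwards [Ioo_mem_nhds hlt hk.2] with s' hs' using (hγ k s' ⟨hs'.1.le, hs'.2⟩).symm

lemma tendsto_nhdsLT (hγ : IsPiecewiseOrbit ψ t x γ) (hψ : IsTimeFlow ψ) (ht : IsSpaced T t)
    (k : ℤ) : Tendsto γ (𝓝[<] (t (k + 1))) (𝓝 (ψ (t (k + 1) - t k) (x k))) :=
  hψ.tendsto_of_eqOn (ht.strictMono (lt_add_one k)) fun s hs => hγ k s ⟨hs.1.le, hs.2⟩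

lemma exists_tendsto_nhdsLT (hγ : IsPiecewiseOrbit ψ t x γ) (hψ : IsTimeFlow ψ)
    (ht : IsSpaced T t) {dist : N → N → ℝ} {ε : ℝ} {k : ℤ}
    (h_jump : dist (x (k + 1)) (ψ (t (k + 1) - t k) (x k)) < ε) :
    ∃ y, Tendsto γ (𝓝[<] (t (k + 1))) (𝓝 y) ∧ dist (γ (t (k + 1))) y < ε :=
  ⟨_, hγ.tendsto_nhdsLT hψ ht k, hγ.apply_start hψ ht (k + 1) ▸ h_jump⟩

lemma eq_flow [T2Space N] (hγ : IsPiecewiseOrbit ψ t x γ) (hψ : IsTimeFlow ψ) (ht : IsSpaced T t)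
    {a b : ℝ} (hab : a ≤ b) (h_cont : ContinuousOn γ (Icc a b)) : γ b = ψ (b - a) (γ a) := by
  obtain ⟨k₀, hk₀⟩ := ht.exists_mem_Ico a
  have h_piece (k) (hk : k₀ ≤ k) :
      ∀ s ∈ Ico (t k) (t (k + 1)), s ∈ Icc a b → γ s = ψ (s - a) (γ a) := by
    induction k, hk using Int.leInduction with
    | base =>
      intro s hs _
      rw [hγ k₀ s hs, hγ k₀ a hk₀, ← hψ.map_add, add_comm, sub_add_sub_cancel]
    | succ k hk ih =>
      intro s hs hsab
      have hat : a < t (k + 1) := hk₀.2.trans_le (ht.strictMono.monotone (by lia))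
      have htb : t (k + 1) ∈ Icc a b := ⟨hat.le, hs.1.trans hsab.2⟩
      have h_lim : Tendsto γ (𝓝[<] (t (k + 1))) (𝓝 (γ (t (k + 1)))) := by
        rw [← nhdsWithin_Ioo_eq_nhdsLT hat]
        exact (h_cont _ htb).mono fun u hu => ⟨hu.1.le, hu.2.le.trans htb.2⟩
      have h_lim_flow : Tendsto γ (𝓝[<] (t (k + 1))) (𝓝 (ψ (t (k + 1) - a) (γ a))) :=
        hψ.tendsto_of_eqOn (max_lt hat (ht.strictMono (lt_add_one k))) fun u hu =>
          ih u ⟨(le_max_right _ _).trans hu.1.le, hu.2⟩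
            ⟨(le_max_left _ _).trans hu.1.le, hu.2.le.trans htb.2⟩
      have h_start : x (k + 1) = ψ (t (k + 1) - a) (γ a) :=
        (hγ.apply_start hψ ht (k + 1)).symm.trans (tendsto_nhds_unique h_lim h_lim_flow)
      rw [hγ _ s hs, h_start, ← hψ.map_add, add_comm, sub_add_sub_cancel]
  obtain ⟨k, hk⟩ := ht.exists_mem_Ico b
  have hk₀k : k₀ < k + 1 := ht.strictMono.lt_iff_lt.1 (hk₀.1.trans_lt (hab.trans_lt hk.2))
  exact h_piece k (Int.lt_add_one_iff.1 hk₀k) b hk ⟨hab, le_rfl⟩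

end IsPiecewiseOrbit

lemma IsPiecewiseOrbit.isPseudoOrbit {N : Type u} [TopologicalSpace N] [T2Space N]
    {dist : N → N → ℝ} {ψ : ℝ → N → N} {ε T : ℝ} {t : ℤ → ℝ} {x : ℤ → N} {γ : ℝ → N}
    (hγ : IsPiecewiseOrbit ψ t x γ) (hψ : IsTimeFlow ψ) (ht : IsSpaced T t) (ht0 : t 0 = 0)
    (h_jump : ∀ k, 0 ≤ k → dist (x (k + 1)) (ψ (t (k + 1) - t k) (x k)) < ε) {n : ℤ} (hn : 0 < n) :
    IsPseudoOrbit dist ψ ε T (t n) γ := by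
  have h_right := hγ.continuousWithinAt_Ici hψ ht
  refine ⟨ht0 ▸ ht.strictMono hn, fun s _ => (h_right s).mono Ico_subset_Ici_self,
    t '' Ioo 0 n, (finite_Ioo 0 n).image _, ?_, ?_, fun s hs hsΔ => ?_,
    fun s hs s' hs' => ht.le_abs_sub (image_subset_range _ _ hs) (image_subset_range _ _ hs'),
    fun a b _ hab _ h_cont => hγ.eq_flow hψ ht hab h_cont, ?_⟩
  · rintro _ ⟨k, hk, rfl⟩
    exact ⟨ht0 ▸ (ht.strictMono hk.1).le, ht.strictMono hk.2⟩
  · rw [Set.disjoint_left]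
    rintro _ ⟨k, hk, rfl⟩ h
    have h_one := ht.le_sub 0
    have h_le := ht.strictMono.monotone (Int.add_one_le_of_lt hk.1)
    linarith [h.2]
  · rcases hs.1.eq_or_lt with rfl | hs0
    · exact (h_right 0).mono Ico_subset_Ici_self
    · refine (hγ.continuousAt hψ ht ?_).continuousWithinAt
      rintro ⟨k, rfl⟩
      exact hsΔ ⟨k, ⟨ht.strictMono.lt_iff_lt.1 (ht0.symm ▸ hs0),
        ht.strictMono.lt_iff_lt.1 hs.2⟩, rfl⟩
  · rintro _ ⟨k, hk, rfl⟩
    obtain ⟨j, rfl⟩ : ∃ j, k = j + 1 := ⟨k - 1, (sub_add_cancel k 1).symm⟩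
    exact hγ.exists_tendsto_nhdsLT hψ ht (h_jump j (Int.lt_add_one_iff.1 hk.1))

lemma IsPiecewiseOrbit.periodic {N : Type*} {ψ : ℝ → N → N} {T l : ℝ} {t : ℤ → ℝ} {x : ℤ → N}
    {γ : ℝ → N} (hγ : IsPiecewiseOrbit ψ t x γ) (ht : IsSpaced T t) {n : ℤ}
    (htn : ∀ k, t (k + n) = t k + l) (hxn : Function.Periodic x n) : Function.Periodic γ l := by
  intro s
  obtain ⟨k, hk⟩ := ht.exists_mem_Ico s
  rw [hγ k s hk, hγ (k + n) (s + l), htn, hxn, add_sub_add_right_eq_sub]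
  rw [add_right_comm, htn, htn]
  exact ⟨add_le_add_left hk.1 l, add_lt_add_left hk.2 l⟩

lemma IsPiecewiseOrbit.isPeriodicPseudoOrbit {M : Type u} [MetricSpace M] {φ : Flow ℝ M}
    {ε T l : ℝ} {t : ℤ → ℝ} {x : ℤ → M} {γ : ℝ → M}
    (hγ : IsPiecewiseOrbit (fun s y => φ s y) t x γ) (ht : IsSpaced T t) (ht0 : t 0 = 0)
    (h_jump : ∀ k, dist (x (k + 1)) (φ (t (k + 1) - t k) (x k)) < ε) {n : ℤ} (hn : 0 < n)
    (htn : ∀ k, t (k + n) = t k + l) (hxn : Function.Periodic x n) :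
    IsPeriodicPseudoOrbit φ ε T l γ := by
  have hψ := isTimeFlow_flow φ
  have hl : t n = l := by simpa [ht0] using htn 0
  refine ⟨hl ▸ ht0 ▸ ht.strictMono hn, hγ.periodic ht htn hxn, hγ.continuousWithinAt_Ici hψ ht,
    range t, fun s => ⟨?_, ?_⟩, ?_, fun s hs => hγ.continuousAt hψ ht hs,
    fun s hs s' hs' => ht.le_abs_sub hs hs',
    fun a b hab h_cont => hγ.eq_flow hψ ht hab h_cont, ?_⟩
  · rintro ⟨k, hk⟩
    have h_shift := htn (k - n)
    rw [sub_add_cancel] at h_shift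
    exact ⟨k - n, add_right_cancel (h_shift.symm.trans hk)⟩
  · rintro ⟨k, rfl⟩
    exact ⟨k + n, htn k⟩
  · refine ((finite_Ico 0 n).image t).subset ?_
    rintro _ ⟨⟨k, rfl⟩, hk⟩
    exact ⟨k, ⟨ht.strictMono.le_iff_le.1 (ht0.symm ▸ hk.1),
      ht.strictMono.lt_iff_lt.1 (hl.symm ▸ hk.2)⟩, rfl⟩
  · rintro _ ⟨k, rfl⟩
    obtain ⟨j, rfl⟩ : ∃ j, k = j + 1 := ⟨k - 1, (sub_add_cancel k 1).symm⟩
    exact hγ.exists_tendsto_nhdsLT hψ ht (h_jump j)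

end PiecewiseOrbit

/-! ### Closed chains -/

section ClosedChain

variable {M : Type*} [MetricSpace M] {A : Type*} [AddCommGroup A]

/-- A closed chain of `n` orbit arcs. The `k`-th arc starts at `m k`, has length `τ k ≥ T`, and is
followed by a jump of size `ε` to `m (k + 1)`; arc and jump together raise the height by `w k`. -/
structure IsClosedChain (Θ : PathCocycle M A) (φ : Flow ℝ M) (ε T : ℝ) (n : ℕ) (m : ℕ → M)
    (τ : ℕ → ℝ) (w : ℕ → A) : Prop where
  pos : 0 < n
  closed : m n = m 0
  le : ∀ k < n, T ≤ τ k
  near : ∀ k < n, Θ.Near ε (Θ.skew φ (τ k) (m k, 0)) (m (k + 1), w k)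

/-- A closed chain of `n` orbit arcs, unrolled to a sequence indexed by the integers. The `k`-th arc
starts at `x k` at the time `t k`. -/
structure IsPeriodicChain (Θ : PathCocycle M A) (φ : Flow ℝ M) (ε T : ℝ) (n : ℕ) (x : ℤ → M)
    (t : ℤ → ℝ) (w : ℤ → A) : Prop where
  pos : 0 < n
  spaced : IsSpaced T t
  start : t 0 = 0
  time_add : ∀ k, t (k + n) = t k + t n
  point_periodic : Function.Periodic x n
  height_periodic : Function.Periodic w n
  near : ∀ k, Θ.Near ε (Θ.skew φ (t (k + 1) - t k) (x k, 0)) (x (k + 1), w k)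

variable {Θ : PathCocycle M A} {φ : Flow ℝ M} {ε T : ℝ} {n : ℕ}

lemma ediv_toNat_emod_add_one (hn : 0 < n) (k : ℤ) :
    ((k + 1) / n = k / n ∧ ((k + 1) % n).toNat = (k % n).toNat + 1) ∨
      ((k + 1) / n = k / n + 1 ∧ ((k + 1) % n).toNat = 0 ∧ (k % n).toNat + 1 = n) := by
  have hn' : (0 : ℤ) < n := by exact_mod_cast hn
  have h_lt := Int.emod_lt_of_pos k hn'
  have h_nonneg := Int.emod_nonneg k hn'.ne'
  have h_div := Int.emod_add_mul_ediv k n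
  by_cases hk : k % n + 1 < n
  · obtain ⟨h_ediv, h_emod⟩ :=
      (Int.ediv_emod_unique (a := k + 1) (r := k % n + 1) (q := k / n) hn').2 ⟨by lia, by lia, hk⟩
    exact .inl ⟨h_ediv, by lia⟩
  · obtain ⟨h_ediv, h_emod⟩ :=
      (Int.ediv_emod_unique (a := k + 1) (r := 0) (q := k / n + 1) hn').2
        ⟨by rw [mul_add]; lia, le_rfl, hn'⟩
    exact .inr ⟨h_ediv, by lia, by lia⟩

lemma IsClosedChain.exists_isPeriodicChain {m : ℕ → M} {τ : ℕ → ℝ} {w : ℕ → A}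
    (h : IsClosedChain Θ φ ε T n m τ w) (hT : 0 < T) :
    ∃ x t W, IsPeriodicChain Θ φ ε T n x t W ∧ x 0 = m 0 ∧
      ∑ k ∈ Finset.range n, W k = ∑ k ∈ Finset.range n, w k := by
  have hn : (n : ℤ) ≠ 0 := by exact_mod_cast h.pos.ne'
  set l := ∑ k ∈ Finset.range n, τ k
  let r (k : ℤ) : ℕ := (k % n).toNat
  let t (k : ℤ) : ℝ := (k / n : ℤ) * l + ∑ i ∈ Finset.range (r k), τ i
  have hr_lt (k) : r k < n := by
    have := Int.emod_lt_of_pos k (Int.natCast_pos.2 h.pos)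
    have := Int.emod_nonneg k hn
    lia
  have hr_periodic (k) : r (k + n) = r k := by simp [r]
  have h_step (k) : m (r (k + 1)) = m (r k + 1) ∧ t (k + 1) - t k = τ (r k) := by
    rcases ediv_toNat_emod_add_one h.pos k with ⟨h_ediv, h_emod⟩ | ⟨h_ediv, h_emod, h_last⟩
    · refine ⟨congrArg m h_emod, ?_⟩
      simp only [t, r, h_ediv, h_emod, Finset.sum_range_succ]
      ring
    · have hl' : l = ∑ i ∈ Finset.range (r k), τ i + τ (r k) := by
        rw [← Finset.sum_range_succ, h_last]
      refine ⟨?_, ?_⟩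
      · simp only [r, h_emod, h_last, h.closed]
      · simp only [t, r, h_ediv, h_emod, Finset.sum_range_zero]
        push_cast
        linear_combination hl'
  refine ⟨fun k => m (r k), t, fun k => w (r k), ⟨h.pos, ⟨hT, fun k => ?_⟩, by simp [t, r],
    fun k => ?_, fun k => by simp only [hr_periodic], fun k => by simp only [hr_periodic],
    fun k => ?_⟩, by simp [r], Finset.sum_congr rfl fun k hk => ?_⟩
  · exact (h_step k).2 ▸ h.le _ (hr_lt k)
  · simp [t, r, Int.add_ediv_of_dvd_right]
    ring
  · rw [(h_step k).1, (h_step k).2]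
    exact h.near _ (hr_lt k)
  · simp only [r, Int.emod_eq_of_lt (Int.natCast_nonneg k)
      (Int.ofNat_lt.2 (Finset.mem_range.1 hk)), Int.toNat_natCast]

lemma sum_range_mul_of_periodic {w : ℤ → A} (hw : Function.Periodic w n) (j : ℕ) :
    ∑ k ∈ Finset.range (j * n), w k = j • ∑ k ∈ Finset.range n, w k := by
  induction j with
  | zero => simp
  | succ j ih =>
    have h_shift (k : ℕ) : w ((j * n + k : ℕ) : ℤ) = w k := by
      push_cast
      rw [add_comm, hw.nat_mul j k]
    simp only [add_one_mul, Finset.sum_range_add, ih, h_shift, succ_nsmul]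

end ClosedChain

/-! ### Realization of chains -/

section Realization

variable {M : Type*} [MetricSpace M] {ε : ℝ} {γ : ℝ → M}

/-- The first component of `p` is part of an `ε`-realization of the curve `γ`, with the second
component as its parametrization. -/
structure IsRealizationPath (ε : ℝ) (γ : ℝ → M) {X Y : M × ℝ} (p : Path X Y) : Prop where
  monotone : Monotone fun s => (p s).2
  eq_of_continuousAt : ∀ s, ContinuousAt γ (p s).2 → (p s).1 = γ (p s).2
  mem_ball : ∀ s, ¬ContinuousAt γ (p s).2 → (p s).1 ∈ Metric.ball (γ (p s).2) ε

lemma monotone_path_trans {N : Type*} [TopologicalSpace N] {X Y Z : N} {p : Path X Y} {q : Path Y Z}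
    {f : N → ℝ} (hp : Monotone fun s => f (p s)) (hq : Monotone fun s => f (q s)) :
    Monotone fun s => f (p.trans q s) := by
  intro s s' hs
  have hs' : (s : ℝ) ≤ s' := hs
  simp only [Path.trans_apply]
  split_ifs with h h' h'
  · exact hp (Subtype.mk_le_mk.2 (by linarith))
  · refine (hp unitInterval.le_one').trans (le_of_eq_of_le ?_ (hq unitInterval.nonneg'))
    simp
  · linarith
  · exact hq (Subtype.mk_le_mk.2 (by linarith))

namespace IsRealizationPath

lemma refl {X : M × ℝ} (hX : X.1 = γ X.2) (hε : 0 < ε) : IsRealizationPath ε γ (Path.refl X) where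
  monotone _ _ _ := le_rfl
  eq_of_continuousAt _ _ := hX
  mem_ball _ _ := by simpa [hX] using hε

lemma trans {X Y Z : M × ℝ} {p : Path X Y} {q : Path Y Z} (hp : IsRealizationPath ε γ p)
    (hq : IsRealizationPath ε γ q) : IsRealizationPath ε γ (p.trans q) := by
  have h_mem (s) : p.trans q s ∈ range p ∪ range q := Path.trans_range p q ▸ mem_range_self s
  refine ⟨monotone_path_trans hp.monotone hq.monotone, fun s => ?_, fun s => ?_⟩ <;>
    obtain ⟨u, hu⟩ | ⟨u, hu⟩ := h_mem s <;> rw [← hu]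
  exacts [hp.eq_of_continuousAt u, hq.eq_of_continuousAt u, hp.mem_ball u, hq.mem_ball u]

end IsRealizationPath

namespace IsPiecewiseOrbit

variable {φ : Flow ℝ M} {t : ℤ → ℝ} {x : ℤ → M} {T : ℝ}

lemma eq_of_continuousAt (hγ : IsPiecewiseOrbit (fun s y => φ s y) t x γ) (ht : IsSpaced T t)
    {k : ℤ} (h_cont : ContinuousAt γ (t (k + 1))) :
    φ (t (k + 1) - t k) (x k) = γ (t (k + 1)) :=
  tendsto_nhds_unique (hγ.tendsto_nhdsLT (isTimeFlow_flow φ) ht k)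
    (h_cont.tendsto.mono_left nhdsWithin_le_nhds)

lemma isRealizationPath_orbit (hγ : IsPiecewiseOrbit (fun s y => φ s y) t x γ)
    (ht : IsSpaced T t) (k : ℤ) (h_jump : dist (φ (t (k + 1) - t k) (x k)) (x (k + 1)) < ε) :
    IsRealizationPath ε γ
      ((orbitPath φ (t (k + 1) - t k) (x k)).prod (Path.segment (t k) (t (k + 1)))) := by
  have hlt : t k < t (k + 1) := ht.strictMono (lt_add_one k)
  have h_end := hγ.apply_start (isTimeFlow_flow φ) ht (k + 1)
  set p := (orbitPath φ (t (k + 1) - t k) (x k)).prod (Path.segment (t k) (t (k + 1)))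
  have hp (s) : p s = (φ (s * (t (k + 1) - t k)) (x k), t k + s * (t (k + 1) - t k)) := by
    simp [p, AffineMap.lineMap_apply, add_comm]
  have hp_lt (s : unitInterval) (hs : (s : ℝ) < 1) : (p s).1 = γ (p s).2 := by
    rw [hp, hγ k _ ⟨by nlinarith [s.2.1], by nlinarith⟩, add_sub_cancel_left]
  have hp_one (s : unitInterval) (hs : (s : ℝ) = 1) :
      p s = (φ (t (k + 1) - t k) (x k), t (k + 1)) := by
    rw [hp, hs, one_mul, add_sub_cancel]
  refine ⟨fun s s' hs => ?_, fun s h_cont => ?_, fun s _ => ?_⟩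
  · have hs' : (s : ℝ) ≤ s' := hs
    simp only [hp]
    nlinarith
  · rcases s.2.2.eq_or_lt with hs | hs
    · rw [hp_one s hs] at h_cont ⊢
      exact hγ.eq_of_continuousAt ht h_cont
    · exact hp_lt s hs
  · rcases s.2.2.eq_or_lt with hs | hs
    · rwa [hp_one s hs, h_end, Metric.mem_ball]
    · exact hp_lt s hs ▸ Metric.mem_ball_self (dist_nonneg.trans_lt h_jump)

lemma isRealizationPath_jump (hγ : IsPiecewiseOrbit (fun s y => φ s y) t x γ) (ht : IsSpaced T t)
    {k : ℤ} {q : Path (φ (t (k + 1) - t k) (x k)) (x (k + 1))}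
    (hq : ∀ s, dist (q s) (x (k + 1)) < ε)
    (hq_const : φ (t (k + 1) - t k) (x k) = x (k + 1) → ∀ s, q s = x (k + 1)) :
    IsRealizationPath ε γ (q.prod (Path.refl (t (k + 1)))) := by
  have h_end := hγ.apply_start (isTimeFlow_flow φ) ht (k + 1)
  refine ⟨fun _ _ _ => le_rfl, fun s h_cont => ?_, fun s _ => ?_⟩
  · exact (hq_const ((hγ.eq_of_continuousAt ht h_cont).trans h_end) s).trans h_end.symm
  · exact (congrArg _ h_end).trans_lt (hq s)

end IsPiecewiseOrbit

variable {A : Type*} [AddCommGroup A] [CompactSpace M]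

lemma LocallyContracts.exists_path_of_near (hM : LocallyContracts M) (Θ : PathCocycle M A) :
    ∃ ρ > 0, ∀ ε ≤ ρ, ∀ X Y : M × A, Θ.Near ε X Y → ∃ q : Path X.1 Y.1,
      (∀ s, dist (q s) Y.1 < ε) ∧ Y.2 = X.2 + Θ q ∧ (X.1 = Y.1 → ∀ s, q s = Y.1) := by
  obtain ⟨ρ, hρ, h_prim⟩ := hM.exists_isPrimitiveOn_ball Θ
  refine ⟨ρ, hρ, fun ε hε X Y ⟨p, hp, hpΘ⟩ => ?_⟩
  by_cases hXY : X.1 = Y.1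
  · obtain ⟨F, hF⟩ := h_prim Y.1
    have h_zero : Θ p = 0 := by
      rw [hF.map_path p fun s => (hp s).trans_le hε, hXY, sub_self]
    have hε : 0 < ε := dist_nonneg.trans_lt (hp 0)
    exact ⟨(Path.refl Y.1).cast hXY rfl, fun s => by simpa using hε,
      by rw [hpΘ, h_zero]; exact congrArg _ (Θ.map_refl Y.1).symm, fun _ _ => rfl⟩
  · exact ⟨p, hp, hpΘ, fun h => absurd h hXY⟩

lemma LocallyContracts.exists_realization (hM : LocallyContracts M) (Θ : PathCocycle M A)
    (φ : Flow ℝ M) :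
    ∃ ρ > 0, ∀ ε ≤ ρ, ∀ (T : ℝ) (x : ℤ → M) (t : ℤ → ℝ) (w : ℤ → A) (γ : ℝ → M),
      IsSpaced T t → IsPiecewiseOrbit (fun s y => φ s y) t x γ →
      (∀ k, Θ.Near ε (Θ.skew φ (t (k + 1) - t k) (x k, 0)) (x (k + 1), w k)) →
      ∀ n : ℕ, ∃ p : Path (x 0, t 0) (x n, t n), IsRealizationPath ε γ p ∧
        Θ (p.map continuous_fst) = ∑ k ∈ Finset.range n, w k := by
  obtain ⟨ρ, hρ, h_path⟩ := hM.exists_path_of_near Θ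
  refine ⟨ρ, hρ, fun ε hε T x t w γ ht hγ h_near n => ?_⟩
  induction n with
  | zero =>
    exact ⟨.refl _, .refl (hγ.apply_start (isTimeFlow_flow φ) ht 0).symm
      (dist_nonneg.trans_lt (h_near 0).dist_lt), Θ.map_refl _⟩
  | succ n ih =>
    obtain ⟨p, hp, hpΘ⟩ := ih
    obtain ⟨q : Path (φ (t (n + 1) - t n) (x n)) (x (n + 1)), hq, hqΘ, hq_const⟩ :=
      h_path ε hε _ _ (h_near n)
    refine ⟨(p.trans ((orbitPath φ (t (n + 1) - t n) (x n)).prod (Path.segment _ _))).trans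
      (q.prod (Path.refl (t (n + 1)))),
      (hp.trans (hγ.isRealizationPath_orbit ht n (h_near n).dist_lt)).trans
        (hγ.isRealizationPath_jump ht hq hq_const), ?_⟩
    have h_step : w n = Θ (orbitPath φ (t (n + 1) - t n) (x n)) + Θ q :=
      hqΘ.trans (congrArg (· + Θ q) (zero_add _))
    rw [Path.map_trans, Path.map_trans, Θ.map_trans, Θ.map_trans, hpΘ, Finset.sum_range_succ,
      h_step, add_assoc]
    rfl

end Realization

section PeriodicRealization

variable {M : Type u} [MetricSpace M]

lemma IsRealizationPath.isRealization {ε : ℝ} {γ : ℝ → M} {X Y : M × ℝ} {p : Path X Y}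
    (hp : IsRealizationPath ε γ p) (hX : X.2 = 0) (hXY : X.1 = Y.1) :
    IsRealization ε Y.2 γ (p.map continuous_fst).toContinuousMap :=
  ⟨by simpa using hXY, fun s => (p s).2, by fun_prop, hp.monotone, by simpa using hX, by simp,
    fun s => ⟨hp.eq_of_continuousAt s, hp.mem_ball s⟩⟩

lemma LocallyContracts.exists_periodicPseudoOrbit [CompactSpace M] (hM : LocallyContracts M)
    (φ : Flow ℝ M) (α : CohomH1 M) :
    ∃ ρ > 0, ∀ ε ≤ ρ, ∀ T > 0, ∀ (n : ℕ) (m : ℕ → M) (τ w : ℕ → ℝ),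
      IsClosedChain (cohomCocycle α) φ ε T n m τ w → ∃ (l : ℝ) (γ : ℝ → M) (h : H1 M),
        IsPeriodicPseudoOrbit φ ε T l γ ∧ γ 0 = m 0 ∧ IsClassOf ε l γ h ∧
          α h = ∑ k ∈ Finset.range n, w k := by
  obtain ⟨ρ, hρ, h_real⟩ := hM.exists_realization (cohomCocycle α) φ
  refine ⟨ρ, hρ, fun ε hε T hT n m τ w hc => ?_⟩
  obtain ⟨x, t, W, hp, hx0, hW⟩ := hc.exists_isPeriodicChain hT
  obtain ⟨γ, hγ⟩ := hp.spaced.exists_isPiecewiseOrbit (fun s y => φ s y) x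
  obtain ⟨p, hp_real, hp_sum⟩ := h_real ε hε T x t W γ hp.spaced hγ hp.near n
  have h_closed : x 0 = x n := hp.point_periodic.eq.symm
  obtain ⟨h, hh⟩ := exists_isHomologyClass_of_closed (c := (p.map continuous_fst).toContinuousMap)
    (by simpa using h_closed)
  have h_jump (k) : dist (x (k + 1)) (φ (t (k + 1) - t k) (x k)) < ε :=
    (dist_comm _ _).trans_lt (hp.near k).dist_lt
  refine ⟨t n, γ, h, hγ.isPeriodicPseudoOrbit hp.spaced hp.start h_jump (Int.natCast_pos.2 hp.pos)
    hp.time_add hp.point_periodic, ?_, ⟨_, hp_real.isRealization hp.start h_closed, hh⟩, ?_⟩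
  · simpa [hp.start, hx0] using hγ.apply_start (isTimeFlow_flow φ) hp.spaced 0
  · rw [← hW, ← hp_sum, ← homologyCocycle_eq hh]
    rfl

end PeriodicRealization

section LiftedChain

variable {M : Type u} [MetricSpace M] {φ : Flow ℝ M} {α : CohomH1 M} {x₀ : M}
  {d : MetricSpace (Cover α x₀)} {T : ℝ}

lemma Cover.exists_lift_chain (hd : IsLocallyLiftedMetric d) {r : ℝ}
    (hr : ∀ z x y : Cover α x₀, d.dist z x < r → d.dist z y < r → d.dist x y = dist x.proj y.proj)
    {η : ℝ} (hη : 4 * η ≤ r) {x : ℕ → M} {τ w : ℕ → ℝ}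
    (h : ∀ k, (cohomCocycle α).Near η ((cohomCocycle α).skew φ (τ k) (x k, 0)) (x (k + 1), w k))
    {y₀ : Cover α x₀} (hy₀ : y₀.proj = x 0) :
    ∃ y : ℕ → Cover α x₀, y 0 = y₀ ∧
      (∀ k, (y k).pt = (x k, y₀.height + ∑ i ∈ Finset.range k, w i)) ∧
      ∀ k, d.dist (y (k + 1)) (liftFlow φ (τ k) (y k)) < η := by
  have h_next (k : ℕ) (y : Cover α x₀) (hy : y.proj = x k) : ∃ z : Cover α x₀,
      z.pt = (x (k + 1), y.height + w k) ∧ d.dist z (liftFlow φ (τ k) y) < η := by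
    have h_near := (h k).raise y.height
    rw [← PathCocycle.skew_raise, show raise y.height (x k, 0) = y.pt by
      simp [raise, Cover.pt, hy], ← Cover.pt_liftFlow] at h_near
    obtain ⟨z, hz, h_dist⟩ := Cover.exists_dist_lt_of_near hd hr hη _ h_near
    exact ⟨z, by rw [hz, raise, add_comm y.height], (d.dist_comm _ _).trans_lt h_dist⟩
  have : Nonempty (Cover α x₀) := ⟨y₀⟩
  choose! next h_next_pt h_next_dist using h_next
  let y (k : ℕ) : Cover α x₀ := Nat.rec y₀ next k
  have hy (k) : (y k).pt = (x k, y₀.height + ∑ i ∈ Finset.range k, w i) := by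
    induction k with
    | zero => simp [y, Cover.pt, hy₀]
    | succ k ih =>
      rw [Finset.sum_range_succ, ← add_assoc]
      exact (h_next_pt k (y k) (congrArg Prod.fst ih)).trans
        (congrArg (fun a => (x (k + 1), a + w k)) (congrArg Prod.snd ih))
  exact ⟨y, rfl, hy, fun k => h_next_dist k (y k) (congrArg Prod.fst (hy k))⟩

lemma Cover.exists_isPseudoOrbit_of_chain (hd : IsLocallyLiftedMetric d) {ε : ℝ} {t : ℤ → ℝ}
    (ht : IsSpaced T t) (ht0 : t 0 = 0) {y : ℕ → Cover α x₀}
    (hy : ∀ k : ℕ, d.dist (y (k + 1)) (liftFlow φ (t (k + 1) - t k) (y k)) < ε) (N : ℕ) :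
    ∃ l γ, IsPseudoOrbit d.dist (liftFlow φ) ε T l γ ∧ γ 0 = y 0 ∧ ∃ s ∈ Ico 0 l, γ s = y N := by
  have := Cover.t2Space hd
  have hψ := Cover.isTimeFlow_liftFlow (α := α) (x₀ := x₀) φ
  obtain ⟨γ, hγ⟩ := ht.exists_isPiecewiseOrbit (liftFlow φ) fun k => y k.toNat
  have h_start := hγ.apply_start hψ ht
  refine ⟨t (N + 1), γ, hγ.isPseudoOrbit hψ ht ht0 (fun k hk => ?_) (by positivity),
    ht0 ▸ h_start 0, t N, ⟨?_, ht.strictMono (lt_add_one _)⟩, h_start N⟩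
  · obtain ⟨k, rfl⟩ := Int.eq_ofNat_of_zero_le hk
    exact hy k
  · exact ht0 ▸ ht.strictMono.monotone (Int.natCast_nonneg N)

lemma sum_nonpos_of_isQuasiLyapunovWith [CompactSpace M] [ConnectedSpace M]
    (hM : LocallyContracts M) (hd : IsLocallyLiftedMetric d) (hT : 0 < T) {C : ℝ}
    {f : Cover α x₀ → ℝ} (hf : IsEquivariant f) (hQ : IsQuasiLyapunovWith φ T d C f) :
    ∃ ρ > 0, ∀ (n : ℕ) (m : ℕ → M) (τ w : ℕ → ℝ),
      IsClosedChain (cohomCocycle α) φ ρ T n m τ w → ∑ k ∈ Finset.range n, w k ≤ 0 := by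
  have := hM.locallyPathConnectedSpace
  obtain ⟨ε, hε, hQ⟩ := hQ
  obtain ⟨r, hr_pos, hr⟩ := hd.isometric
  refine ⟨min ε (r / 4), by positivity, fun n m τ w hc => ?_⟩
  obtain ⟨x, t, W, hp, -, hW⟩ := hc.exists_isPeriodicChain hT
  obtain ⟨y₀, hy₀⟩ := Cover.proj_surjective (α := α) (x₀ := x₀) hd (x 0)
  obtain ⟨y, rfl, hy_pt, hy_dist⟩ := Cover.exists_lift_chain hd hr
    (by linarith [min_le_right ε (r / 4)]) (x := fun k => x k) (w := fun k => W k)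
    (fun k => hp.near k) hy₀
  have h_turns (j : ℕ) : j * ∑ k ∈ Finset.range n, W k ≤ C := by
    obtain ⟨l, γ, hγ, hγ0, s, hs, hγs⟩ := Cover.exists_isPseudoOrbit_of_chain hd hp.spaced hp.start
      (fun k => (hy_dist k).trans_le (min_le_left _ _)) (j * n)
    have h_lyapunov := hQ l γ hγ s hs
    have h_proj : (y (j * n)).proj = (y 0).proj := by
      rw [hy₀, ← hp.point_periodic.nat_mul_eq j]
      exact congrArg Prod.fst (hy_pt (j * n))
    have h_height : (y (j * n)).height = (y 0).height + j * ∑ k ∈ Finset.range n, W k := by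
      rw [← nsmul_eq_mul, ← sum_range_mul_of_periodic hp.height_periodic]
      exact congrArg Prod.snd (hy_pt (j * n))
    rw [hγ0, hγs] at h_lyapunov
    linarith [Cover.sub_height_eq_of_proj_eq hf h_proj]
  rw [← hW]
  by_contra! h_pos
  obtain ⟨j, hj⟩ := exists_nat_gt (C / ∑ k ∈ Finset.range n, W k)
  exact ((div_lt_iff₀ h_pos).1 hj).not_ge (h_turns j)

end LiftedChain

/-! ### Weighted walks in finite graphs -/

section Walk

variable {V A : Type*}

/-- A walk of length `n` in a weighted graph, where `E a b u` means that there is an edge of weight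
`u` from `a` to `b`. Only `v 0, …, v n` and `w 0, …, w (n - 1)` matter. -/
def IsWalk (E : V → V → A → Prop) (n : ℕ) (v : ℕ → V) (w : ℕ → A) : Prop :=
  ∀ k < n, E (v k) (v (k + 1)) (w k)

lemma IsWalk.exists_remove_loop [AddCommMonoid A] {E : V → V → A → Prop} {a c r : ℕ} {v : ℕ → V}
    {w : ℕ → A} (h : IsWalk E (a + c + r) v w) (h_loop : v (a + c) = v a) :
    ∃ v' w', IsWalk E (a + r) v' w' ∧ ∑ k ∈ Finset.range (a + c + r), w k =
      ∑ k ∈ Finset.range (a + r), w' k + ∑ k ∈ Finset.range c, w (a + k) := by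
  refine ⟨fun k => if k ≤ a then v k else v (k + c), fun k => if k < a then w k else w (k + c),
    fun k hk => ?_, ?_⟩
  · rcases lt_trichotomy k a with hka | rfl | hka
    · simpa only [hka, hka.le, Nat.succ_le_of_lt hka, if_true] using h k (by omega)
    · simpa [h_loop, add_right_comm] using h (k + c) (by omega)
    · simpa [hka.not_ge, hka.not_gt, (Nat.lt_succ_of_lt hka).not_ge, add_right_comm] using
        h (k + c) (by omega)
  · rw [Finset.sum_range_add, Finset.sum_range_add, Finset.sum_range_add _ a r, add_right_comm]
    refine congrArg (· + _) (congrArg₂ (· + ·) (Finset.sum_congr rfl fun k hk => ?_)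
      (Finset.sum_congr rfl fun k _ => ?_))
    · rw [if_pos (Finset.mem_range.1 hk)]
    · rw [if_neg (by omega), add_right_comm]

lemma exists_lt_le_card_eq [Fintype V] (v : ℕ → V) :
    ∃ a b, a < b ∧ b ≤ Fintype.card V ∧ v b = v a := by
  obtain ⟨i, j, hij, hv⟩ := Fintype.exists_ne_map_eq_of_card_lt
    (fun i : Fin (Fintype.card V + 1) => v i) (by simp)
  rcases lt_or_gt_of_ne (Fin.val_ne_of_ne hij) with h | h
  · exact ⟨i, j, h, Nat.lt_succ_iff.1 j.2, hv.symm⟩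
  · exact ⟨j, i, h, Nat.lt_succ_iff.1 i.2, hv⟩

lemma IsWalk.sum_le_of_loops_le [Fintype V] {E : V → V → ℝ → Prop} {B s : ℝ} (hB : 0 ≤ B)
    (hs : 0 ≤ s) (hE : ∀ a b u, E a b u → u ≤ B)
    (h_loop : ∀ n v w, 0 < n → n ≤ Fintype.card V → IsWalk E n v w → v n = v 0 →
      ∑ k ∈ Finset.range n, w k ≤ -s) {n : ℕ} {v : ℕ → V} {w : ℕ → ℝ} (h : IsWalk E n v w) :
    ∑ k ∈ Finset.range n, w k ≤ Fintype.card V * B + s - s / Fintype.card V * n := by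
  have hV : (0 : ℝ) < Fintype.card V := by exact_mod_cast Fintype.card_pos_iff.2 ⟨v 0⟩
  have h_slope {k : ℕ} (hk : k ≤ Fintype.card V) : s / Fintype.card V * k ≤ s := by
    rw [div_mul_eq_mul_div, div_le_iff₀ hV]
    gcongr
  induction n using Nat.strong_induction_on generalizing v w with
  | _ n ih =>
    rcases le_or_gt n (Fintype.card V) with hn | hn
    · have h_sum : ∑ k ∈ Finset.range n, w k ≤ n * B := by
        simpa using Finset.sum_le_card_nsmul (Finset.range n) w B fun k hk =>
          hE _ _ _ (h k (Finset.mem_range.1 hk))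
      have h_card : n * B ≤ Fintype.card V * B := by gcongr
      linarith [h_slope hn]
    · obtain ⟨a, b, hab, hb, hv⟩ := exists_lt_le_card_eq v
      obtain ⟨c, rfl⟩ := Nat.exists_eq_add_of_le hab.le
      obtain ⟨r, rfl⟩ := Nat.exists_eq_add_of_le (hb.trans hn.le)
      obtain ⟨v', w', h', h_sum⟩ := h.exists_remove_loop hv
      have h_short := ih (a + r) (by omega) h'
      have h_loop_sum := h_loop c (fun k => v (a + k)) (fun k => w (a + k)) (by omega) (by omega)
        (fun k hk => h (a + k) (by omega)) hv
      rw [h_sum]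
      push_cast at h_short ⊢
      linarith [h_slope (k := c) (by omega)]

end Walk

/-! ### Drift along chains -/

section Drift

variable {M : Type*} [MetricSpace M]

lemma IsClosedChain.mono {A : Type*} [AddCommGroup A] {Θ : PathCocycle M A} {φ : Flow ℝ M}
    {ε ε' T T' : ℝ} {n : ℕ} {m : ℕ → M} {τ : ℕ → ℝ} {w : ℕ → A}
    (h : IsClosedChain Θ φ ε T n m τ w) (hε : ε ≤ ε') (hT : T' ≤ T) :
    IsClosedChain Θ φ ε' T' n m τ w :=
  ⟨h.pos, h.closed, fun k hk => hT.trans (h.le k hk), fun k hk => (h.near k hk).mono hε⟩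

/-- The edges, on points of `M`, of the graph that records the passages of chains: an orbit arc of
length between `L` and `3 * L` and a jump lead from `p` to `q` and raise the height above the graph
of `g` by `u`. -/
def PathCocycle.IsPassage {A : Type*} [AddCommGroup A] (Θ : PathCocycle M A) (φ : Flow ℝ M)
    (g : M → A) (ε L : ℝ) (p q : M) (u : A) : Prop :=
  ∃ τ ∈ Icc L (3 * L), Θ.Near ε (Θ.skew φ τ (p, g p)) (q, g q + u)

/-- A bound on the height above the graph of `g` along chains with arcs of lengths between `L` and
`3 * L` and with `η`-small jumps: it drops with slope `c`, up to the constant `B`. -/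
def PathCocycle.HasDrift (Θ : PathCocycle M ℝ) (φ : Flow ℝ M) (g : M → ℝ) (η L B c : ℝ) : Prop :=
  ∀ (n : ℕ) (X : ℕ → M × ℝ) (τ : ℕ → ℝ), (∀ k < n, τ k ∈ Icc L (3 * L)) →
    (∀ k < n, Θ.Near η (Θ.skew φ (τ k) (X k)) (X (k + 1))) →
      heightAbove g (X n) - heightAbove g (X 0) ≤ B - c * n

section Passage

variable {A : Type*} [AddCommGroup A] {Θ : PathCocycle M A} {φ : Flow ℝ M} {g : M → A} {W : Set A}
  {ε η L : ℝ}

lemma PathCocycle.IsDiscretization.mem_of_isPassage (hg : Θ.IsDiscretization φ η (3 * L) g W)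
    (hL : 0 ≤ L) {p q : M} {u : A} (h : Θ.IsPassage φ g η L p q u) : u ∈ image2 (· + ·) W W := by
  obtain ⟨τ, hτ, h_near⟩ := h
  refine ⟨_, hg.near h_near, _, hg.skew (p, g p) τ ⟨hL.trans hτ.1, hτ.2⟩, ?_⟩
  simp [heightAbove]

lemma IsWalk.exists_isClosedChain {n : ℕ} {v : ℕ → M} {w : ℕ → A} (hn : 0 < n)
    (h : IsWalk (Θ.IsPassage φ g ε L) n v w) (h_closed : v n = v 0) :
    ∃ τ w', IsClosedChain Θ φ ε L n v τ w' ∧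
      ∑ k ∈ Finset.range n, w' k = ∑ k ∈ Finset.range n, w k := by
  choose! τ hτ h_near using h
  refine ⟨τ, fun k => w k + (g (v (k + 1)) - g (v k)),
    ⟨hn, h_closed, fun k hk => (hτ k hk).1, fun k hk => ?_⟩, ?_⟩
  · convert (h_near k hk).skew_add_right (-g (v k)) using 2
    · rw [add_neg_cancel]
    · abel
  · rw [Finset.sum_add_distrib, Finset.sum_range_sub (fun k => g (v k)), h_closed, sub_self,
      add_zero]

variable (Θ φ L) in
lemma LocallyContracts.exists_finite_net [CompactSpace M] (hM : LocallyContracts M) (hε : 0 < ε)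
    (hL : 0 ≤ L) : ∃ η > 0, ∃ P : Set M, P.Finite ∧
      ∀ (g : M → A) (n : ℕ) (X : ℕ → M × A) (τ : ℕ → ℝ),
      (∀ k < n, τ k ∈ Icc L (3 * L)) →
      (∀ k < n, Θ.Near η (Θ.skew φ (τ k) (X k)) (X (k + 1))) →
      ∃ Y : ℕ → M × A, (∀ k, (Y k).1 ∈ P) ∧ (∀ k, Θ.Near ε (X k) (Y k)) ∧
        IsWalk (Θ.IsPassage φ g ε L) n (fun k => (Y k).1)
          fun k => heightAbove g (Y (k + 1)) - heightAbove g (Y k) := by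
  have := hM.locallyPathConnectedSpace
  obtain ⟨δ, hδ, h_skew⟩ := Θ.exists_near_skew_skew φ (η := ε / 3) (by positivity) (3 * L)
  have hδε : 0 < min (δ / 2) (ε / 3) := by positivity
  obtain ⟨ρ, hρ, h_path⟩ := exists_path_dist_lt (M := M) hδε
  obtain ⟨P, -, hP, h_cover⟩ := finite_cover_balls_of_compact (isCompact_univ (X := M)) hρ
  have h_net (X : M × A) : ∃ Y : M × A, Y.1 ∈ P ∧ Θ.Near (min (δ / 2) (ε / 3)) X Y := by
    obtain ⟨p, hp, hXp⟩ := mem_iUnion₂.1 (h_cover (mem_univ X.1))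
    obtain ⟨q, hq⟩ := h_path X.1 p hXp
    exact ⟨(p, X.2 + Θ q), hp, q, hq, rfl⟩
  refine ⟨ε / 3, by positivity, P, hP, fun g n X τ hτ hX => ?_⟩
  choose Y hYP hXY using fun k => h_net (X k)
  refine ⟨Y, hYP, fun k => (hXY k).mono (by linarith [min_le_right (δ / 2) (ε / 3)]),
    fun k hk => ⟨τ k, hτ k hk, ?_⟩⟩
  have h_back : Θ.Near δ (Y k) (X k) :=
    (hXY k).symm.mono (by linarith [min_le_left (δ / 2) (ε / 3)])
  have h_arc := h_skew _ _ h_back (τ k) ⟨hL.trans (hτ k hk).1, (hτ k hk).2⟩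
  have h_step : Θ.Near ε (Θ.skew φ (τ k) (Y k)) (Y (k + 1)) :=
    ((h_arc.trans (hX k hk)).trans (hXY (k + 1))).mono
      (by linarith [min_le_right (δ / 2) (ε / 3)])
  convert h_step.skew_add_right (-heightAbove g (Y k)) using 2
  · simp [heightAbove]
  · simp only [heightAbove]
    abel

end Passage

lemma exists_forall_le_neg_of_finite {F : Set ℝ} (hF : F.Finite) (h_nonpos : ∀ x ∈ F, x ≤ 0) :
    ∃ s ≥ 0, ((∀ x ∈ F, x < 0) → 0 < s) ∧ ∀ x ∈ F, x ≤ -s := by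
  rcases F.eq_empty_or_nonempty with rfl | h_nonempty
  · exact ⟨1, zero_le_one, fun _ => one_pos, fun x hx => hx.elim⟩
  · obtain ⟨a, ha, h_max⟩ := F.exists_max_image id hF h_nonempty
    exact ⟨-a, neg_nonneg.2 (h_nonpos a ha), fun h => neg_pos.2 (h a ha), by simpa using h_max⟩

variable {Θ : PathCocycle M ℝ} {φ : Flow ℝ M} {g : M → ℝ} {W : Set ℝ} {ε η L : ℝ}

/- The loops of bounded length in a finite graph with finitely many weights have finitely many
weights. Hence they drop by a definite amount as soon as each of them drops. -/
lemma PathCocycle.IsDiscretization.exists_forall_loop_le (hg : Θ.IsDiscretization φ η (3 * L) g W)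
    (hεη : ε ≤ η) (hL : 0 ≤ L) (h_nonpos : ∀ n m τ w, IsClosedChain Θ φ ε L n m τ w →
      ∑ k ∈ Finset.range n, w k ≤ 0) (N : ℕ) :
    ∃ s ≥ 0, ((∀ n m τ w, IsClosedChain Θ φ ε L n m τ w → ∑ k ∈ Finset.range n, w k < 0) → 0 < s) ∧
      ∀ n v w, 0 < n → n ≤ N → IsWalk (Θ.IsPassage φ g ε L) n v w → v n = v 0 →
        ∑ k ∈ Finset.range n, w k ≤ -s := by
  let F : Set ℝ := {x | ∃ n v w, 0 < n ∧ n ≤ N ∧ IsWalk (Θ.IsPassage φ g ε L) n v w ∧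
    v n = v 0 ∧ ∑ k ∈ Finset.range n, w k = x}
  have hF : F.Finite := by
    choose S hS h_mem using
      exists_finite_forall_telescope_mem (hg.finite.image2 (· + ·) hg.finite)
    refine ((finite_Iic N).biUnion fun n _ => hS n).subset ?_
    rintro _ ⟨n, v, w, -, hn, hw, -, rfl⟩
    refine mem_biUnion (x := n) hn ?_
    simpa using h_mem n (fun k => ∑ i ∈ Finset.range k, w i) fun k hk => by
      obtain ⟨τ, hτ, h_near⟩ := hw k hk
      simpa [Finset.sum_range_succ] using hg.mem_of_isPassage hL ⟨τ, hτ, h_near.mono hεη⟩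
  have h_chain : ∀ x ∈ F, ∃ n m τ w, IsClosedChain Θ φ ε L n m τ w ∧
      ∑ k ∈ Finset.range n, w k = x := by
    rintro _ ⟨n, v, w, hn, -, hw, hv, rfl⟩
    exact ⟨n, v, hw.exists_isClosedChain hn hv⟩
  obtain ⟨s, hs, hs_pos, h_le⟩ := exists_forall_le_neg_of_finite hF fun x hx => by
    obtain ⟨n, m, τ, w, h, rfl⟩ := h_chain x hx
    exact h_nonpos n m τ w h
  refine ⟨s, hs, fun h_neg => hs_pos fun x hx => ?_, fun n v w hn hnN hw hv =>
    h_le _ ⟨n, v, w, hn, hnN, hw, hv, rfl⟩⟩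
  obtain ⟨n, m, τ, w, h, rfl⟩ := h_chain x hx
  exact h_neg n m τ w h

lemma LocallyContracts.exists_hasDrift [CompactSpace M] [Nonempty M] (hM : LocallyContracts M)
    (hg : Θ.IsDiscretization φ η (3 * L) g W) (hη : 0 < η) (hε : 0 < ε) (hL : 0 ≤ L)
    (h_nonpos : ∀ n m τ w, IsClosedChain Θ φ ε L n m τ w → ∑ k ∈ Finset.range n, w k ≤ 0) :
    ∃ δ > 0, ∃ B, ∃ c ≥ 0, Θ.HasDrift φ g δ L B c ∧
      ((∀ n m τ w, IsClosedChain Θ φ ε L n m τ w → ∑ k ∈ Finset.range n, w k < 0) → 0 < c) := by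
  obtain ⟨δ, hδ, P, hP, h_net⟩ := hM.exists_finite_net Θ φ L (lt_min hε hη) hL
  have := hP.fintype
  obtain ⟨s, hs, hs_pos, h_loop⟩ := hg.exists_forall_loop_le (ε := min ε η) (min_le_right _ _) hL
    (fun n m τ w h => h_nonpos n m τ w (h.mono (min_le_left _ _) le_rfl)) (Fintype.card P)
  obtain ⟨B, hB⟩ := ((hg.finite.image2 (· + ·) hg.finite).union hg.finite).bddAbove
  obtain ⟨b, hb⟩ := hg.finite.bddBelow
  refine ⟨δ, hδ, Fintype.card P * max B 0 + s + B - b, s / Fintype.card P, by positivity,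
    fun n X τ hτ hX => ?_, fun h_neg => ?_⟩
  · obtain ⟨Y, hYP, hXY, h_walk⟩ := h_net g n X τ hτ hX
    let E : P → P → ℝ → Prop := fun p q u => Θ.IsPassage φ g (min ε η) L p q u
    have h_sum : _ ≤ Fintype.card P * max B 0 + s - s / Fintype.card P * n :=
      IsWalk.sum_le_of_loops_le (E := E) (v := fun k => ⟨(Y k).1, hYP k⟩) (le_max_right B 0) hs
        (fun p q u ⟨τ, hτ, h⟩ => le_max_of_le_left (hB (.inl
          (hg.mem_of_isPassage hL ⟨τ, hτ, h.mono (min_le_right _ _)⟩))))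
        (fun n v w hn hnP hw hv => h_loop n (fun k => v k) w hn hnP hw (congrArg _ hv)) h_walk
    rw [Finset.sum_range_sub (fun k => heightAbove g (Y k))] at h_sum
    have h_start := hB (.inr (hg.near ((hXY 0).mono (min_le_right _ _))))
    have h_end := hb (hg.near ((hXY n).mono (min_le_right _ _)))
    linarith
  · obtain ⟨Y, hYP, -⟩ := h_net g 0 (fun _ => (Classical.arbitrary M, 0)) 0 (by simp) (by simp)
    have h_card : 0 < Fintype.card P := Fintype.card_pos_iff.2 ⟨⟨_, hYP 0⟩⟩
    have h_slope := hs_pos fun n m τ w h => h_neg n m τ w (h.mono (min_le_left _ _) le_rfl)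
    positivity

end Drift

/-! ### Recurrence -/

section Recurrence

/-- A step of a chain: an orbit arc of length at least `T` followed by an `ε`-small jump. -/
def PathCocycle.Step {M A : Type*} [MetricSpace M] [AddCommGroup A] (Θ : PathCocycle M A)
    (φ : Flow ℝ M) (ε T : ℝ) (X Y : M × A) : Prop :=
  ∃ τ ≥ T, Θ.Near ε (Θ.skew φ τ X) Y

section Step

variable {M : Type*} [MetricSpace M] {A : Type*} [AddCommGroup A] {Θ : PathCocycle M A}
  {φ : Flow ℝ M} {ε ε' T T' : ℝ}

lemma PathCocycle.Step.mono {X Y : M × A} (h : Θ.Step φ ε T X Y) (hε : ε ≤ ε') (hT : T' ≤ T) :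
    Θ.Step φ ε' T' X Y := by
  obtain ⟨τ, hτ, h_near⟩ := h
  exact ⟨τ, hT.trans hτ, h_near.mono hε⟩

lemma IsClosedChain.transGen {n : ℕ} {m : ℕ → M} {τ : ℕ → ℝ} {w : ℕ → A}
    (h : IsClosedChain Θ φ ε T n m τ w) :
    Relation.TransGen (Θ.Step φ ε T) (m 0, 0) (m 0, ∑ k ∈ Finset.range n, w k) := by
  let X (k : ℕ) : M × A := (m k, ∑ i ∈ Finset.range k, w i)
  have h_step (k) (hk : k < n) : Θ.Step φ ε T (X k) (X (k + 1)) := by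
    refine ⟨τ k, h.le k hk, ?_⟩
    simpa [X, Finset.sum_range_succ, add_comm] using
      (h.near k hk).skew_add_right (∑ i ∈ Finset.range k, w i)
  have h_end : X n = (m 0, ∑ k ∈ Finset.range n, w k) := by simp only [X, h.closed]
  have h_start : X 0 = (m 0, 0) := rfl
  rw [← h_start, ← h_end]
  exact (transGen_of_succ_of_lt (fun i j => Θ.Step φ ε T (X i) (X j))
    (fun k hk => h_step k hk.2) h.pos).lift' X fun _ _ => .single

lemma exists_forall_lt_of_transGen {X : Type*} {r : X → X → Prop} {x y : X}
    (h : Relation.TransGen r x y) :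
    ∃ n > 0, ∃ z : ℕ → X, z 0 = x ∧ z n = y ∧ ∀ k < n, r (z k) (z (k + 1)) := by
  induction h with
  | @single y h => exact ⟨1, one_pos, fun k => if k = 0 then x else y, rfl, rfl, by simpa using h⟩
  | @tail y y' _ h ih =>
    obtain ⟨n, hn, z, hz0, hzn, hz⟩ := ih
    refine ⟨n + 1, n.succ_pos, fun k => if k ≤ n then z k else y', by simp [hz0], by simp,
      fun k hk => ?_⟩
    rcases (Nat.lt_succ_iff.1 hk).eq_or_lt with rfl | hkn
    · simpa [hzn] using h
    · simpa [hkn.le, Nat.succ_le_of_lt hkn] using hz k hkn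

lemma exists_isClosedChain_of_transGen {x : M} {a : A}
    (h : Relation.TransGen (Θ.Step φ ε T) (x, 0) (x, a)) :
    ∃ n m τ w, IsClosedChain Θ φ ε T n m τ w ∧ m 0 = x ∧ ∑ k ∈ Finset.range n, w k = a := by
  obtain ⟨n, hn, Z, hZ0, hZn, hZ⟩ := exists_forall_lt_of_transGen h
  choose! τ hτ h_near using hZ
  refine ⟨n, fun k => (Z k).1, τ, fun k => (Z (k + 1)).2 - (Z k).2,
    ⟨hn, by simp only [hZ0, hZn], hτ, fun k hk => ?_⟩, by simp only [hZ0], ?_⟩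
  · simpa [sub_eq_add_neg] using PathCocycle.Near.skew_add_right (h_near k hk) (-(Z k).2)
  · rw [Finset.sum_range_sub (fun k => (Z k).2), hZ0, hZn, sub_zero]

lemma transGen_step_add_right {x y : M} {a b : A}
    (h : Relation.TransGen (Θ.Step φ ε T) (x, a) (y, b)) (c : A) :
    Relation.TransGen (Θ.Step φ ε T) (x, a + c) (y, b + c) :=
  Relation.TransGen.lift (p := Θ.Step φ ε T) (raise c) (fun X Y ⟨τ, hτ, h_near⟩ =>
    ⟨τ, hτ, by rw [PathCocycle.skew_raise]; exact h_near.raise c⟩) _ _ h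

/- The last jump of the chain at `y` is prolonged to `x`. Its first arc is shadowed from `x` for the
time `T` and then joined by a jump, so that at least the time `T` remains for the rest of it. -/
lemma LocallyContracts.exists_transGen_step_of_dist_lt [CompactSpace M] (hM : LocallyContracts M)
    (Θ : PathCocycle M A) (φ : Flow ℝ M) (hε : 0 < ε) (hT : 0 ≤ T) :
    ∃ ρ > 0, ∀ x y : M, dist y x < ρ → ∀ a : A,
      Relation.TransGen (Θ.Step φ ρ (2 * T)) (y, 0) (y, a) →
        Relation.TransGen (Θ.Step φ ε T) (x, 0) (x, a) := by
  have := hM.locallyPathConnectedSpace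
  obtain ⟨δ, hδ, h_skew⟩ := Θ.exists_near_skew_skew φ hε T
  set η := min (δ / 2) (ε / 2)
  have hηδ : 2 * η ≤ δ := by linarith [min_le_left (δ / 2) (ε / 2)]
  have hηε : ε / 2 + η ≤ ε := by linarith [min_le_right (δ / 2) (ε / 2)]
  obtain ⟨ρ, hρ, h_path⟩ := exists_path_dist_lt (M := M) (η := η) (by positivity)
  refine ⟨min ρ (ε / 2), by positivity, fun x y hxy a h => ?_⟩
  obtain ⟨p, hp⟩ := h_path y x (hxy.trans_le (min_le_left _ _))
  have h_jump (b : A) : Θ.Near η (y, b + -Θ p) (x, b) := ⟨p, hp, by simp⟩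
  have h_last : Relation.TransGen (Θ.Step φ ε (2 * T)) (y, 0 + -Θ p) (x, a) := by
    obtain ⟨Y, hY, τ, hτ, h_near⟩ :=
      Relation.TransGen.tail'_iff.1 (transGen_step_add_right h (-Θ p))
    refine .tail' (Relation.ReflTransGen.mono (fun X X' hX => hX.mono ?_ le_rfl) _ _ hY) ⟨τ, hτ, ?_⟩
    · exact ((h_near.mono (min_le_right _ _)).trans (h_jump a)).mono hηε
    · linarith [min_le_right ρ (ε / 2)]
  obtain ⟨Y, ⟨τ, hτ, h_near⟩, hY⟩ := Relation.TransGen.head'_iff.1 h_last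
  have h_first : Θ.Step φ ε T (x, 0) (Θ.skew φ T (y, 0 + -Θ p)) :=
    ⟨T, le_rfl, h_skew _ _ ((h_jump 0).symm.mono hηδ) T ⟨hT, le_rfl⟩⟩
  refine .head h_first (.head' ⟨τ - T, by linarith, ?_⟩
    (Relation.ReflTransGen.mono (fun X X' hX => hX.mono le_rfl (by linarith)) _ _ hY))
  rwa [← PathCocycle.skew_add, add_sub_cancel]

end Step

variable {M : Type u} [MetricSpace M] {φ : Flow ℝ M} {ε ε' T l : ℝ} {γ : ℝ → M}

lemma IsPeriodicPseudoOrbit.mono (h : IsPeriodicPseudoOrbit φ ε T l γ) (hε : ε ≤ ε') :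
    IsPeriodicPseudoOrbit φ ε' T l γ := by
  obtain ⟨hl, h_periodic, h_right, Δ, hΔ, hΔ_periodic, hΔ_spaced, h_cont, h_flow, h_jump⟩ := h
  refine ⟨hl, h_periodic, h_right, Δ, hΔ, hΔ_periodic, hΔ_spaced, h_cont, h_flow, fun t ht => ?_⟩
  obtain ⟨y, hy, h_dist⟩ := h_jump t ht
  exact ⟨y, hy, h_dist.trans_le hε⟩

lemma IsClassOf.mono {h : H1 M} (hγ : IsClassOf ε l γ h) (hε : ε ≤ ε') : IsClassOf ε' l γ h := by
  obtain ⟨δ, ⟨h_closed, σ, hσ_mono, hσ_cont, hσ0, hσ1, hσ⟩, hδ⟩ := hγ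
  exact ⟨δ, ⟨h_closed, σ, hσ_mono, hσ_cont, hσ0, hσ1, fun s => ⟨(hσ s).1, fun hs =>
    Metric.ball_subset_ball hε ((hσ s).2 hs)⟩⟩, hδ⟩

lemma LocallyContracts.mem_alphaRecurrentSet_of_tendsto [CompactSpace M] (hM : LocallyContracts M)
    {α : CohomH1 M} {y : ℕ → M} {δ L : ℕ → ℝ} {x : M} (hy : Tendsto y atTop (𝓝 x))
    (hδ : Tendsto δ atTop (𝓝 0)) (hL : Tendsto L atTop atTop)
    (h_loop : ∀ N, Relation.TransGen ((cohomCocycle α).Step φ (δ N) (L N)) (y N, 0) (y N, 0)) :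
    x ∈ alphaRecurrentSet φ α := by
  obtain ⟨ρ, hρ, h_orbit⟩ := hM.exists_periodicPseudoOrbit φ α
  intro ε hε T hT
  obtain ⟨ρ', hρ', h_move⟩ :=
    hM.exists_transGen_step_of_dist_lt (cohomCocycle α) φ (lt_min hε hρ) hT.le
  obtain ⟨N, hyN, hδN, hLN⟩ := ((hy.eventually (Metric.ball_mem_nhds x hρ')).and
    ((hδ.eventually_lt_const hρ').and (hL.eventually_ge_atTop (2 * T)))).exists
  have h_loop_x := h_move x (y N) hyN 0
    (Relation.TransGen.mono (fun X Y h => h.mono hδN.le hLN) _ _ (h_loop N))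
  obtain ⟨n, m, τ, w, hc, rfl, hw⟩ := exists_isClosedChain_of_transGen h_loop_x
  obtain ⟨l, γ, h, hγ, hγ0, hh, hα⟩ := h_orbit _ (min_le_right ε ρ) T hT n m τ w hc
  exact ⟨l, γ, h, hγ.mono (min_le_left _ _), ⟨0, hγ0⟩, hh.mono (min_le_left _ _), hα.trans hw⟩

lemma LocallyContracts.exists_sum_ne_zero [CompactSpace M] (hM : LocallyContracts M) {α : CohomH1 M}
    (φ : Flow ℝ M) (T : ℝ) (h_empty : alphaRecurrentSet φ α = ∅) : ∃ ε > 0, ∃ L ≥ T,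
      ∀ n m τ w, IsClosedChain (cohomCocycle α) φ ε L n m τ w →
        ∑ k ∈ Finset.range n, w k ≠ 0 := by
  by_contra! h_contra
  have h_loop (N : ℕ) : ∃ y : M, Relation.TransGen
      ((cohomCocycle α).Step φ (1 / (N + 1)) (max T N)) (y, 0) (y, 0) := by
    obtain ⟨n, m, τ, w, hc, hw⟩ := h_contra (1 / (N + 1)) (by positivity) _ (le_max_left T N)
    exact ⟨m 0, hw ▸ hc.transGen⟩
  choose y hy using h_loop
  obtain ⟨x, f, hf, hyx⟩ := CompactSpace.tendsto_subseq y
  refine notMem_empty x (h_empty ▸ hM.mem_alphaRecurrentSet_of_tendsto hyx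
    (tendsto_one_div_add_atTop_nhds_zero_nat.comp hf.tendsto_atTop)
    (tendsto_atTop_mono (fun N => le_max_right T _)
      (tendsto_natCast_atTop_atTop.comp hf.tendsto_atTop)) fun N => hy (f N))

end Recurrence

/-! ### Heights along chains of short arcs -/

section ShortArcs

variable {M : Type*} [MetricSpace M] [CompactSpace M] {Θ : PathCocycle M ℝ} {φ : Flow ℝ M}
  {g : M → ℝ} {η L T B c : ℝ}

lemma PathCocycle.HasDrift.exists_of_short_steps (h_drift : Θ.HasDrift φ g η L B c) (hη : 0 < η)
    (hT : 0 < T) {m : ℕ} (hm : 4 * L ≤ m * T) (hm' : m * T ≤ 6 * L) :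
    ∃ δ > 0, ∀ (n : ℕ) (X : ℕ → M × ℝ), ∀ h ∈ Icc (T / 4) (T / 2),
      (∀ k < m * n, Θ.Near δ (Θ.skew φ h (X k)) (X (k + 1))) →
        heightAbove g (X (m * n)) - heightAbove g (X 0) ≤ B - c * n := by
  obtain ⟨δ, hδ, h_chain⟩ := Θ.exists_near_skew_of_chain φ hη (T / 2) m
  refine ⟨δ, hδ, fun n X h hh hX => h_drift n (fun k => X (m * k)) (fun _ => m * h)
    (fun k _ => ⟨?_, ?_⟩) fun k hk => ?_⟩
  · have h_le : m * (T / 4) ≤ m * h := by gcongr; exact hh.1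
    linarith
  · have h_le : m * h ≤ m * (T / 2) := by gcongr; exact hh.2
    linarith
  · refine h_chain (fun j => X (m * k + j)) h ⟨by linarith [hh.1], hh.2⟩ fun j hj => hX _ ?_
    calc m * k + j < m * (k + 1) := by rw [mul_add]; omega
      _ ≤ m * n := Nat.mul_le_mul_left _ hk

/-- A curve `X` in the skew product that follows the flow up to an error `η`, over times less than
`T`. The lifts of pseudo-orbits have this property. -/
def PathCocycle.Follows (Θ : PathCocycle M ℝ) (φ : Flow ℝ M) (η T l : ℝ) (X : ℝ → M × ℝ) : Prop :=
  ∀ a b, 0 ≤ a → a ≤ b → b < l → b - a < T → Θ.Near η (Θ.skew φ (b - a) (X a)) (X b)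

omit [CompactSpace M] in
lemma PathCocycle.Follows.near_skew_mul {l h : ℝ} {X : ℝ → M × ℝ} (hX : Θ.Follows φ η T l X)
    (h_nonneg : 0 ≤ h) (h_lt : h < T) {N k : ℕ} (hN : N * h < l) (hk : k < N) :
    Θ.Near η (Θ.skew φ h (X (k * h))) (X ((k + 1 : ℕ) * h)) := by
  have h_sub : (k + 1 : ℕ) * h - k * h = h := by
    push_cast
    ring
  have h_le : (k + 1 : ℕ) * h ≤ N * h := by
    gcongr
    exact hk
  simpa only [h_sub] using hX (k * h) ((k + 1 : ℕ) * h) (by positivity) (by linarith)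
    (h_le.trans_lt hN) (by linarith)

lemma exists_four_mul_mul_eq {t : ℝ} (hT : 0 < T) (ht : 2 * T ≤ t) :
    ∃ N : ℕ, ∃ h ∈ Icc (T / 4) (T / 2), (4 * N : ℕ) * h = t := by
  have ht_div : 1 ≤ t / (2 * T) := (one_le_div (by positivity)).2 ht
  have h_lt := Nat.ceil_lt_two_mul (a := t / (2 * T)) (by linarith)
  have : (0 : ℝ) < ⌈t / (2 * T)⌉₊ := by linarith [Nat.le_ceil (t / (2 * T))]
  refine ⟨⌈t / (2 * T)⌉₊, t / (4 * ⌈t / (2 * T)⌉₊), ⟨?_, ?_⟩, by push_cast; field_simp⟩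
  · rw [le_div_iff₀ (by positivity)]
    calc T / 4 * (4 * ⌈t / (2 * T)⌉₊) ≤ T / 4 * (4 * (2 * (t / (2 * T)))) := by gcongr
      _ = t := by field_simp
  · rw [div_le_iff₀ (by positivity)]
    calc t = T / 2 * (4 * (t / (2 * T))) := by field_simp; norm_num
      _ ≤ T / 2 * (4 * ⌈t / (2 * T)⌉₊) := by gcongr; exact Nat.le_ceil _

lemma LocallyContracts.exists_forall_heightAbove_sub_le [Nonempty M] (hM : LocallyContracts M)
    {W : Set ℝ} (hg : Θ.IsDiscretization φ η (3 * T) g W) (hη : 0 < η) {ε : ℝ} (hε : 0 < ε)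
    (hT : 0 < T) (h_nonpos : ∀ n m τ w, IsClosedChain Θ φ ε T n m τ w →
      ∑ k ∈ Finset.range n, w k ≤ 0) :
    ∃ δ > 0, ∃ C, ∀ (l : ℝ) (X : ℝ → M × ℝ), Θ.Follows φ δ T l X → ∀ t ∈ Ico 0 l,
      heightAbove g (X t) - heightAbove g (X 0) ≤ C := by
  obtain ⟨δ₀, hδ₀, B, c, hc, h_drift, -⟩ := hM.exists_hasDrift hg hη hε hT.le h_nonpos
  obtain ⟨δ₁, hδ₁, h_long⟩ :=
    h_drift.exists_of_short_steps hδ₀ hT (m := 4) (by norm_num) (by norm_num; linarith)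
  obtain ⟨δ₂, hδ₂, h_short⟩ := Θ.exists_near_skew_of_chain φ hη (T / 2) 4
  obtain ⟨b, hb⟩ := hg.finite.bddAbove
  refine ⟨min δ₁ δ₂, by positivity, max B (2 * b), fun l X hX t ht => ?_⟩
  rcases le_or_gt (2 * T) t with hTt | hTt
  · obtain ⟨N, h, hh, rfl⟩ := exists_four_mul_mul_eq hT hTt
    have h_le := h_long N (fun k => X (k * h)) h hh fun k hk =>
      (hX.near_skew_mul (by linarith [hh.1]) (by linarith [hh.2]) ht.2 hk).mono (min_le_left _ _)
    simp only [Nat.cast_zero, zero_mul] at h_le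
    exact le_max_of_le_left (h_le.trans (sub_le_self _ (by positivity)))
  · have h_four : ((4 : ℕ) : ℝ) * (t / 4) = t := by
      push_cast
      ring
    have h_lt : ((4 : ℕ) : ℝ) * (t / 4) < l := h_four.trans_lt ht.2
    have h_near := h_short (fun k => X (k * (t / 4))) (t / 4) ⟨by linarith [ht.1], by linarith⟩
      fun k hk => (hX.near_skew_mul (by linarith [ht.1]) (by linarith) h_lt hk).mono
        (min_le_right _ _)
    simp only [h_four, Nat.cast_zero, zero_mul] at h_near
    have h_jump := hb (hg.near h_near)
    have h_arc := hb (hg.skew (X 0) t ⟨ht.1, by linarith⟩)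
    exact le_max_of_le_right (by linarith)

end ShortArcs

/-! ### Quasi-Lyapunov classes -/

lemma isQuasiLyapunov_of_sum_nonpos {M : Type u} [MetricSpace M] [CompactSpace M] [ConnectedSpace M]
    (hM : LocallyContracts M) {α : CohomH1 M} {x₀ : M} {d : MetricSpace (Cover α x₀)}
    (hd : IsLocallyLiftedMetric d) {φ : Flow ℝ M} {T ε : ℝ} (hT : 0 < T) (hε : 0 < ε)
    (h_nonpos : ∀ n m τ w, IsClosedChain (cohomCocycle α) φ ε T n m τ w →
      ∑ k ∈ Finset.range n, w k ≤ 0) : IsQuasiLyapunov φ T α x₀ d := by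
  have := hM.locallyPathConnectedSpace
  intro f hf hfα
  obtain ⟨η, hη, g, W, hg⟩ := hM.exists_isDiscretization (cohomCocycle α) φ (3 * T)
  obtain ⟨δ, hδ, B, hB⟩ := hM.exists_forall_heightAbove_sub_le hg hη hε hT h_nonpos
  obtain ⟨ε', hε', h_near⟩ := exists_near_of_isPseudoOrbit hd φ T hδ
  obtain ⟨C, hC⟩ := Cover.exists_forall_abs_sub_le hd hf hfα hη hg
  refine ⟨max 0 (2 * C + B), le_max_left _ _, ε', hε', fun l γ hγ t ht => ?_⟩
  have h_height := hB l (fun s => (γ s).pt) (h_near l γ hγ) t ht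
  linarith [le_max_right 0 (2 * C + B), (abs_le.1 (hC (γ t))).2, (abs_le.1 (hC (γ 0))).1]

/-! ### Directions of periodic pseudo-orbits -/

section Directions

variable {M : Type u} [MetricSpace M] [CompactSpace M]

lemma exists_periodic_chain_of_isRealization {A : Type*} [AddCommGroup A] (Θ : PathCocycle M A)
    (φ : Flow ℝ M) {T η : ℝ} (hT : 0 < T) (hη : 0 < η) :
    ∃ ε > 0, ∀ (l : ℝ) (γ : ℝ → M) (δ : C(unitInterval, M)), IsPeriodicPseudoOrbit φ ε T l γ →
      IsRealization ε l γ δ → ∃ h ∈ Icc (T / 4) (T / 2), ∃ k n : ℕ, 0 < k ∧ 0 < n ∧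
        n * h = k * l ∧ ∃ Y : ℕ → M × A, (∀ i, Θ.Near η (Θ.skew φ h (Y i)) (Y (i + 1))) ∧
          ∀ i, Y (i + n) = raise (k • Θ δ) (Y i) := by
  obtain ⟨ε, hε, h_chain⟩ := exists_chain_of_isRealization Θ φ T hη
  refine ⟨ε, hε, fun l γ δ hγ hδ => ?_⟩
  obtain ⟨h, k, n, hTh, hhT, hk, hn, hnk⟩ := exists_sampling_step hγ.1 hT
  exact ⟨h, ⟨hTh, hhT⟩, k, n, hk, hn, hnk,
    h_chain l γ δ hγ hδ h k n (by linarith) (by linarith) hn hnk⟩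

open scoped Pointwise in
lemma LocallyContracts.exists_isCompact_forall_mem (hM : LocallyContracts M) (φ : Flow ℝ M) {T : ℝ}
    (hT : 0 < T) : ∃ ε > 0, ∃ K : Set (H1 M), @IsCompact (H1 M) (moduleTopology ℝ (H1 M)) K ∧
      ∀ (l : ℝ) (γ : ℝ → M) (h : H1 M), IsPeriodicPseudoOrbit φ ε T l γ → IsClassOf ε l γ h →
        l⁻¹ • h ∈ K := by
  let : TopologicalSpace (H1 M) := moduleTopology ℝ (H1 M)
  have : IsModuleTopology ℝ (H1 M) := ⟨rfl⟩
  have : ContinuousSMul ℝ (H1 M) := IsModuleTopology.toContinuousSMul ℝ (H1 M)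
  have : IsTopologicalAddGroup (H1 M) := IsModuleTopology.topologicalAddGroup ℝ (H1 M)
  obtain ⟨η, hη, g, W, hg⟩ := hM.exists_isDiscretization (homologyCocycle M) φ T
  obtain ⟨ε, hε, h_chain⟩ := exists_periodic_chain_of_isRealization (homologyCocycle M) φ hT hη
  let Ψ : Set (H1 M) := W + W
  have hΨ : Ψ.Finite := hg.finite.add hg.finite
  refine ⟨ε, hε, Icc 0 (4 / T) • convexHull ℝ Ψ,
    isCompact_Icc.smul_set (hΨ.isCompact_convexHull ℝ), ?_⟩
  rintro l γ h hγ ⟨δ, hδ, hh⟩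
  obtain ⟨a, ha, k, n, -, hn, hnk, Y, hY, hYn⟩ := h_chain l γ δ hγ hδ
  have hl : 0 < l := hγ.1
  have ha_pos : 0 < a := by linarith [ha.1]
  let D (i : ℕ) : H1 M := heightAbove g (Y i)
  have hD (i : ℕ) : D (i + 1) - D i ∈ Ψ :=
    ⟨_, hg.near (hY i), _, hg.skew (Y i) a ⟨ha_pos.le, by linarith [ha.2]⟩, by simp [D]⟩
  have h_sum : ∑ i ∈ Finset.range n, (D (i + 1) - D i) = (k : ℝ) • h := by
    have hY0 : Y n = raise (k • h) (Y 0) := by simpa [homologyCocycle_eq hh] using hYn 0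
    rw [Finset.sum_range_sub D]
    simp only [D, hY0, heightAbove, raise_snd, raise_fst, Nat.cast_smul_eq_nsmul]
    abel
  refine ⟨a⁻¹, ⟨by positivity, ?_⟩, (n : ℝ)⁻¹ • ((k : ℝ) • h), ?_, ?_⟩
  · rw [inv_le_comm₀ ha_pos (by positivity), inv_div]
    exact ha.1
  · rw [← h_sum, Finset.smul_sum]
    exact (convex_convexHull ℝ Ψ).sum_mem (fun _ _ => by positivity) (by simp [hn.ne'])
      fun i _ => subset_convexHull ℝ Ψ (hD i)
  · have h_coeff : a⁻¹ * ((n : ℝ)⁻¹ * k) = l⁻¹ := by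
      field_simp
      linarith
    simp only [smul_smul, h_coeff]

lemma LocallyContracts.exists_forall_neg (hM : LocallyContracts M) {φ : Flow ℝ M} {T : ℝ}
    (hT : 0 < T) {α : CohomH1 M} (hα : ∀ v ∈ asympPseudoDirections φ T, α v < 0) :
    ∃ ε > 0, ∀ (l : ℝ) (γ : ℝ → M) (h : H1 M), IsPeriodicPseudoOrbit φ ε T l γ →
      IsClassOf ε l γ h → α h < 0 := by
  let : TopologicalSpace (H1 M) := moduleTopology ℝ (H1 M)
  have : IsModuleTopology ℝ (H1 M) := ⟨rfl⟩
  have hα_cont : Continuous α := IsModuleTopology.continuous_of_linearMap α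
  obtain ⟨ε₀, hε₀, K, hK, h_mem⟩ := hM.exists_isCompact_forall_mem φ hT
  by_contra! h_contra
  choose l γ h hγ hh hαh using fun N : ℕ =>
    h_contra (min ε₀ (1 / ((N : ℝ) + 1))) (by positivity)
  obtain ⟨v, -, hv⟩ := hK.exists_mapClusterPt (f := atTop) (u := fun N => (l N)⁻¹ • h N)
    (tendsto_principal.2 (.of_forall fun N =>
      h_mem _ _ _ ((hγ N).mono (min_le_left _ _)) ((hh N).mono (min_le_left _ _))))
  have hαv : 0 ≤ α v := by
    refine (isClosed_Ici.preimage hα_cont).mem_of_mapClusterPt hv (.of_forall fun N => ?_)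
    have hl : 0 < l N := (hγ N).1
    simpa using mul_nonneg (inv_nonneg.2 hl.le) (hαh N)
  refine hαv.not_gt (hα v (mem_iInter₂.2 fun ε hε => isClosed_closure.mem_of_mapClusterPt hv ?_))
  filter_upwards [tendsto_one_div_add_atTop_nhds_zero_nat.eventually_lt_const hε] with N hN
  have h_le : min ε₀ (1 / ((N : ℝ) + 1)) ≤ ε := (min_le_right _ _).trans hN.le
  exact subset_closure ⟨l N, γ N, h N, (hγ N).mono h_le, (hh N).mono h_le, rfl⟩

lemma apply_mul_eq_raise {X A : Type*} [AddCommGroup A] {Y : ℕ → X × A} {n : ℕ} {a : A}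
    (hY : ∀ i, Y (i + n) = raise a (Y i)) (j : ℕ) : Y (j * n) = raise (j • a) (Y 0) := by
  induction j with
  | zero => simp
  | succ j ih => rw [add_mul, one_mul, hY, ih, raise_raise, succ_nsmul]

lemma nonpos_of_forall_nsmul_le {a B : ℝ} (h : ∀ j : ℕ, j • a ≤ B) : a ≤ 0 := by
  by_contra! ha
  obtain ⟨j, hj⟩ := exists_lt_nsmul ha B
  exact (h j).not_gt hj

lemma exists_nat_mul_mem_Icc {T L : ℝ} (hT : 0 < T) (hL : T ≤ L) :
    ∃ m : ℕ, 4 * L ≤ m * T ∧ m * T ≤ 6 * L := by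
  refine ⟨⌈4 * L / T⌉₊, (div_le_iff₀ hT).1 (Nat.le_ceil _), ?_⟩
  have h_lt := Nat.ceil_lt_add_one (a := 4 * L / T) (div_nonneg (by linarith) hT.le)
  calc ⌈4 * L / T⌉₊ * T ≤ (4 * L / T + 1) * T := by gcongr
    _ = 4 * L + T := by field_simp
    _ ≤ 6 * L := by linarith

lemma LocallyContracts.exists_forall_apply_le [Nonempty M] (hM : LocallyContracts M) (φ : Flow ℝ M)
    {T : ℝ} (hT : 0 < T) (α : CohomH1 M) {ε L : ℝ} (hε : 0 < ε) (hL : T ≤ L)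
    (h_neg : ∀ n m τ w, IsClosedChain (cohomCocycle α) φ ε L n m τ w →
      ∑ k ∈ Finset.range n, w k < 0) :
    ∃ ε' > 0, ∃ c > 0, ∀ (l : ℝ) (γ : ℝ → M) (h : H1 M), IsPeriodicPseudoOrbit φ ε' T l γ →
      IsClassOf ε' l γ h → α (l⁻¹ • h) ≤ -c := by
  obtain ⟨η, hη, g, W, hg⟩ := hM.exists_isDiscretization (cohomCocycle α) φ (3 * L)
  obtain ⟨η', hη', B, c, -, h_drift, hc⟩ := hM.exists_hasDrift hg hη hε (hT.le.trans hL)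
    fun n m τ w h => (h_neg n m τ w h).le
  have hc : 0 < c := hc h_neg
  obtain ⟨m, hm, hm'⟩ := exists_nat_mul_mem_Icc hT hL
  have hm_pos : (0 : ℝ) < m := pos_of_mul_pos_left (by linarith : 0 < m * T) hT.le
  obtain ⟨δ', hδ', h_short⟩ := h_drift.exists_of_short_steps hη' hT hm hm'
  obtain ⟨ε', hε', h_chain⟩ := exists_periodic_chain_of_isRealization (cohomCocycle α) φ hT hδ'
  refine ⟨ε', hε', c / (m * (T / 2)), by positivity, ?_⟩
  rintro l γ h hγ ⟨δ, hδ, hh⟩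
  obtain ⟨a, ha, k, n, hk, hn, hnk, Y, hY, hYn⟩ := h_chain l γ δ hγ hδ
  have hl : 0 < l := hγ.1
  have ha_pos : 0 < a := by linarith [ha.1]
  have hαδ : cohomCocycle α δ = α h := congrArg α (homologyCocycle_eq hh)
  have h_period : m * (k * α h) + c * n ≤ 0 := by
    refine nonpos_of_forall_nsmul_le (B := B) fun j => ?_
    have h_le := h_short (j * n) Y a ha fun i _ => hY i
    rw [← mul_assoc, apply_mul_eq_raise hYn, hαδ] at h_le
    simp only [heightAbove, raise_fst, raise_snd, nsmul_eq_mul] at h_le ⊢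
    push_cast at h_le
    linarith
  have h_le : k * α h ≤ -(c * n) / m := by
    rw [le_div_iff₀ hm_pos]
    linarith
  rw [map_smul, smul_eq_mul]
  calc l⁻¹ * α h = k * α h / (n * a) := by rw [hnk]; field_simp
    _ ≤ -(c * n) / m / (n * a) := by gcongr
    _ = -(c / (m * a)) := by field_simp
    _ ≤ -(c / (m * (T / 2))) := by gcongr; exact ha.2

omit [CompactSpace M] in
lemma apply_le_of_mem_asympPseudoDirections {φ : Flow ℝ M} {T ε C : ℝ} {α : CohomH1 M} (hε : 0 < ε)
    (h_le : ∀ (l : ℝ) (γ : ℝ → M) (h : H1 M), IsPeriodicPseudoOrbit φ ε T l γ →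
      IsClassOf ε l γ h → α (l⁻¹ • h) ≤ C) {v : H1 M} (hv : v ∈ asympPseudoDirections φ T) :
    α v ≤ C := by
  let : TopologicalSpace (H1 M) := moduleTopology ℝ (H1 M)
  have : IsModuleTopology ℝ (H1 M) := ⟨rfl⟩
  have hα_cont : Continuous α := IsModuleTopology.continuous_of_linearMap α
  refine closure_minimal (t := α ⁻¹' Iic C) ?_ (isClosed_Iic.preimage hα_cont)
    (mem_iInter₂.1 hv ε hε)
  rintro _ ⟨l, γ, h, hγ, hh, rfl⟩
  exact h_le l γ h hγ hh

end Directions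

end AsympDir

end

open AsympDir in
theorem proposition3_general {M : Type u} [MetricSpace M] [CompactSpace M] [ConnectedSpace M]
    (hM : LocallyContracts M) (φ : Flow ℝ M) (T : ℝ) (hT : 0 < T) (α : CohomH1 M) (x₀ : M)
    (d : MetricSpace (Cover α x₀)) (hd : IsLocallyLiftedMetric d) :
    (∀ v ∈ asympPseudoDirections φ T, α v < 0) ↔
      IsQuasiLyapunov φ T α x₀ d ∧ alphaRecurrentSet φ α = ∅ := by
  constructor
  · intro hα
    obtain ⟨ε, hε, h_neg⟩ := hM.exists_forall_neg hT hα
    obtain ⟨ρ, hρ, h_orbit⟩ := hM.exists_periodicPseudoOrbit φ α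
    refine ⟨isQuasiLyapunov_of_sum_nonpos hM hd hT (lt_min hε hρ) fun n m τ w hc => ?_,
      eq_empty_of_forall_notMem fun x hx => ?_⟩
    · obtain ⟨l, γ, h, hγ, -, hh, hαh⟩ := h_orbit _ (min_le_right ε ρ) T hT n m τ w hc
      exact hαh ▸ (h_neg l γ h (hγ.mono (min_le_left _ _)) (hh.mono (min_le_left _ _))).le
    · obtain ⟨l, γ, h, hγ, -, hh, hαh⟩ := hx ε hε T hT
      exact (h_neg l γ h hγ hh).ne hαh
  · rintro ⟨hQ, h_empty⟩ v hv
    obtain ⟨f, hf, hfα⟩ := Cover.exists_continuous_isEquivariant α x₀ hM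
    obtain ⟨C, -, hfC⟩ := hQ f hf hfα
    obtain ⟨ρ, hρ, h_nonpos⟩ := sum_nonpos_of_isQuasiLyapunovWith hM hd hT hfα hfC
    obtain ⟨ε, hε, L, hTL, h_ne⟩ := hM.exists_sum_ne_zero φ T h_empty
    obtain ⟨ε', hε', c, hc, h_le⟩ := hM.exists_forall_apply_le φ hT α (lt_min hε hρ) hTL
      fun n m τ w h => (h_nonpos n m τ w (h.mono (min_le_right _ _) hTL)).lt_of_ne
        (h_ne n m τ w (h.mono (min_le_left _ _) le_rfl))
    exact (apply_le_of_mem_asympPseudoDirections hε' h_le hv).trans_lt (neg_lt_zero.2 hc)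

theorem proposition3 {M : Type u} [MetricSpace M] [CompactSpace M] [ConnectedSpace M]
    (hM : AsympDir.IsTopManifold M) (φ : Flow ℝ M) (T : ℝ) (hT : 0 < T)
    (α : AsympDir.CohomH1 M) (x₀ : M)
    (d : MetricSpace (AsympDir.Cover α x₀)) (hd : AsympDir.IsLiftedMetric d) :
    (∀ v ∈ AsympDir.asympPseudoDirections φ T, α v < 0) ↔
      AsympDir.IsQuasiLyapunov φ T α x₀ d ∧ AsympDir.alphaRecurrentSet φ α = ∅ :=
  proposition3_general hM.locallyContracts φ T hT α x₀ d hd.isLocallyLiftedMetric
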